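/- **Setting.** Let $U\subset\{(v,S,\lambda):v>0\}\subset\mathbb R^3$ be open, containing $(v,S,t\lambda)$ whenever it contains $(v,S,\lambda)$ and $0\le t\le 1$. Let the pressure $p$, temperature $T>0$, free energy increment $\Delta F$ and reaction rate $r$ be smooth (in particular, possibly real analytic) real functions on $U$ with $r=r_v=r_S=0$ where $\lambda=0$ and $r_\lambda<0$ on $U$. Put $\Phi=-r\,\Delta F/T$ and $c_0=\sqrt{-v^2p_v}$. Let $(v,u,S,\lambda)(x)$ be smooth on $[0,\infty)$, with $(v,S,\lambda)(x)\in U$, and solve the steady ZND equations $$uv'-vu'=0,\qquad uu'+v\,p'=0,\qquad uS'=\Phi,\qquad u\lambda'=r .$$ Assume that $\kappa:=u/c_0$ takes values in a compact subinterval of $(0,1)$ and $u$ in a compact subinterval of $(0,\infty)$, and that $(v,u,S,\lambda)(x)$ converges at a rate $O(e^{-\beta x})$, $\beta>0$, as $x\to\infty$ to a limit $(v_\infty,u_\infty,S_\infty,\lambda_\infty)$ with $(v_\infty,S_\infty,\lambda_\infty)\in U$. Write $\eta=1-\kappa^2$ and $m=u/v$, and along the profile let $$A_x=\begin{pmatrix}u&-v&0&0&0\\vp_v&u&0&vp_S&vp_\lambda\\0&0&u&0&0\\0&0&0&u&0\\0&0&0&0&u\end{pmatrix},\qquad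 A_y=\begin{pmatrix}0&0&-v&0&0\\0&0&0&0&0\\vp_v&0&0&vp_S&vp_\lambda\\0&0&0&0&0\\0&0&0&0&0\end{pmatrix},$$ $$B=\begin{pmatrix}-u'&v'&0&0&0\\p'-v(c_0^2/v^2)'&u'&0&v(p_S)'&v(p_\lambda)'\\0&0&0&0&0\\-\Phi_v&S'&0&-\Phi_S&-\Phi_\lambda\\-r_v&\lambda'&0&-r_S&-r_\lambda\end{pmatrix},$$ where $'=d/dx$. Consider $$\theta'=-P^t(x,\tau,\varepsilon)\,\theta\ \text{ on }[0,\infty),\qquad P=-A_x^{-1}(\tau I+i\varepsilon A_y+B). \tag{1}$$ For $\operatorname{Re}\zeta\ge0$ let $s(x,\zeta)=\sqrt{\zeta^2+c_0^2\eta}$, with the branch that is positive when $\zeta^2+c_0^2\eta>0$, has $\operatorname{Re}s>0$ when $\operatorname{Re}\zeta>0$, and equals $\pm i|s|$ when $\zeta=\pm i|\zeta|$ and $\zeta^2+c_0^2\eta<0$. Let $\mu_1=-\kappa(\kappa\zeta+s)/(\eta u)$, let $\mu_1(\infty,\zeta)$ be its value at the limiting state, and let $$T(x,\zeta)e_1=\Big(\frac{ms}{\kappa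 u},\ \frac{\zeta}{u},\ -i,\ -\frac{\kappa p_S s}{um},\ -\frac{\kappa p_\lambda s}{um}\Big)^t .$$ Class III is the set of $\zeta$ with $\operatorname{Re}\zeta=0$ and $\inf_{x\ge0}c_0\eta^{1/2}\le|\zeta|\le\sup_{x\ge0}c_0\eta^{1/2}$. For $\operatorname{Re}\tau\ge0$, $\varepsilon>0$, a *decaying solution* of (1) is a solution $\theta$, bounded on $[0,\infty)$, for which $e^{-\varepsilon\mu_1(\infty,\tau/\varepsilon)x}\theta(x)$ has a nonzero limit as $x\to\infty$. It is called *the exact decaying solution* (which fixes it up to a scalar factor) if every decaying solution is a scalar multiple of it and, when $\operatorname{Re}\tau>0$, every bounded solution of (1) is a scalar multiple of it. **Statement.** The scalar factors can be chosen so that there are functions $\theta(x,\tau,\varepsilon)$ with the following properties. 1. For every $\zeta$ with $\operatorname{Re}\zeta\ge0$, $\zeta\notin$ Class III, and every $R$, there are constants $C$ and $\varepsilon_0>0$, depending on $\zeta$ and $R$, such that for all $\varepsilon\ge\varepsilon_0$ and all $\nu$ with $\operatorname{Re}\nu\ge0$, $|\nu|\le R$, with $\tau=\varepsilon\zeta+\nu$,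 the function $\theta(\cdot,\tau,\varepsilon)$ is the exact decaying solution of (1) and $$|\theta(0,\tau,\varepsilon)-T(0,\zeta)e_1|\le C/\varepsilon .$$ 2. For every compact $K\subset\{\operatorname{Re}\zeta\ge0\}\setminus\text{Class III}$ and every $R$, the constants $C$ and $\varepsilon_0$ can be chosen to depend only on $K$ and $R$, uniformly for $\zeta\in K$. -/

import Mathlib

open Set Filter Topology
open scoped ContDiff Matrix

noncomputable section

namespace ZND

/-! Thermodynamic states are triples `(v, S, lam)`: specific volume, entropy, and mass fraction
of reactant. -/

/-- `∂f/∂v`. -/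
def partialV (f : ℝ × ℝ × ℝ → ℝ) (z : ℝ × ℝ × ℝ) : ℝ := fderiv ℝ f z (1, 0, 0)

/-- `∂f/∂S`. -/
def partialS (f : ℝ × ℝ × ℝ → ℝ) (z : ℝ × ℝ × ℝ) : ℝ := fderiv ℝ f z (0, 1, 0)

/-- `∂f/∂lam`. -/
def partialLam (f : ℝ × ℝ × ℝ → ℝ) (z : ℝ × ℝ × ℝ) : ℝ := fderiv ℝ f z (0, 0, 1)

/-- The thermodynamic functions of the ZND system: pressure, temperature, free energy increment
and reaction rate, smooth on an open set `U` of admissible states.  The set `U` contains, with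
each state, the states obtained from it by burning reactant at fixed `(v, S)`. -/
structure ThermoModel where
  U : Set (ℝ × ℝ × ℝ)
  p : ℝ × ℝ × ℝ → ℝ
  temp : ℝ × ℝ × ℝ → ℝ
  deltaF : ℝ × ℝ × ℝ → ℝ
  r : ℝ × ℝ × ℝ → ℝ
  isOpen_U : IsOpen U
  burn_mem : ∀ v S lam t : ℝ, (v, S, lam) ∈ U → 0 ≤ t → t ≤ 1 → (v, S, t * lam) ∈ U
  v_pos : ∀ z ∈ U, 0 < z.1
  temp_pos : ∀ z ∈ U, 0 < temp z
  contDiffOn_p : ContDiffOn ℝ ∞ p U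
  contDiffOn_temp : ContDiffOn ℝ ∞ temp U
  contDiffOn_deltaF : ContDiffOn ℝ ∞ deltaF U
  contDiffOn_r : ContDiffOn ℝ ∞ r U

namespace ThermoModel

variable (M : ThermoModel)

/-- Entropy production `Φ = - r ΔF / T`. -/
def entropySource (z : ℝ × ℝ × ℝ) : ℝ := -(M.r z * M.deltaF z) / M.temp z

/-- Sound speed, `c₀² = - v² p_v`. -/
def c0 (z : ℝ × ℝ × ℝ) : ℝ := Real.sqrt (-(z.1 ^ 2 * partialV M.p z))

/-- `r = r_v = r_S = 0` where `lam = 0`, and `r_lam < 0`. -/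
structure RateAssumption : Prop where
  r_eq_zero : ∀ v S : ℝ, (v, S, 0) ∈ M.U → M.r (v, S, 0) = 0
  r_v_eq_zero : ∀ v S : ℝ, (v, S, 0) ∈ M.U → partialV M.r (v, S, 0) = 0
  r_S_eq_zero : ∀ v S : ℝ, (v, S, 0) ∈ M.U → partialS M.r (v, S, 0) = 0
  r_lam_neg : ∀ z ∈ M.U, partialLam M.r z < 0

end ThermoModel

/-! Algebraic quantities attached to a particle speed `u` and a sound speed `c` (with `u < c`). -/

/-- `κ = u / c`. -/
def kappaOf (u c : ℝ) : ℝ := u / c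

/-- `η = 1 - κ²`. -/
def etaOf (u c : ℝ) : ℝ := 1 - kappaOf u c ^ 2

/-- The branch of `√(z² + a²)` (for `a > 0`) on `0 ≤ Re z` which is positive where `z² + a² > 0`,
and equal to `± i |z² + a²|^(1/2)` for `z = ± i |z|` with `|z| > a`.  Since `z ∓ i a` have
nonnegative real part there, it is the product of their principal square roots. -/
def sqrtBranch (a : ℝ) (z : ℂ) : ℂ :=
  (z - Complex.I * a) ^ (1 / 2 : ℂ) * (z + Complex.I * a) ^ (1 / 2 : ℂ)

/-- `s = √(ζ² + c² η)`. -/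
def sOf (u c : ℝ) (ζ : ℂ) : ℂ := sqrtBranch (c * Real.sqrt (etaOf u c)) ζ

/-- `μ₁ = - κ (κ ζ + s) / (η u)`. -/
def mu1Of (u c : ℝ) (ζ : ℂ) : ℂ :=
  -((kappaOf u c : ℂ) * (kappaOf u c * ζ + sOf u c ζ)) / ((etaOf u c : ℂ) * u)

/-- The reaction zone `x ≥ 0` of a steady planar strong detonation profile
`w = (v, u, 0, 0, S, lam)`, with its limiting state at `x = ∞`.  Only values at `x ≥ 0` matter. -/
structure Profile (M : ThermoModel) where
  v : ℝ → ℝ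
  u : ℝ → ℝ
  S : ℝ → ℝ
  lam : ℝ → ℝ
  vInf : ℝ
  uInf : ℝ
  SInf : ℝ
  lamInf : ℝ
  contDiffOn_v : ContDiffOn ℝ ∞ v (Ici 0)
  contDiffOn_u : ContDiffOn ℝ ∞ u (Ici 0)
  contDiffOn_S : ContDiffOn ℝ ∞ S (Ici 0)
  contDiffOn_lam : ContDiffOn ℝ ∞ lam (Ici 0)
  mem_U : ∀ x, 0 ≤ x → (v x, S x, lam x) ∈ M.U
  inf_mem_U : (vInf, SInf, lamInf) ∈ M.U
  /-- conservation of mass -/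
  mass : ∀ x, 0 ≤ x → u x * derivWithin v (Ici 0) x - v x * derivWithin u (Ici 0) x = 0
  /-- conservation of momentum -/
  momentum : ∀ x, 0 ≤ x → u x * derivWithin u (Ici 0) x
    + v x * derivWithin (fun y => M.p (v y, S y, lam y)) (Ici 0) x = 0
  /-- entropy equation -/
  entropy : ∀ x, 0 ≤ x →
    u x * derivWithin S (Ici 0) x = M.entropySource (v x, S x, lam x)
  /-- reaction equation -/
  reaction : ∀ x, 0 ≤ x → u x * derivWithin lam (Ici 0) x = M.r (v x, S x, lam x)
  /-- uniformly subsonic flow -/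
  kappa_bounds : ∃ C₁ C₂ : ℝ, 0 < C₁ ∧ C₂ < 1 ∧ ∀ x, 0 ≤ x →
    C₁ ≤ kappaOf (u x) (M.c0 (v x, S x, lam x)) ∧ kappaOf (u x) (M.c0 (v x, S x, lam x)) ≤ C₂
  /-- particle velocity in a compact subinterval of `(0, ∞)` -/
  u_bounds : ∃ C₁ C₂ : ℝ, 0 < C₁ ∧ ∀ x, 0 ≤ x → C₁ ≤ u x ∧ u x ≤ C₂
  /-- exponential convergence to the end state -/
  exp_decay : ∃ C β : ℝ, 0 < C ∧ 0 < β ∧ ∀ x, 0 ≤ x →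
    |v x - vInf| ≤ C * Real.exp (-β * x) ∧ |u x - uInf| ≤ C * Real.exp (-β * x) ∧
    |S x - SInf| ≤ C * Real.exp (-β * x) ∧ |lam x - lamInf| ≤ C * Real.exp (-β * x)

namespace Profile

variable {M : ThermoModel} (D : Profile M)

/-- Thermodynamic state at `x`. -/
def state (x : ℝ) : ℝ × ℝ × ℝ := (D.v x, D.S x, D.lam x)

/-- Sound speed at `x`. -/
def c0 (x : ℝ) : ℝ := M.c0 (D.state x)

/-- Sound speed at `x = ∞`. -/
def c0Inf : ℝ := M.c0 (D.vInf, D.SInf, D.lamInf)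

/-- `κ(x)`. -/
def kappa (x : ℝ) : ℝ := kappaOf (D.u x) (D.c0 x)

/-- `η(x)`. -/
def eta (x : ℝ) : ℝ := etaOf (D.u x) (D.c0 x)

/-- Mass flux `m = u / v` (constant in `x`). -/
def m (x : ℝ) : ℝ := D.u x / D.v x

/-- `s(x, ζ)`. -/
def s (x : ℝ) (ζ : ℂ) : ℂ := sOf (D.u x) (D.c0 x) ζ

/-- `d/dx` on the reaction zone `[0, ∞)`. -/
def ddx (f : ℝ → ℝ) (x : ℝ) : ℝ := derivWithin f (Ici 0) x

/-- The coefficient matrix `A_x`. -/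
def Ax (x : ℝ) : Matrix (Fin 5) (Fin 5) ℝ :=
  let u := D.u x
  let v := D.v x
  let z := D.state x
  !![u, -v, 0, 0, 0;
     v * partialV M.p z, u, 0, v * partialS M.p z, v * partialLam M.p z;
     0, 0, u, 0, 0;
     0, 0, 0, u, 0;
     0, 0, 0, 0, u]

/-- The coefficient matrix `A_y`. -/
def Ay (x : ℝ) : Matrix (Fin 5) (Fin 5) ℝ :=
  let v := D.v x
  let z := D.state x
  !![0, 0, -v, 0, 0;
     0, 0, 0, 0, 0;
     v * partialV M.p z, 0, 0, v * partialS M.p z, v * partialLam M.p z;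
     0, 0, 0, 0, 0;
     0, 0, 0, 0, 0]

/-- The coefficient matrix `B`. -/
def B (x : ℝ) : Matrix (Fin 5) (Fin 5) ℝ :=
  let v := D.v x
  let z := D.state x
  let Φ := M.entropySource
  !![-ddx D.u x, ddx D.v x, 0, 0, 0;
     ddx (fun y => M.p (D.state y)) x - v * ddx (fun y => D.c0 y ^ 2 / D.v y ^ 2) x, ddx D.u x, 0,
       v * ddx (fun y => partialS M.p (D.state y)) x,
       v * ddx (fun y => partialLam M.p (D.state y)) x;
     0, 0, 0, 0, 0;
     -partialV Φ z, ddx D.S x, 0, -partialS Φ z, -partialLam Φ z;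
     -partialV M.r z, ddx D.lam x, 0, -partialS M.r z, -partialLam M.r z]

/-- `P = - A_x⁻¹ (τ I + i ε A_y + B)`. -/
def P (x : ℝ) (τ : ℂ) (ε : ℝ) : Matrix (Fin 5) (Fin 5) ℂ :=
  -(((D.Ax x)⁻¹.map Complex.ofReal) *
    (τ • (1 : Matrix (Fin 5) (Fin 5) ℂ) + (Complex.I * ε) • (D.Ay x).map Complex.ofReal
      + (D.B x).map Complex.ofReal))

/-- `θ` solves the transposed equation `θ' = - Pᵗ θ` on `[0, ∞)`. -/
def IsSolution (τ : ℂ) (ε : ℝ) (θ : ℝ → Fin 5 → ℂ) : Prop :=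
  ∀ x, 0 ≤ x → HasDerivWithinAt θ (-((D.P x τ ε)ᵀ *ᵥ θ x)) (Ici 0) x

/-- Boundedness on `[0, ∞)`. -/
def IsBoundedFun (θ : ℝ → Fin 5 → ℂ) : Prop := ∃ C : ℝ, ∀ x, 0 ≤ x → ‖θ x‖ ≤ C

/-- The fast mode at `x = ∞`: `ε μ₁(∞, τ/ε)`, which for `Re τ > 0` is the only eigenvalue of the
limiting matrix `- Pᵗ(∞, τ, ε)` with negative real part.  For `Re τ = 0`, where boundedness alone
need not single out one solution, it still distinguishes the limits of the decaying solutions. -/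
def fastMode (τ : ℂ) (ε : ℝ) : ℂ := (ε : ℂ) * mu1Of D.uInf D.c0Inf (τ / (ε : ℂ))

/-- `θ` is a bounded solution that behaves at `x = ∞` like a nonzero multiple of the fast mode,
`θ(x) = e^{ε μ₁(∞, τ/ε) x} (c + o(1))`. -/
structure IsDecayingSolution (τ : ℂ) (ε : ℝ) (θ : ℝ → Fin 5 → ℂ) : Prop where
  solves : D.IsSolution τ ε θ
  bounded : IsBoundedFun θ
  asymptotic : ∃ c : Fin 5 → ℂ, c ≠ 0 ∧
    Tendsto (fun x : ℝ => Complex.exp (-(D.fastMode τ ε * x)) • θ x) atTop (𝓝 c)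

/-- `θ` is *the* decaying solution: it is one, every other one is a multiple of it and, for
`Re τ > 0`, so is every solution that is merely bounded. -/
structure IsExactDecayingSolution (τ : ℂ) (ε : ℝ) (θ : ℝ → Fin 5 → ℂ) : Prop where
  decaying : D.IsDecayingSolution τ ε θ
  unique : ∀ ψ : ℝ → Fin 5 → ℂ, D.IsDecayingSolution τ ε ψ →
    ∃ c : ℂ, ∀ x, 0 ≤ x → ψ x = c • θ x
  unique_of_bounded : 0 < τ.re → ∀ ψ : ℝ → Fin 5 → ℂ, D.IsSolution τ ε ψ → IsBoundedFun ψ →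
    ∃ c : ℂ, ∀ x, 0 ≤ x → ψ x = c • θ x

/-- The matrix `T(x, ζ)` whose columns are the eigenvectors of the leading-order matrix
`{A_x⁻¹ (ζ I + i A_y)}ᵗ`; the first one belongs to `μ₁`. -/
def T (x : ℝ) (ζ : ℂ) : Matrix (Fin 5) (Fin 5) ℂ :=
  let u : ℂ := D.u x
  let m : ℂ := D.m x
  let κ : ℂ := D.kappa x
  let η : ℂ := D.eta x
  let pS : ℂ := partialS M.p (D.state x)
  let pL : ℂ := partialLam M.p (D.state x)
  let s : ℂ := D.s x ζ
  let i : ℂ := Complex.I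
  !![m * s / (κ * u), -(m * s / (κ * u)), -(i * m / (1 - η)), 0, 0;
     ζ / u, ζ / u, i, 0, 0;
     -i, -i, ζ / u, 0, 0;
     -(κ * pS * s / (u * m)), κ * pS * s / (u * m), 0, 1, 0;
     -(κ * pL * s / (u * m)), κ * pL * s / (u * m), 0, 0, 1]

/-- The first column `T(x, ζ) e₁`. -/
def Te1 (x : ℝ) (ζ : ℂ) : Fin 5 → ℂ := D.T x ζ *ᵥ Pi.single 0 1

/-- The values of `c₀ √η` on `[0, ∞)`. -/
def turningValues : Set ℝ := (fun x => D.c0 x * Real.sqrt (D.eta x)) '' Ici 0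

/-- Class III: `Re ζ = 0` and `inf c₀ √η ≤ |ζ| ≤ sup c₀ √η`. -/
def classIII : Set ℂ :=
  {ζ | ζ.re = 0 ∧ sInf D.turningValues ≤ ‖ζ‖ ∧ ‖ζ‖ ≤ sSup D.turningValues}

end Profile

/-- Euclidean length of a vector in `ℂ⁵`. -/
def euclid (w : Fin 5 → ℂ) : ℝ := ‖(WithLp.toLp 2 w : EuclideanSpace ℂ (Fin 5))‖

end ZND

end

/-!
# Exact decaying solutions of the high-frequency adjoint ZND equations

Replacing `ζ` by `ζ + ν / ε` turns `τ = ε ζ + ν` into `τ = ε ζ`, at the price of an error `O(1 / ε)`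
in `T(0, ζ) e₁`, which is Lipschitz in `ζ` away from the branch points `± i c₀ √η` of `s`.  So it is
enough to treat `θ' = (ε G(x, ζ) + H(x)) θ`, uniformly for `ζ` in a bounded set at positive distance
from all branch points.

The eigenvalues of `G` are the acoustic ones `μ₁`, `μ₂` and the triple one `μ₃ = ζ / u`, with
`Re μ₁ ≤ 0 ≤ Re μ₂, Re μ₃`.  The gaps `μ₂ - μ₁ = 2 c₀ s / q` and
`μ₃ - μ₁ = c₀ (c₀ ζ + u s) / (u q)`, where `q = c₀² - u²`, are bounded away from zero, because `s`
lies in the same quadrant as `ζ`.  However, `μ₂ = μ₃` at `ζ = u`, where `G` is not diagonalizable.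
Explicit matrices of modes (`leftModes_mul_symbol`) bring `G` to a diagonal matrix plus one entry
`b` that couples `μ₃` into `μ₂`: for small `Re ζ` one can take `b = 0`
(`exists_decaying_of_re_le`); for `Re ζ` bounded below `b` is dominated by `Re μ₂`
(`exists_decaying_of_le_re`).

The remaining order-one matrix `N` decays exponentially in all rows but the last.  This is where the
assumptions on the rate enter: no reactant is left at the end state (`lamInf_eq_zero`), so `r`,
`r_v`, `r_S`, `Φ`, `Φ_v`, `Φ_S` vanish there, and only the last column of `B` survives
(`source_pathInf`).  In the last row the diagonal entry tends to `-r_λ / u > 0`, which is growth and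
hence does no harm.  One change of variables `1 + c / ε`, where `c` sits in the column of `μ₁`, makes
the action of the mode `μ₁` on the others `O(e^{-βx} / ε)` (`SpectralData.normalForm`).

After division by `exp (ε ∫ μ₁)` the mode `0` is neutral up to integrable terms and the other modes
do not decay.  A comparison argument for the weighted norms of the components
(`NormalForm.backward_bound`), applied to solutions started at large `x` and carried back to `x = 0`,
yields a solution that is `e₀ + O(e^{-βx})`, with components `≠ 0` of size `O(e^{-βx} / ε)`
(`NormalForm.exists_solution`); the same estimate, applied to the difference of a solution and its
matching multiple of this one, gives uniqueness (`NormalForm.unique`).  Undoing the transformations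
(`SpectralData.exists_decaying`), the value at `0` is the first column `T(0, ζ) e₁` of the inverse
mode matrix, up to a scalar factor and `O(1 / ε)`.

The scalar factors are fixed by giving component `2` at `x = 0` the value `-i` it has in `T e₁`
(`normalizedSolution`); uniqueness makes this choice depend on `(τ, ε)` only, and not on `ζ`.
-/

noncomputable section

namespace ZND

/-! ### Comparison principle -/

/-- An invariance principle of Nagumo type: a finite family of functions that starts nonnegative,
and each of whose members has positive derivative whenever it vanishes while the others are
nonnegative, stays nonnegative. -/
lemma forall_nonneg_of_deriv_pos {ι : Type*} [Finite ι] {φ φ' : ι → ℝ → ℝ} {a b : ℝ}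
    (hφ : ∀ i, ∀ t ∈ Icc a b, HasDerivWithinAt (φ i) (φ' i t) (Icc a b) t)
    (h0 : ∀ i, 0 ≤ φ i a)
    (h : ∀ t ∈ Ico a b, (∀ j, 0 ≤ φ j t) → ∀ i, φ i t = 0 → 0 < φ' i t) :
    ∀ t ∈ Icc a b, ∀ i, 0 ≤ φ i t := by
  rcases lt_or_ge b a with hab | hab
  · intro t ht
    exact absurd (ht.1.trans ht.2) (not_le.2 hab)
  have hcl : IsClosed ({t | ∀ i, 0 ≤ φ i t} ∩ Icc a b) := by
    have : {t | ∀ i, 0 ≤ φ i t} ∩ Icc a b = Icc a b ∩ ⋂ i, (Icc a b ∩ φ i ⁻¹' Ici 0) := by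
      ext t
      simp only [mem_inter_iff, mem_ofPred_eq, mem_iInter, mem_preimage, mem_Ici]
      exact ⟨fun h => ⟨h.2, fun i => ⟨h.2, h.1 i⟩⟩, fun h => ⟨fun i => (h.2 i).2, h.1⟩⟩
    rw [this]
    refine isClosed_Icc.inter (isClosed_iInter fun i => ?_)
    exact ContinuousOn.preimage_isClosed_of_isClosed
      (fun t ht => (hφ i t ht).continuousWithinAt) isClosed_Icc isClosed_Ici
  refine hcl.Icc_subset_of_forall_exists_gt h0 ?_
  rintro t ⟨ht, htab⟩ y hy
  have hmem : Icc a b ∈ 𝓝[>] t := Icc_mem_nhdsGT_of_mem htab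
  have key : ∀ i, ∀ᶠ z in 𝓝[>] t, 0 ≤ φ i z := by
    intro i
    have hd := (hφ i t (Ico_subset_Icc_self htab)).mono_of_mem_nhdsWithin hmem
    rcases (ht i).eq_or_lt with h' | h'
    · have hpos := h t htab ht i h'.symm
      have hs := (hasDerivWithinAt_iff_tendsto_slope' (by simp)).1 hd
      filter_upwards [hs.eventually (lt_mem_nhds hpos), self_mem_nhdsWithin] with z hz hz'
      rw [slope_def_field, ← h', sub_zero] at hz
      have : 0 < z - t := sub_pos.2 hz'
      exact ((div_pos_iff_of_pos_right this).1 hz).le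
    · exact (hd.continuousWithinAt.eventually (lt_mem_nhds h')).mono fun z hz => hz.le
  have := (eventually_all.2 key).and (Ioc_mem_nhdsGT hy)
  obtain ⟨z, hz1, hz2⟩ := this.exists
  exact ⟨z, hz1, hz2⟩

/-- Forward comparison of the moduli of complex functions with prescribed bounds. -/
lemma norm_le_of_deriv_lt {ι : Type*} [Finite ι] {Y Y' : ι → ℝ → ℂ} {B B' : ι → ℝ → ℝ} {a b : ℝ}
    (hY : ∀ i, ∀ t ∈ Icc a b, HasDerivWithinAt (Y i) (Y' i t) (Icc a b) t)
    (hB : ∀ i, ∀ t ∈ Icc a b, HasDerivWithinAt (B i) (B' i t) (Icc a b) t)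
    (hBnn : ∀ i, ∀ t ∈ Icc a b, 0 ≤ B i t)
    (h0 : ∀ i, ‖Y i a‖ ≤ B i a)
    (h : ∀ t ∈ Icc a b, (∀ j, ‖Y j t‖ ≤ B j t) → ∀ i, ‖Y i t‖ = B i t →
      inner ℝ (Y i t) (Y' i t) < B i t * B' i t) :
    ∀ t ∈ Icc a b, ∀ i, ‖Y i t‖ ≤ B i t := by
  intro t ht i
  have hab : a ≤ b := ht.1.trans ht.2
  have hiff : ∀ s ∈ Icc a b, ∀ j, 0 ≤ B j s ^ 2 - ‖Y j s‖ ^ 2 ↔ ‖Y j s‖ ≤ B j s := by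
    intro s hs j
    rw [sub_nonneg, sq_le_sq₀ (norm_nonneg _) (hBnn j s hs)]
  rw [← hiff t ht i]
  refine forall_nonneg_of_deriv_pos (φ := fun j s => B j s ^ 2 - ‖Y j s‖ ^ 2)
    (φ' := fun j s => 2 * (B j s * B' j s) - 2 * inner ℝ (Y j s) (Y' j s)) ?_ ?_ ?_ t ht i
  · intro j s hs
    have h1 := (hB j s hs).pow 2
    have h2 := (hY j s hs).norm_sq
    refine (h1.sub h2).congr_deriv ?_
    simp only [Nat.cast_ofNat]
    ring
  · intro j
    exact (hiff a ⟨le_rfl, hab⟩ j).2 (h0 j)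
  · intro s hs hs' j hj
    have hs2 := Ico_subset_Icc_self hs
    have hj' : ‖Y j s‖ = B j s := by
      have : ‖Y j s‖ ^ 2 = B j s ^ 2 := by linarith
      exact (sq_eq_sq₀ (norm_nonneg _) (hBnn j s hs2)).1 this
    have := h s hs2 (fun k => (hiff s hs2 k).1 (hs' k)) j hj'
    linarith

/-- Backward comparison of the moduli of complex functions with prescribed bounds. -/
lemma norm_le_of_lt_deriv {ι : Type*} [Finite ι] {Y Y' : ι → ℝ → ℂ} {B B' : ι → ℝ → ℝ} {a b : ℝ}
    (hY : ∀ i, ∀ t ∈ Icc a b, HasDerivWithinAt (Y i) (Y' i t) (Icc a b) t)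
    (hB : ∀ i, ∀ t ∈ Icc a b, HasDerivWithinAt (B i) (B' i t) (Icc a b) t)
    (hBnn : ∀ i, ∀ t ∈ Icc a b, 0 ≤ B i t)
    (h0 : ∀ i, ‖Y i b‖ ≤ B i b)
    (h : ∀ t ∈ Icc a b, (∀ j, ‖Y j t‖ ≤ B j t) → ∀ i, ‖Y i t‖ = B i t →
      B i t * B' i t < inner ℝ (Y i t) (Y' i t)) :
    ∀ t ∈ Icc a b, ∀ i, ‖Y i t‖ ≤ B i t := by
  have hmaps : MapsTo (fun s : ℝ => -s) (Icc (-b) (-a)) (Icc a b) := fun s hs =>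
    ⟨by linarith [hs.2], by linarith [hs.1]⟩
  have hneg : ∀ s ∈ Icc (-b) (-a), HasDerivWithinAt (fun s : ℝ => -s) (-1) (Icc (-b) (-a)) s :=
    fun s _ => (hasDerivAt_neg s).hasDerivWithinAt
  intro t ht i
  have key := norm_le_of_deriv_lt (Y := fun j s => Y j (-s)) (Y' := fun j s => -Y' j (-s))
    (B := fun j s => B j (-s)) (B' := fun j s => -B' j (-s)) (a := -b) (b := -a)
    (fun j s hs => by
      have := (hY j (-s) (hmaps hs)).scomp s (hneg s hs) hmaps
      simpa [Function.comp_def] using this)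
    (fun j s hs => by
      have := (hB j (-s) (hmaps hs)).scomp s (hneg s hs) hmaps
      simpa [Function.comp_def] using this)
    (fun j s hs => hBnn j (-s) (hmaps hs))
    (fun j => by simpa using h0 j)
    (fun s hs hs' j hj => by
      have := h (-s) (hmaps hs) hs' j hj
      simp only [inner_neg_right, mul_neg]
      linarith)
    (-t) ⟨by linarith [ht.2], by linarith [ht.1]⟩ i
  simpa using key

lemma le_inner_mul_add (y m r : ℂ) :
    ‖y‖ * (m.re * ‖y‖ - ‖r‖) ≤ inner ℝ y (m * y + r) := by
  have h1 : inner ℝ y (m * y) = m.re * ‖y‖ ^ 2 := by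
    rw [Complex.inner, ← Complex.normSq_eq_norm_sq, mul_assoc, Complex.mul_conj,
      Complex.re_mul_ofReal]
  have h2 := abs_real_inner_le_norm y r
  rw [inner_add_right, h1]
  nlinarith [neg_abs_le (inner ℝ y r)]

/-! ### Linear differential equations on a half line -/

/-- Existence for linear equations with bounded continuous coefficients, by a fixed point argument
in an exponentially weighted sup norm. -/
lemma exists_solution_of_bounded {E : Type*} [NormedAddCommGroup E] [NormedSpace ℝ E]
    [CompleteSpace E] (A : ℝ → E →L[ℝ] E) (hA : Continuous A) (C : ℝ) (hC : ∀ t, ‖A t‖ ≤ C)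
    (x₀ : E) :
    ∃ x : ℝ → E, x 0 = x₀ ∧ ∀ t, 0 ≤ t → HasDerivWithinAt x (A t (x t)) (Ici 0) t := by
  have hC0 : 0 ≤ C := (norm_nonneg _).trans (hC 0)
  obtain ⟨l, hl0, hl⟩ : ∃ l : ℝ, 0 < l ∧ C / l ≤ 1 / 2 :=
    ⟨2 * C + 1, by positivity, by rw [div_le_iff₀ (by positivity)]; linarith⟩
  have hint : ∀ y : BoundedContinuousFunction ℝ E,
      Continuous fun s => Real.exp (l * s) • A s (y s) := fun y =>
    (by fun_prop : Continuous fun s : ℝ => Real.exp (l * s)).smul (hA.clm_apply y.continuous)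
  have hprim : ∀ y : BoundedContinuousFunction ℝ E,
      Continuous fun t => ∫ s in (0:ℝ)..t, Real.exp (l * s) • A s (y s) := fun y =>
    continuous_iff_continuousAt.2 fun t =>
      (intervalIntegral.integral_hasDerivAt_right ((hint y).intervalIntegrable _ _)
        ((hint y).stronglyMeasurableAtFilter _ _) (hint y).continuousAt).continuousAt
  have hexp : ∀ t, ∫ s in (0:ℝ)..t, Real.exp (l * s) = (Real.exp (l * t) - 1) / l := by
    intro t
    rw [intervalIntegral.integral_comp_mul_left (fun s => Real.exp s) hl0.ne']
    simp [div_eq_inv_mul]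
  have hbd : ∀ y : BoundedContinuousFunction ℝ E, ∀ t, 0 ≤ t →
      ‖Real.exp (-(l * t)) • ∫ s in (0:ℝ)..t, Real.exp (l * s) • A s (y s)‖ ≤ 1 / 2 * ‖y‖ := by
    intro y t ht
    have h1 : ‖∫ s in (0:ℝ)..t, Real.exp (l * s) • A s (y s)‖
        ≤ ∫ s in (0:ℝ)..t, (C * ‖y‖) * Real.exp (l * s) := by
      refine intervalIntegral.norm_integral_le_of_norm_le ht ?_
        (Continuous.intervalIntegrable (by fun_prop) _ _)
      refine Eventually.of_forall fun s _ => ?_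
      rw [norm_smul, Real.norm_eq_abs, abs_of_pos (Real.exp_pos _), mul_comm]
      refine mul_le_mul_of_nonneg_right ?_ (Real.exp_pos _).le
      exact ((A s).le_opNorm _).trans (mul_le_mul (hC s) (y.norm_coe_le_norm s) (norm_nonneg _) hC0)
    rw [intervalIntegral.integral_const_mul, hexp] at h1
    rw [norm_smul, Real.norm_eq_abs, abs_of_pos (Real.exp_pos _)]
    calc _ ≤ Real.exp (-(l * t)) * (C * ‖y‖ * ((Real.exp (l * t) - 1) / l)) := by gcongr
      _ = C / l * ‖y‖ * (1 - Real.exp (-(l * t))) := by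
        have : Real.exp (-(l * t)) * Real.exp (l * t) = 1 := by
          rw [← Real.exp_add]; simp
        field_simp
        linear_combination (C * ‖y‖) * this
      _ ≤ C / l * ‖y‖ * 1 := by
        gcongr
        linarith [Real.exp_pos (-(l * t))]
      _ ≤ _ := by rw [mul_one]; gcongr
  let T : BoundedContinuousFunction ℝ E → BoundedContinuousFunction ℝ E := fun y =>
    BoundedContinuousFunction.ofNormedAddCommGroup
      (fun t => Real.exp (-(l * max t 0)) •
        (x₀ + ∫ s in (0:ℝ)..(max t 0), Real.exp (l * s) • A s (y s)))
      ((by fun_prop : Continuous fun t : ℝ => Real.exp (-(l * max t 0))).smul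
        (continuous_const.add ((hprim y).comp (continuous_id.max continuous_const))))
      (‖x₀‖ + 1 / 2 * ‖y‖) (fun t => by
        rw [smul_add]
        refine (norm_add_le _ _).trans (add_le_add ?_ (hbd y _ (le_max_right _ _)))
        rw [norm_smul, Real.norm_eq_abs, abs_of_pos (Real.exp_pos _)]
        have : Real.exp (-(l * max t 0)) ≤ 1 := by
          rw [Real.exp_le_one_iff, neg_nonpos]
          exact mul_nonneg hl0.le (le_max_right _ _)
        nlinarith [norm_nonneg x₀])
  have hT : ∀ y t, T y t = Real.exp (-(l * max t 0)) •
        (x₀ + ∫ s in (0:ℝ)..(max t 0), Real.exp (l * s) • A s (y s)) := fun _ _ => rfl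
  have hcontr : ContractingWith (1 / 2) T := by
    refine ⟨by norm_num [← NNReal.coe_lt_coe], LipschitzWith.of_dist_le_mul fun y z => ?_⟩
    rw [dist_eq_norm, dist_eq_norm]
    refine (BoundedContinuousFunction.norm_le (by positivity)).2 fun t => ?_
    have := hbd (y - z) (max t 0) (le_max_right _ _)
    rw [BoundedContinuousFunction.sub_apply, hT, hT, ← smul_sub, add_sub_add_left_eq_sub,
      ← intervalIntegral.integral_sub ((hint y).intervalIntegrable _ _)
        ((hint z).intervalIntegrable _ _)]
    simpa [smul_sub] using this
  set y := hcontr.fixedPoint with hy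
  have hfix : ∀ t, y t = Real.exp (-(l * max t 0)) •
        (x₀ + ∫ s in (0:ℝ)..(max t 0), Real.exp (l * s) • A s (y s)) := fun t => by
    rw [← hT, hy]
    exact (congrArg (fun f => f t) hcontr.fixedPoint_isFixedPt).symm
  refine ⟨fun t => x₀ + ∫ s in (0:ℝ)..t, Real.exp (l * s) • A s (y s), by simp, fun t ht => ?_⟩
  have hd := (intervalIntegral.integral_hasDerivAt_right ((hint y).intervalIntegrable 0 t)
        ((hint y).stronglyMeasurableAtFilter _ _) (hint y).continuousAt).const_add x₀
  refine (hd.congr_deriv ?_).hasDerivWithinAt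
  have h1 := hfix t
  rw [max_eq_left ht] at h1
  have h2 : (x₀ + ∫ s in (0:ℝ)..t, Real.exp (l * s) • A s (y s)) = Real.exp (l * t) • y t := by
    rw [h1, smul_smul, ← Real.exp_add]
    simp
  simp only [h2, map_smul]

/-- `mulVec` as a family of continuous linear maps is continuous when its entries are. -/
lemma exists_mulVec_clm {n : ℕ} (M : ℝ → Matrix (Fin n) (Fin n) ℂ)
    (hM : ∀ i j, Continuous fun t => M t i j) (C : ℝ) (hC : ∀ t i j, ‖M t i j‖ ≤ C) :
    ∃ (A : ℝ → (Fin n → ℂ) →L[ℝ] (Fin n → ℂ)) (C' : ℝ), Continuous A ∧ (∀ t, ‖A t‖ ≤ C') ∧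
      ∀ t z, A t z = M t *ᵥ z := by
  let L : Matrix (Fin n) (Fin n) ℂ → (Fin n → ℂ) →L[ℝ] (Fin n → ℂ) := fun N =>
    LinearMap.toContinuousLinearMap ((Matrix.mulVecLin N).restrictScalars ℝ)
  have hL : ∀ N z, L N z = N *ᵥ z := fun N z => rfl
  refine ⟨fun t => L (M t), n * |C|, ?_, fun t => ?_, fun t z => rfl⟩
  · rw [continuous_clm_apply]
    intro z
    simp only [hL]
    refine continuous_pi fun i => ?_
    simp only [Matrix.mulVec, dotProduct]
    exact continuous_finsetSum _ fun j _ => (hM i j).mul continuous_const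
  · refine ContinuousLinearMap.opNorm_le_bound _ (by positivity) fun z => ?_
    rw [hL, pi_norm_le_iff_of_nonneg (by positivity)]
    intro i
    simp only [Matrix.mulVec, dotProduct]
    refine (norm_sum_le _ _).trans ?_
    calc _ ≤ ∑ j : Fin n, |C| * ‖z‖ := by
          refine Finset.sum_le_sum fun j _ => ?_
          rw [norm_mul]
          exact mul_le_mul ((hC t i j).trans (le_abs_self C)) (norm_le_pi_norm z j)
            (norm_nonneg _) (abs_nonneg _)
      _ = _ := by simp [mul_assoc]

lemma hasDerivWithinAt_apply {n : ℕ} {Z : ℝ → Fin n → ℂ} {M : Matrix (Fin n) (Fin n) ℂ}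
    {s : Set ℝ} {t : ℝ} (h : HasDerivWithinAt Z (M *ᵥ Z t) s t) (i : Fin n) :
    HasDerivWithinAt (fun x => Z x i) (∑ j, M i j * Z t j) s t :=
  (hasDerivWithinAt_pi.1 h) i

/-- A linear system with bounded continuous coefficients can be solved on the half line with data
at `0`. -/
lemma exists_forward_solution {n : ℕ} (M : ℝ → Matrix (Fin n) (Fin n) ℂ)
    (hM : ∀ i j, ContinuousOn (fun t => M t i j) (Ici 0)) (C : ℝ)
    (hC : ∀ t, 0 ≤ t → ∀ i j, ‖M t i j‖ ≤ C) (z₀ : Fin n → ℂ) :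
    ∃ Z : ℝ → Fin n → ℂ, Z 0 = z₀ ∧
      ∀ t, 0 ≤ t → HasDerivWithinAt Z (M t *ᵥ Z t) (Ici 0) t := by
  obtain ⟨A, C', hA, hAC, hAM⟩ := exists_mulVec_clm (fun t => M (max t 0))
    (fun i j => (hM i j).comp_continuous (continuous_id.max continuous_const)
      fun t => mem_Ici.2 (le_max_right _ _)) C (fun t => hC _ (le_max_right _ _))
  obtain ⟨Z, h0, hZ⟩ := exists_solution_of_bounded A hA C' hAC z₀
  refine ⟨Z, h0, fun t ht => (hZ t ht).congr_deriv ?_⟩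
  rw [hAM, max_eq_left ht]

/-- A linear system with bounded continuous coefficients can be solved on `[0, X]` with data
at `X`. -/
lemma exists_backward_solution {n : ℕ} (M : ℝ → Matrix (Fin n) (Fin n) ℂ)
    (hM : ∀ i j, ContinuousOn (fun t => M t i j) (Ici 0)) (C : ℝ)
    (hC : ∀ t, 0 ≤ t → ∀ i j, ‖M t i j‖ ≤ C) (X : ℝ) (z₀ : Fin n → ℂ) :
    ∃ Z : ℝ → Fin n → ℂ, Z X = z₀ ∧
      ∀ t ∈ Icc 0 X, HasDerivWithinAt Z (M t *ᵥ Z t) (Icc 0 X) t := by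
  obtain ⟨A, C', hA, hAC, hAM⟩ := exists_mulVec_clm (fun t => -M (max (X - t) 0))
    (fun i j => ((hM i j).comp_continuous
      (f := fun t => max (X - t) 0) (by fun_prop) fun t => mem_Ici.2 (le_max_right _ _)).neg) C
      (fun t i j => by simpa using hC (max (X - t) 0) (le_max_right _ _) i j)
  obtain ⟨Z, h0, hZ⟩ := exists_solution_of_bounded A hA C' hAC z₀
  refine ⟨fun t => Z (X - t), by simpa using h0, fun t ht => ?_⟩
  have hd : HasDerivWithinAt (fun s : ℝ => X - s) (-1) (Icc 0 X) t :=
    (hasDerivAt_id t).const_sub X |>.hasDerivWithinAt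
  have := (hZ (X - t) (by linarith [ht.2])).scomp t hd
    (fun s hs => by simpa using hs.2 : MapsTo (fun s : ℝ => X - s) (Icc 0 X) (Ici 0))
  refine this.congr_deriv ?_
  simp [hAM, max_eq_left ht.1, Matrix.neg_mulVec]

/-- Continuous dependence of solutions on the data at `0`. -/
lemma tendsto_of_tendsto_initial {n : ℕ} (M : ℝ → Matrix (Fin n) (Fin n) ℂ) (C : ℝ)
    (hC : ∀ t, 0 ≤ t → ∀ i j, ‖M t i j‖ ≤ C) {Z : ℝ → Fin n → ℂ} {X : ℝ} (hX : 0 ≤ X)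
    (hZ : ∀ t ∈ Icc 0 X, HasDerivWithinAt Z (M t *ᵥ Z t) (Icc 0 X) t)
    {W : ℕ → ℝ → Fin n → ℂ}
    (hW : ∀ᶠ k in atTop, ∀ t ∈ Icc 0 X, HasDerivWithinAt (W k) (M t *ᵥ W k t) (Icc 0 X) t)
    (h0 : Tendsto (fun k => W k 0) atTop (𝓝 (Z 0))) :
    Tendsto (fun k => W k X) atTop (𝓝 (Z X)) := by
  have hlip : ∀ t, 0 ≤ t → ∀ z : Fin n → ℂ, ‖M t *ᵥ z‖ ≤ (n * |C|) * ‖z‖ := by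
    intro t ht z
    rw [pi_norm_le_iff_of_nonneg (by positivity)]
    intro i
    simp only [Matrix.mulVec, dotProduct]
    refine (norm_sum_le _ _).trans ?_
    calc _ ≤ ∑ j : Fin n, |C| * ‖z‖ := by
          refine Finset.sum_le_sum fun j _ => ?_
          rw [norm_mul]
          exact mul_le_mul ((hC t ht i j).trans (le_abs_self C)) (norm_le_pi_norm z j)
            (norm_nonneg _) (abs_nonneg _)
      _ = _ := by simp [mul_assoc]
  rw [tendsto_iff_dist_tendsto_zero] at h0 ⊢
  have hlim : Tendsto (fun k => dist (W k 0) (Z 0) * Real.exp (n * |C| * X)) atTop (𝓝 0) := by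
    simpa using h0.mul_const (Real.exp (n * |C| * X))
  refine squeeze_zero' (Eventually.of_forall fun _ => dist_nonneg) ?_ hlim
  filter_upwards [hW] with k hk
  have hd : ∀ t ∈ Icc 0 X, HasDerivWithinAt (fun t => W k t - Z t)
      (M t *ᵥ (W k t - Z t)) (Icc 0 X) t := fun t ht => by
    rw [Matrix.mulVec_sub]
    exact (hk t ht).sub (hZ t ht)
  have := norm_le_gronwallBound_of_norm_deriv_right_le (f := fun t => W k t - Z t)
    (f' := fun t => M t *ᵥ (W k t - Z t)) (δ := ‖W k 0 - Z 0‖) (K := n * |C|) (ε := 0)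
    (a := 0) (b := X) (fun t ht => (hd t ht).continuousWithinAt)
    (fun t ht => (hd t (Ico_subset_Icc_self ht)).mono_of_mem_nhdsWithin
      (Icc_mem_nhdsGE_of_mem ht)) le_rfl
    (fun t ht => by simpa using hlip t ht.1 _) X ⟨hX, le_rfl⟩
  rw [gronwallBound_ε0, sub_zero] at this
  simpa [dist_eq_norm] using this

/-! ### Limits at infinity -/

/-- The variation beyond `x` of a function with exponentially decaying derivative. -/
lemma norm_sub_le_of_deriv_decay {f f' : ℝ → ℂ} {C β : ℝ} (hβ : 0 < β)
    (hf : ∀ x, 0 ≤ x → HasDerivWithinAt f (f' x) (Ici 0) x)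
    (hf' : ∀ x, 0 ≤ x → ‖f' x‖ ≤ C * Real.exp (-β * x)) {x y : ℝ} (hx : 0 ≤ x) (hxy : x ≤ y) :
    ‖f y - f x‖ ≤ C / β * Real.exp (-β * x) := by
  have hC : 0 ≤ C := by simpa using (norm_nonneg _).trans (hf' 0 le_rfl)
  have hdB : ∀ t, HasDerivAt (fun t => C / β * (Real.exp (-β * x) - Real.exp (-β * t)))
      (C * Real.exp (-β * t)) t := by
    intro t
    have h1 : HasDerivAt (fun t => Real.exp (-β * t)) (Real.exp (-β * t) * (-β)) t := by
      simpa using ((hasDerivAt_id t).const_mul (-β)).exp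
    refine ((h1.const_sub (Real.exp (-β * x))).const_mul (C / β)).congr_deriv ?_
    field_simp
  have := image_norm_le_of_norm_deriv_right_le_deriv_boundary'
    (f := fun t => f t - f x) (f' := f') (a := x) (b := y)
    (B := fun t => C / β * (Real.exp (-β * x) - Real.exp (-β * t)))
    (B' := fun t => C * Real.exp (-β * t))
    (fun t ht => ((hf t (hx.trans ht.1)).continuousWithinAt.mono
      (fun s hs => hx.trans hs.1)).sub continuousWithinAt_const)
    (fun t ht => ((hf t (hx.trans ht.1)).mono (fun s hs => (hx.trans ht.1).trans hs)).sub_const _)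
    (by simp) (fun t _ => (hdB t).continuousAt.continuousWithinAt)
    (fun t _ => (hdB t).hasDerivWithinAt) (fun t ht => hf' t (hx.trans ht.1)) ⟨hxy, le_rfl⟩
  refine this.trans ?_
  have : 0 ≤ C / β := by positivity
  have := Real.exp_pos (-β * y)
  gcongr
  linarith

/-- A function with exponentially decaying derivative converges at infinity. -/
lemma exists_tendsto_of_deriv_decay {f f' : ℝ → ℂ} {C β : ℝ} (hβ : 0 < β)
    (hf : ∀ x, 0 ≤ x → HasDerivWithinAt f (f' x) (Ici 0) x)
    (hf' : ∀ x, 0 ≤ x → ‖f' x‖ ≤ C * Real.exp (-β * x)) :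
    ∃ l, Tendsto f atTop (𝓝 l) := by
  have hexp : Tendsto (fun x : ℝ => C / β * Real.exp (-β * x)) atTop (𝓝 0) := by
    have : Tendsto (fun x : ℝ => Real.exp (-β * x)) atTop (𝓝 0) :=
      Real.tendsto_exp_atBot.comp
        ((tendsto_const_mul_atBot_of_neg (by linarith : -β < 0)).2 tendsto_id)
    simpa using this.const_mul (C / β)
  refine cauchy_map_iff_exists_tendsto.1 ?_
  rw [Metric.cauchy_iff]
  refine ⟨map_neBot, fun δ hδ => ?_⟩
  obtain ⟨x, hx1, hx2⟩ := ((hexp.eventually (gt_mem_nhds (half_pos hδ))).and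
    (eventually_ge_atTop 0)).exists
  refine ⟨f '' Ici x, image_mem_map (Ici_mem_atTop x), ?_⟩
  rintro _ ⟨y, hy, rfl⟩ _ ⟨z, hz, rfl⟩
  have h1 := norm_sub_le_of_deriv_decay hβ hf hf' hx2 hy
  have h2 := norm_sub_le_of_deriv_decay hβ hf hf' hx2 hz
  calc dist (f y) (f z) ≤ dist (f y) (f x) + dist (f z) (f x) := dist_triangle_right _ _ _
    _ < δ := by rw [dist_eq_norm, dist_eq_norm]; linarith

/-- If a real function and its derivative both converge at infinity, the derivative tends to `0`. -/
lemma deriv_limit_eq_zero_real {f f' : ℝ → ℝ} {a l : ℝ}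
    (hf : ∀ x, 0 ≤ x → HasDerivWithinAt f (f' x) (Ici 0) x)
    (ha : Tendsto f atTop (𝓝 a)) (hl : Tendsto f' atTop (𝓝 l)) : l = 0 := by
  have h1 : ∀ x, ∃ c, 0 ≤ x → x < c ∧ f' c = f (x + 1) - f x := by
    intro x
    by_cases hx : 0 ≤ x
    · obtain ⟨c, hc, hc'⟩ := exists_hasDerivAt_eq_slope f f' (by linarith : x < x + 1)
        (fun t ht => (hf t (hx.trans ht.1)).continuousWithinAt.mono (fun s hs => hx.trans hs.1))
        (fun t ht => (hf t (hx.trans ht.1.le)).hasDerivAt (Ici_mem_nhds (hx.trans_lt ht.1)))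
      exact ⟨c, fun _ => ⟨hc.1, by simpa using hc'⟩⟩
    · exact ⟨0, fun h => absurd h hx⟩
  choose c hc using h1
  have hcl : Tendsto c atTop atTop :=
    tendsto_atTop_mono' _ ((eventually_ge_atTop 0).mono fun x hx => (hc x hx).1.le) tendsto_id
  have h2 : Tendsto (fun x => f (x + 1) - f x) atTop (𝓝 (a - a)) :=
    (ha.comp (tendsto_atTop_add_const_right _ 1 tendsto_id)).sub ha
  have h3 : Tendsto (fun x => f (x + 1) - f x) atTop (𝓝 l) :=
    (hl.comp hcl).congr' ((eventually_ge_atTop 0).mono fun x hx => (hc x hx).2)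
  simpa using tendsto_nhds_unique h3 h2

/-- Complex version of `deriv_limit_eq_zero_real`. -/
lemma deriv_limit_eq_zero {f f' : ℝ → ℂ} {a l : ℂ}
    (hf : ∀ x, 0 ≤ x → HasDerivWithinAt f (f' x) (Ici 0) x)
    (ha : Tendsto f atTop (𝓝 a)) (hl : Tendsto f' atTop (𝓝 l)) : l = 0 := by
  refine Complex.ext ?_ ?_
  · exact deriv_limit_eq_zero_real
      (fun x hx => Complex.reCLM.hasFDerivAt.comp_hasDerivWithinAt x (hf x hx))
      ((Complex.continuous_re.tendsto a).comp ha) ((Complex.continuous_re.tendsto l).comp hl)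
  · exact deriv_limit_eq_zero_real
      (fun x hx => Complex.imCLM.hasFDerivAt.comp_hasDerivWithinAt x (hf x hx))
      ((Complex.continuous_im.tendsto a).comp ha) ((Complex.continuous_im.tendsto l).comp hl)

end ZND

namespace ZND

/-! ### Systems with one distinguished mode -/

/-- Systems `Z' = M Z` on `[0, ∞)` in which the mode `0` is constant up to integrable terms, feels
the others and acts on them only through integrable terms (the latter being `O(1/ε)`), while the
other modes grow at rate at least `γ` up to integrable terms: their block is row diagonally
dominant with respect to the weights `w`. -/
structure NormalForm {n : ℕ} (M : ℝ → Matrix (Fin (n + 1)) (Fin (n + 1)) ℂ) (w : Fin (n + 1) → ℝ)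
    (C β ε : ℝ) (γ : ℝ → ℝ) : Prop where
  cont : ∀ i j, ContinuousOn (fun t => M t i j) (Ici 0)
  bdd : ∃ C', ∀ t, 0 ≤ t → ∀ i j, ‖M t i j‖ ≤ C'
  row_zero : ∀ t, 0 ≤ t → ∀ j, ‖M t 0 j‖ ≤ C * Real.exp (-β * t)
  col_zero : ∀ t, 0 ≤ t → ∀ i, i ≠ 0 → ‖M t i 0‖ ≤ C / ε * Real.exp (-β * t)
  dominance : ∀ t, 0 ≤ t → ∀ i, i ≠ 0 → w i * γ t - C * Real.exp (-β * t) ≤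
    w i * (M t i i).re - ∑ j ∈ Finset.univ.filter (fun j => j ≠ 0 ∧ j ≠ i), w j * ‖M t i j‖

variable {n : ℕ}

lemma sum_eq_diag_add (f : Fin (n + 1) → ℂ) {i : Fin (n + 1)} (hi : i ≠ 0) :
    ∑ j, f j = f i + (f 0 + ∑ j ∈ Finset.univ.filter (fun j => j ≠ 0 ∧ j ≠ i), f j) := by
  rw [← Finset.add_sum_erase _ f (Finset.mem_univ i),
    ← Finset.add_sum_erase (Finset.univ.erase i) f (a := 0) (by simp [hi.symm])]
  congr 3
  ext j
  simp

/-- Growth of a mode `i ≠ 0` at a point where its weighted modulus dominates the others. -/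
lemma inner_ge_of_dominance {m : Matrix (Fin (n + 1)) (Fin (n + 1)) ℂ} {w : Fin (n + 1) → ℝ}
    {i : Fin (n + 1)} (hi : i ≠ 0) {z : Fin (n + 1) → ℂ} {B g : ℝ} {r : ℂ} (hB : 0 ≤ B)
    (hz : ∀ j, j ≠ 0 → ‖z j‖ ≤ w j * B) (hzi : ‖z i‖ = w i * B)
    (hdom : g ≤ w i * (m i i).re -
      ∑ j ∈ Finset.univ.filter (fun j => j ≠ 0 ∧ j ≠ i), w j * ‖m i j‖) :
    ‖z i‖ * (g * B - ‖m i 0‖ * ‖z 0‖ - ‖r‖) ≤ inner ℝ (z i) (∑ j, m i j * z j + r) := by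
  rw [sum_eq_diag_add _ hi, add_assoc]
  refine le_trans ?_ (le_inner_mul_add _ _ _)
  refine mul_le_mul_of_nonneg_left ?_ (norm_nonneg _)
  set s := Finset.univ.filter (fun j : Fin (n + 1) => j ≠ 0 ∧ j ≠ i)
  have h1 : ‖∑ j ∈ s, m i j * z j‖ ≤ (∑ j ∈ s, w j * ‖m i j‖) * B := by
    refine (norm_sum_le _ _).trans ?_
    rw [Finset.sum_mul]
    refine Finset.sum_le_sum fun j hj => ?_
    rw [norm_mul]
    have := hz j (Finset.mem_filter.1 hj).2.1
    nlinarith [norm_nonneg (m i j)]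
  have h2 : ‖m i 0 * z 0 + ∑ j ∈ s, m i j * z j + r‖ ≤
      ‖m i 0‖ * ‖z 0‖ + (∑ j ∈ s, w j * ‖m i j‖) * B + ‖r‖ := by
    refine (norm_add_le _ _).trans (add_le_add ?_ le_rfl)
    refine (norm_add_le _ _).trans (add_le_add ?_ h1)
    rw [norm_mul]
  rw [hzi]
  nlinarith [mul_le_mul_of_nonneg_right hdom hB]

lemma norm_row_zero_le {m : Matrix (Fin (n + 1)) (Fin (n + 1)) ℂ} {w : Fin (n + 1) → ℝ}
    {z : Fin (n + 1) → ℂ} {B k : ℝ} (hB : 0 ≤ B) (hw : ∀ i, 0 < w i)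
    (hz : ∀ j, j ≠ 0 → ‖z j‖ ≤ w j * B) (hm : ∀ j, ‖m 0 j‖ ≤ k) :
    ‖∑ j, m 0 j * z j‖ ≤ k * (‖z 0‖ + (∑ j, w j) * B) := by
  have hk : 0 ≤ k := (norm_nonneg _).trans (hm 0)
  calc ‖∑ j, m 0 j * z j‖ ≤ ∑ j, k * ((if j = 0 then ‖z 0‖ else 0) + w j * B) := by
        refine (norm_sum_le _ _).trans (Finset.sum_le_sum fun j _ => ?_)
        rw [norm_mul]
        refine mul_le_mul (hm j) ?_ (norm_nonneg _) hk
        by_cases hj : j = 0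
        · subst hj
          have := mul_nonneg (hw 0).le hB
          simpa using this
        · simpa [hj] using hz j hj
    _ = _ := by
        rw [← Finset.mul_sum, Finset.sum_add_distrib, ← Finset.sum_mul]
        simp

lemma hasDerivAt_exp_neg_mul (β t : ℝ) :
    HasDerivAt (fun t => Real.exp (-β * t)) (-β * Real.exp (-β * t)) t := by
  simpa [mul_comm] using ((hasDerivAt_id t).const_mul (-β)).exp

/-- A constant `A` for which the decay of `exp (A e^{-βt})` absorbs terms of size `c e^{-βt}`. -/
lemma exists_rate {w : Fin (n + 1) → ℝ} (hw : ∀ i, 0 < w i) {β : ℝ} (hβ : 0 < β) (c : ℝ) :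
    ∃ A : ℝ, 0 < A ∧ c < β * A ∧ ∀ i, c < w i * (β * A) := by
  set S := ∑ i, 1 / w i
  have hS : ∀ i, 1 / w i ≤ S := fun i =>
    Finset.single_le_sum (f := fun i => 1 / w i) (fun j _ => (by have := hw j; positivity))
      (Finset.mem_univ i)
  have hS0 : 0 < S := (by have := hw 0; positivity : 0 < 1 / w 0).trans_le (hS 0)
  refine ⟨(|c| + 1) * (1 + S) / β, by positivity, ?_, fun i => ?_⟩
  · rw [mul_div_cancel₀ _ hβ.ne']
    nlinarith [le_abs_self c, abs_nonneg c]
  · rw [mul_div_cancel₀ _ hβ.ne']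
    have h1 : 1 ≤ w i * (1 + S) := by
      have := mul_le_mul_of_nonneg_left (hS i) (hw i).le
      rw [mul_one_div_cancel (hw i).ne'] at this
      nlinarith [hw i]
    nlinarith [le_abs_self c, abs_nonneg c]

lemma exp_sub_one_le {A β t : ℝ} (hA : 0 < A) (hβ : 0 < β) (ht : 0 ≤ t) :
    Real.exp (A * Real.exp (-β * t)) - 1 ≤ A * Real.exp A * Real.exp (-β * t) := by
  set a := A * Real.exp (-β * t) with ha
  have he : Real.exp (-β * t) ≤ 1 := by
    rw [Real.exp_le_one_iff]
    nlinarith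
  have ha1 : a ≤ A := by nlinarith
  have ha0 : 0 < a := by positivity
  have h1 : Real.exp a - 1 ≤ a * Real.exp a := by
    have h2 := Real.add_one_le_exp (-a)
    have h3 : Real.exp (-a) * Real.exp a = 1 := by rw [← Real.exp_add]; simp
    nlinarith [Real.exp_pos a]
  calc Real.exp a - 1 ≤ a * Real.exp a := h1
    _ ≤ a * Real.exp A := by gcongr
    _ = _ := by rw [ha]; ring

/-- Uniform bounds for the solutions with data `e₀` at a finite point `X`. -/
lemma NormalForm.backward_bound {w : Fin (n + 1) → ℝ} (hw : ∀ i, 0 < w i) {C β : ℝ} (hβ : 0 < β) :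
    ∃ C', 0 < C' ∧ ∀ ε : ℝ, 1 ≤ ε → ∀ M γ, NormalForm M w C β ε γ → (∀ t, 0 ≤ t → 0 ≤ γ t) →
      ∀ X : ℝ, ∀ Z : ℝ → Fin (n + 1) → ℂ, Z X = Pi.single 0 1 →
        (∀ t ∈ Icc 0 X, HasDerivWithinAt Z (M t *ᵥ Z t) (Icc 0 X) t) →
        ∀ t ∈ Icc 0 X, ‖Z t 0 - 1‖ ≤ C' * Real.exp (-β * t) ∧
          ∀ i, i ≠ 0 → ‖Z t i‖ ≤ C' / ε * Real.exp (-β * t) := by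
  set W := ∑ j, w j with hW
  have hwW : ∀ i, w i ≤ W := fun i =>
    Finset.single_le_sum (fun j _ => (hw j).le) (Finset.mem_univ i)
  have hW0 : 0 < W := (hw 0).trans_le (hwW 0)
  obtain ⟨A, hA, hA0, hAi⟩ := exists_rate hw hβ (2 * |C| + |C| * (1 + W))
  refine ⟨(1 + W) * (A * Real.exp A), by positivity, ?_⟩
  intro ε hε M γ hM hγ X Z hZX hZ
  have hε0 : 0 < ε := by linarith
  -- a strict supersolution for the comparison backward from `X`; it decays like `e^{-βt}`
  set B : ℝ → ℝ := fun t => Real.exp (A * Real.exp (-β * t)) - 1 with hBdef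
  have hBd : ∀ t, HasDerivAt B (-(β * A * Real.exp (-β * t) * (B t + 1))) t := by
    intro t
    refine (((hasDerivAt_exp_neg_mul β t).const_mul A).exp.sub_const 1).congr_deriv ?_
    simp only [hBdef]
    ring
  have hBpos : ∀ t, 0 < B t := fun t => by
    have : 0 < A * Real.exp (-β * t) := by positivity
    simpa [hBdef] using this
  -- the mode `0` is compared with `B`, the other ones with `w i * B / ε`
  have key := norm_le_of_lt_deriv (a := 0) (b := X)
    (Y := fun i t => if i = 0 then Z t 0 - 1 else Z t i)
    (Y' := fun i t => ∑ j, M t i j * Z t j)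
    (B := fun i t => if i = 0 then B t else w i / ε * B t)
    (B' := fun i t => if i = 0 then -(β * A * Real.exp (-β * t) * (B t + 1)) else
      w i / ε * -(β * A * Real.exp (-β * t) * (B t + 1)))
    (fun i t ht => by
      by_cases hi : i = 0
      · subst hi
        simpa using (hasDerivWithinAt_apply (hZ t ht) 0).sub_const 1
      · simpa [hi] using hasDerivWithinAt_apply (hZ t ht) i)
    (fun i t ht => by
      by_cases hi : i = 0
      · simpa [hi] using (hBd t).hasDerivWithinAt
      · simpa only [hi, if_false] using ((hBd t).const_mul (w i / ε)).hasDerivWithinAt)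
    (fun i t ht => by
      have := hBpos t
      have := hw i
      by_cases hi : i = 0
      · simpa [hi] using (hBpos t).le
      · simp only [hi, if_false]; positivity)
    (fun i => by
      have := hBpos X
      have := hw i
      by_cases hi : i = 0
      · simpa [hi, hZX] using (hBpos X).le
      · simp only [hi, if_false, hZX, Pi.single_eq_of_ne hi, norm_zero]; positivity)
    (by
      intro t ht hle i hi
      have hB0 := hBpos t
      set k := C * Real.exp (-β * t) with hk
      have he : 0 < Real.exp (-β * t) := Real.exp_pos _
      have hkle : k ≤ |C| * Real.exp (-β * t) := by
        rw [hk]; exact mul_le_mul_of_nonneg_right (le_abs_self C) he.le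
      have hk0 : 0 ≤ k := (norm_nonneg _).trans (hM.row_zero t ht.1 0)
      have hz : ∀ j, j ≠ 0 → ‖Z t j‖ ≤ w j * (B t / ε) := fun j hj => by
        have := hle j
        simp only [hj, if_false] at this
        refine this.trans (le_of_eq (by ring))
      have hz0 : ‖Z t 0‖ ≤ 1 + B t := by
        have h1 := hle 0
        simp only [if_true] at h1
        calc ‖Z t 0‖ = ‖1 + (Z t 0 - 1)‖ := by ring_nf
          _ ≤ ‖(1:ℂ)‖ + ‖Z t 0 - 1‖ := norm_add_le _ _
          _ ≤ _ := by rw [norm_one]; linarith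
      have hBε : B t / ε ≤ B t := div_le_self hB0.le hε
      have hBε0 : 0 < B t / ε := by positivity
      by_cases h0 : i = 0
      · subst h0
        simp only [if_true] at hi ⊢
        have h1 := norm_row_zero_le hBε0.le hw hz (hM.row_zero t ht.1)
        have h2 := abs_real_inner_le_norm (Z t 0 - 1) (∑ j, M t 0 j * Z t j)
        rw [hi] at h2
        have h3 : ‖∑ j, M t 0 j * Z t j‖ ≤ |C| * Real.exp (-β * t) * ((1 + W) * (1 + B t)) := by
          refine h1.trans ?_
          calc k * (‖Z t 0‖ + W * (B t / ε)) ≤ k * ((1 + B t) + W * (1 + B t)) := by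
                gcongr; linarith
            _ ≤ |C| * Real.exp (-β * t) * ((1 + B t) + W * (1 + B t)) := by gcongr
            _ = _ := by ring
        have h4 : |C| * Real.exp (-β * t) * ((1 + W) * (1 + B t)) <
            β * A * Real.exp (-β * t) * (B t + 1) := by
          have : |C| * (1 + W) < β * A := by nlinarith [abs_nonneg C]
          have h5 : 0 < Real.exp (-β * t) * (1 + B t) := by positivity
          nlinarith
        have h5 := neg_abs_le (inner ℝ (Z t 0 - 1) (∑ j, M t 0 j * Z t j))
        nlinarith
      · simp only [h0, if_false] at hi ⊢
        have hzi : ‖Z t i‖ = w i * (B t / ε) := by rw [hi]; ring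
        have h1 := inner_ge_of_dominance (r := 0) h0 hBε0.le hz hzi (hM.dominance t ht.1 i h0)
        rw [add_zero, norm_zero, sub_zero] at h1
        refine lt_of_lt_of_le ?_ h1
        rw [hzi]
        have hwi := hw i
        have h2 : w i / ε * B t = w i * (B t / ε) := by ring
        rw [h2]
        refine mul_lt_mul_of_pos_left ?_ (by positivity)
        have h3 : ‖M t i 0‖ * ‖Z t 0‖ ≤ (k / ε) * (1 + B t) := by
          refine mul_le_mul ((hM.col_zero t ht.1 i h0).trans (le_of_eq ?_)) hz0 (norm_nonneg _)
            (by positivity)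
          rw [hk]; ring
        have h4 : 0 ≤ w i * γ t * (B t / ε) :=
          mul_nonneg (mul_nonneg hwi.le (hγ t ht.1)) hBε0.le
        have h5 : k * (1 + 2 * B t) < w i * (β * A * Real.exp (-β * t) * (B t + 1)) := by
          have h6 : 2 * |C| < w i * (β * A) := by
            have := hAi i
            nlinarith [abs_nonneg C]
          calc k * (1 + 2 * B t) ≤ |C| * Real.exp (-β * t) * (2 * (1 + B t)) := by
                gcongr; linarith
            _ = (2 * |C|) * (Real.exp (-β * t) * (1 + B t)) := by ring
            _ < (w i * (β * A)) * (Real.exp (-β * t) * (1 + B t)) := by gcongr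
            _ = _ := by ring
        have h6 : k / ε * (1 + 2 * B t) <
            w i / ε * (β * A * Real.exp (-β * t) * (B t + 1)) := by
          have := div_lt_div_of_pos_right h5 hε0
          calc _ = k * (1 + 2 * B t) / ε := by ring
            _ < _ := this
            _ = _ := by ring
        have h7 : k / ε * (1 + 2 * B t) = k * (B t / ε) + k / ε * (1 + B t) := by ring
        rw [sub_mul]
        linarith)
  intro t ht
  have hBt := exp_sub_one_le hA hβ ht.1
  have hP : 0 ≤ A * Real.exp A * Real.exp (-β * t) := by positivity
  refine ⟨?_, fun i hi => ?_⟩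
  · have := key t ht 0
    simp only [if_true] at this
    calc _ ≤ _ := this.trans hBt
      _ ≤ _ := by nlinarith
  · have := key t ht i
    simp only [hi, if_false] at this
    have hwi := hw i
    calc _ ≤ _ := this
      _ ≤ (1 + W) / ε * (A * Real.exp A * Real.exp (-β * t)) := by
        gcongr
        · exact (hBpos t).le
        · linarith [hwW i]
      _ = _ := by ring

/-- The solution that tends to `e₀` at infinity, with bounds that are uniform in `ε`. -/
lemma NormalForm.exists_solution {w : Fin (n + 1) → ℝ} (hw : ∀ i, 0 < w i) {C β : ℝ}
    (hβ : 0 < β) :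
    ∃ C', 0 < C' ∧ ∀ ε : ℝ, 1 ≤ ε → ∀ M γ, NormalForm M w C β ε γ → (∀ t, 0 ≤ t → 0 ≤ γ t) →
      ∃ Z : ℝ → Fin (n + 1) → ℂ,
        (∀ t, 0 ≤ t → HasDerivWithinAt Z (M t *ᵥ Z t) (Ici 0) t) ∧
        ∀ t, 0 ≤ t → ‖Z t 0 - 1‖ ≤ C' * Real.exp (-β * t) ∧
          ∀ i, i ≠ 0 → ‖Z t i‖ ≤ C' / ε * Real.exp (-β * t) := by
  obtain ⟨C', hC', hbound⟩ := NormalForm.backward_bound (C := C) hw hβ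
  refine ⟨C', hC', fun ε hε M γ hM hγ => ?_⟩
  obtain ⟨CM, hCM⟩ := hM.bdd
  -- the solutions with data `e₀` at `N` converge along a subsequence, by compactness at `t = 0`
  choose V hV1 hV2 using fun N : ℕ => exists_backward_solution M hM.cont CM hCM (N : ℝ)
    (Pi.single 0 1)
  have hb := fun N : ℕ => hbound ε hε M γ hM hγ (N : ℝ) (V N) (hV1 N) (hV2 N)
  have hε0 : 0 < ε := by linarith
  obtain ⟨z₀, -, φ, hφ, hlim⟩ := tendsto_subseq_of_bounded (x := fun N => V N 0)
    (Metric.isBounded_closedBall (x := (0 : Fin (n + 1) → ℂ)) (r := 1 + C'))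
    (fun N => by
      rw [mem_closedBall_zero_iff, pi_norm_le_iff_of_nonneg (by positivity)]
      intro i
      have h := hb N 0 ⟨le_rfl, Nat.cast_nonneg N⟩
      simp only [mul_zero, Real.exp_zero, mul_one] at h
      by_cases hi : i = 0
      · subst hi
        calc ‖V N 0 0‖ = ‖1 + (V N 0 0 - 1)‖ := by ring_nf
          _ ≤ ‖(1:ℂ)‖ + ‖V N 0 0 - 1‖ := norm_add_le _ _
          _ ≤ _ := by rw [norm_one]; linarith [h.1]
      · have := h.2 i hi
        have h3 : C' / ε ≤ C' := div_le_self hC'.le hε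
        linarith)
  obtain ⟨Z, hZ0, hZ⟩ := exists_forward_solution M hM.cont CM hCM z₀
  have hge : ∀ X : ℝ, ∀ᶠ k in atTop, X ≤ (φ k : ℝ) := fun X =>
    (tendsto_natCast_atTop_atTop.comp hφ.tendsto_atTop).eventually (eventually_ge_atTop X)
  have hconv : ∀ t, 0 ≤ t → Tendsto (fun k => V (φ k) t) atTop (𝓝 (Z t)) := by
    intro t ht
    refine tendsto_of_tendsto_initial M CM hCM ht
      (fun s hs => (hZ s hs.1).mono Icc_subset_Ici_self) ?_ (by rw [hZ0]; exact hlim)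
    filter_upwards [hge t] with k hk s hs
    exact (hV2 (φ k) s ⟨hs.1, hs.2.trans hk⟩).mono (Icc_subset_Icc_right hk)
  refine ⟨Z, hZ, fun t ht => ⟨?_, fun i hi => ?_⟩⟩
  · have h1 : Tendsto (fun k => ‖V (φ k) t 0 - 1‖) atTop (𝓝 ‖Z t 0 - 1‖) :=
      ((tendsto_pi_nhds.1 (hconv t ht) 0).sub_const 1).norm
    exact le_of_tendsto h1 ((hge t).mono fun k hk => (hb (φ k) t ⟨ht, hk⟩).1)
  · have h1 : Tendsto (fun k => ‖V (φ k) t i‖) atTop (𝓝 ‖Z t i‖) :=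
      (tendsto_pi_nhds.1 (hconv t ht) i).norm
    exact le_of_tendsto h1 ((hge t).mono fun k hk => (hb (φ k) t ⟨ht, hk⟩).2 i hi)

/-- For large `ε` the mode `0` of the solution stays away from zero. -/
lemma NormalForm.lower_bound {w : Fin (n + 1) → ℝ} {C β : ℝ} (hβ : 0 < β) (C' : ℝ) :
    ∃ c ε₀ : ℝ, 0 < c ∧ 1 ≤ ε₀ ∧ ∀ ε : ℝ, ε₀ ≤ ε → ∀ M γ, NormalForm M w C β ε γ →
      ∀ Z : ℝ → Fin (n + 1) → ℂ,
        (∀ t, 0 ≤ t → HasDerivWithinAt Z (M t *ᵥ Z t) (Ici 0) t) →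
        (∀ t, 0 ≤ t → ‖Z t 0 - 1‖ ≤ C' * Real.exp (-β * t) ∧
          ∀ i, i ≠ 0 → ‖Z t i‖ ≤ C' / ε * Real.exp (-β * t)) →
        ∀ t, 0 ≤ t → c ≤ ‖Z t 0‖ := by
  set A := (|C| + 1) / β with hA
  have hA0 : 0 < A := by positivity
  set D := (n + 1 : ℝ) * |C'| + 1 with hD
  have hD0 : 0 < D := by positivity
  refine ⟨Real.exp (-A) / 2, 1 + 4 * D * Real.exp A, by positivity, by
    have : 0 < 4 * D * Real.exp A := by positivity
    linarith, ?_⟩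
  intro ε hε M γ hM Z hZ hbd t₀ ht₀
  have hε0 : 0 < ε := by
    have : 0 < 4 * D * Real.exp A := by positivity
    linarith
  set d := D / ε with hd
  have hd0 : 0 < d := by positivity
  have hd1 : 4 * d * Real.exp A ≤ 1 := by
    rw [hd]
    calc 4 * (D / ε) * Real.exp A = (4 * D * Real.exp A) / ε := by ring
      _ ≤ 1 := by rw [div_le_one hε0]; linarith
  set m := ‖Z t₀ 0‖ with hm
  have hm0 : 0 ≤ m := norm_nonneg _
  -- a supersolution forward from `t₀`: if `m` were small, so would be the limit of the mode `0` at
  -- infinity, which is `1`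
  set B : ℝ → ℝ := fun t => (m + 2 * d) * Real.exp (A * (1 - Real.exp (-β * t))) - d with hBdef
  have hBd : ∀ t, HasDerivAt B (A * β * Real.exp (-β * t) * (B t + d)) t := by
    intro t
    refine ((((hasDerivAt_exp_neg_mul β t).const_sub 1).const_mul A).exp.const_mul
      (m + 2 * d) |>.sub_const d).congr_deriv ?_
    simp only [hBdef]
    ring
  have hBge : ∀ t, 0 ≤ t → m + d ≤ B t := by
    intro t ht
    have h1 : Real.exp (-β * t) ≤ 1 := by rw [Real.exp_le_one_iff]; nlinarith
    have h2 : 1 ≤ Real.exp (A * (1 - Real.exp (-β * t))) :=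
      Real.one_le_exp (mul_nonneg hA0.le (by linarith))
    simp only [hBdef]
    nlinarith
  have hBle : ∀ t, B t ≤ (m + 2 * d) * Real.exp A := by
    intro t
    have h2 : Real.exp (A * (1 - Real.exp (-β * t))) ≤ Real.exp A := by
      rw [Real.exp_le_exp]
      nlinarith [Real.exp_pos (-β * t)]
    simp only [hBdef]
    nlinarith
  have key : ∀ T, t₀ ≤ T → ‖Z T 0‖ ≤ (m + 2 * d) * Real.exp A := by
    intro T hT
    refine le_trans ?_ (hBle T)
    refine norm_le_of_deriv_lt (ι := Unit) (a := t₀) (b := T) (Y := fun _ t => Z t 0)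
      (Y' := fun _ t => ∑ j, M t 0 j * Z t j) (B := fun _ => B)
      (B' := fun _ t => A * β * Real.exp (-β * t) * (B t + d))
      (fun _ t ht => (hasDerivWithinAt_apply (hZ t (ht₀.trans ht.1)) 0).mono
        (fun s hs => ht₀.trans hs.1))
      (fun _ t _ => (hBd t).hasDerivWithinAt)
      (fun _ t ht => by linarith [hBge t (ht₀.trans ht.1)])
      (fun _ => by linarith [hBge t₀ ht₀]) ?_ T ⟨hT, le_rfl⟩ ()
    intro t ht _ _ hi
    have ht0 := ht₀.trans ht.1
    have hBp : 0 < B t := by linarith [hBge t ht0]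
    have he := Real.exp_pos (-β * t)
    have h1 : ‖∑ j, M t 0 j * Z t j‖ ≤ |C| * Real.exp (-β * t) * (B t + d) := by
      have h2 := norm_row_zero_le (m := M t) (w := fun _ : Fin (n + 1) => (1 : ℝ))
        (z := Z t) (B := |C'| / ε) (by positivity) (fun _ => one_pos)
        (fun j hj => by
          refine ((hbd t ht0).2 j hj).trans ?_
          have h3 : Real.exp (-β * t) ≤ 1 := by rw [Real.exp_le_one_iff]; nlinarith
          have h4 : C' / ε ≤ |C'| / ε := div_le_div_of_nonneg_right (le_abs_self _) hε0.le
          have h5 : 0 ≤ |C'| / ε := by positivity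
          nlinarith) (hM.row_zero t ht0)
      refine h2.trans ?_
      have h3 : (∑ _j : Fin (n + 1), (1 : ℝ)) * (|C'| / ε) ≤ d := by
        simp only [Finset.sum_const, Finset.card_univ, Fintype.card_fin, nsmul_eq_mul, mul_one]
        rw [hd, hD]
        push_cast
        rw [← mul_div_assoc]
        exact div_le_div_of_nonneg_right (by linarith) hε0.le
      rw [hi]
      refine mul_le_mul (mul_le_mul_of_nonneg_right (le_abs_self C) he.le) (by linarith)
        ?_ (by positivity)
      have : 0 ≤ (∑ _j : Fin (n + 1), (1 : ℝ)) * (|C'| / ε) := by positivity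
      linarith
    have h2 := (le_abs_self _).trans (abs_real_inner_le_norm (Z t 0) (∑ j, M t 0 j * Z t j))
    rw [hi] at h2
    refine h2.trans_lt (mul_lt_mul_of_pos_left (h1.trans_lt ?_) hBp)
    have h3 : A * β = |C| + 1 := by rw [hA]; field_simp
    rw [h3]
    have : 0 < Real.exp (-β * t) * (B t + d) := by positivity
    nlinarith
  have hlim : Tendsto (fun T : ℝ => 1 - C' * Real.exp (-β * T)) atTop (𝓝 (1 - C' * 0)) :=
    ((Real.tendsto_exp_atBot.comp ((tendsto_const_mul_atBot_of_neg
      (by linarith : -β < 0)).2 tendsto_id)).const_mul C').const_sub 1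
  have hone : 1 ≤ (m + 2 * d) * Real.exp A := by
    have : 1 - C' * 0 ≤ (m + 2 * d) * Real.exp A := by
      refine le_of_tendsto hlim ?_
      filter_upwards [eventually_ge_atTop t₀] with T hT
      have h1 := (hbd T (ht₀.trans hT)).1
      have h2 := key T hT
      have h3 : ‖(1:ℂ)‖ ≤ ‖Z T 0‖ + ‖Z T 0 - 1‖ := by
        calc ‖(1:ℂ)‖ = ‖Z T 0 - (Z T 0 - 1)‖ := by ring_nf
          _ ≤ _ := norm_sub_le _ _
      rw [norm_one] at h3
      linarith
    simpa using this
  have hE : Real.exp (-A) * Real.exp A = 1 := by rw [← Real.exp_add]; simp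
  have hEp := Real.exp_pos A
  by_contra hlt
  push Not at hlt
  nlinarith

/-- Uniqueness: a solution whose part transversal to `Zs` grows more slowly than the lower bound
`exp (∫ γ)` for the growth of the transversal modes is a multiple of `Zs`. -/
lemma NormalForm.unique {w : Fin (n + 1) → ℝ} (hw : ∀ i, 0 < w i) {C β ε : ℝ} (hβ : 0 < β)
    {M : ℝ → Matrix (Fin (n + 1)) (Fin (n + 1)) ℂ} {γ Γ : ℝ → ℝ} (hM : NormalForm M w C β ε γ)
    (hΓ : ∀ t, 0 ≤ t → HasDerivWithinAt Γ (γ t) (Ici 0) t)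
    {Zs Z : ℝ → Fin (n + 1) → ℂ}
    (hZs : ∀ t, 0 ≤ t → HasDerivWithinAt Zs (M t *ᵥ Zs t) (Ici 0) t)
    (hZ : ∀ t, 0 ≤ t → HasDerivWithinAt Z (M t *ᵥ Z t) (Ici 0) t)
    {c C' : ℝ} (hc : 0 < c) (hlow : ∀ t, 0 ≤ t → c ≤ ‖Zs t 0‖)
    (hup : ∀ t, 0 ≤ t → ∀ i, ‖Zs t i‖ ≤ C')
    (hq : Tendsto (fun t => ‖Z t - (Z t 0 / Zs t 0) • Zs t‖ * Real.exp (-Γ t)) atTop (𝓝 0)) :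
    ∃ a : ℂ, ∀ t, 0 ≤ t → Z t = a • Zs t := by
  -- `q` is the part of `Z` transversal to `Zs`; it is bounded backward from `X`, with a constant
  -- that tends to `0` as `X → ∞`, and `κ` is constant once `q` vanishes
  set κ : ℝ → ℂ := fun t => Z t 0 / Zs t 0 with hκ
  set q : ℝ → Fin (n + 1) → ℂ := fun t => Z t - κ t • Zs t with hqdef
  have hne : ∀ t, 0 ≤ t → Zs t 0 ≠ 0 := fun t ht => by
    rw [← norm_pos_iff]; exact hc.trans_le (hlow t ht)
  have hC' : 0 < C' := hc.trans_le ((hlow 0 le_rfl).trans (hup 0 le_rfl 0))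
  have hsum : ∀ t i, ∑ j, M t i j * q t j =
      ∑ j, M t i j * Z t j - κ t * ∑ j, M t i j * Zs t j := by
    intro t i
    rw [Finset.mul_sum, ← Finset.sum_sub_distrib]
    refine Finset.sum_congr rfl fun j _ => ?_
    simp only [hqdef, Pi.sub_apply, Pi.smul_apply, smul_eq_mul]
    ring
  have hκd : ∀ t, 0 ≤ t → HasDerivWithinAt κ ((∑ j, M t 0 j * q t j) / Zs t 0) (Ici 0) t := by
    intro t ht
    refine ((hasDerivWithinAt_apply (hZ t ht) 0).div (hasDerivWithinAt_apply (hZs t ht) 0)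
      (hne t ht)).congr_deriv ?_
    rw [hsum]
    have := hne t ht
    simp only [hκ]
    field_simp
  have hq0 : ∀ t, 0 ≤ t → q t 0 = 0 := fun t ht => by
    simp only [hqdef, hκ, Pi.sub_apply, Pi.smul_apply, smul_eq_mul]
    rw [div_mul_cancel₀ _ (hne t ht), sub_self]
  have hqd : ∀ t, 0 ≤ t → ∀ i, HasDerivWithinAt (fun s => q s i)
      (∑ j, M t i j * q t j + -((∑ j, M t 0 j * q t j) / Zs t 0 * Zs t i)) (Ici 0) t := by
    intro t ht i
    refine ((hasDerivWithinAt_apply (hZ t ht) i).sub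
      ((hκd t ht).mul (hasDerivWithinAt_apply (hZs t ht) i))).congr_deriv ?_
    rw [hsum t i]
    ring
  set W := ∑ j, w j with hW
  have hW0 : 0 < W := Finset.sum_pos (fun j _ => hw j) Finset.univ_nonempty
  obtain ⟨A, hA, -, hAi⟩ := exists_rate hw hβ (|C| * (1 + W * (C' / c)))
  set S := ∑ i, 1 / w i with hS
  have hSi : ∀ i, 1 ≤ w i * S := fun i => by
    have h1 : 1 / w i ≤ S := Finset.single_le_sum (f := fun i => 1 / w i)
      (fun j _ => (by have := hw j; positivity)) (Finset.mem_univ i)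
    have := mul_le_mul_of_nonneg_left h1 (hw i).le
    rwa [mul_one_div_cancel (hw i).ne'] at this
  have hS0 : 0 < S := by
    by_contra h
    nlinarith [hSi 0, hw 0]
  have key : ∀ X, ∀ t ∈ Icc 0 X, ∀ i, ‖q t i‖ ≤
      w i * (((‖q X‖ * Real.exp (-Γ X) + Real.exp (-X)) * S) *
        Real.exp (A * Real.exp (-β * t) + Γ t)) := by
    intro X
    set D := (‖q X‖ * Real.exp (-Γ X) + Real.exp (-X)) * S with hD
    have hD0 : 0 < D := by
      have := Real.exp_pos (-X)
      positivity
    set B : ℝ → ℝ := fun t => D * Real.exp (A * Real.exp (-β * t) + Γ t) with hB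
    have hBd : ∀ t ∈ Icc 0 X, HasDerivWithinAt B (B t * (γ t - β * A * Real.exp (-β * t)))
        (Icc 0 X) t := by
      intro t ht
      refine ((((hasDerivAt_exp_neg_mul β t).const_mul A).hasDerivWithinAt.add
        ((hΓ t ht.1).mono Icc_subset_Ici_self)).exp.const_mul D).congr_deriv ?_
      simp only [hB, Pi.add_apply]
      ring
    have hBpos : ∀ t, 0 < B t := fun t => by positivity
    refine norm_le_of_lt_deriv (Y := fun i t => q t i)
      (Y' := fun i t => ∑ j, M t i j * q t j + -((∑ j, M t 0 j * q t j) / Zs t 0 * Zs t i))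
      (B := fun i t => w i * B t)
      (B' := fun i t => w i * (B t * (γ t - β * A * Real.exp (-β * t))))
      (fun i t ht => (hqd t ht.1 i).mono Icc_subset_Ici_self)
      (fun i t ht => (hBd t ht).const_mul (w i))
      (fun i t _ => (mul_pos (hw i) (hBpos t)).le) ?_ ?_
    · intro i
      have h1 : 1 ≤ Real.exp (A * Real.exp (-β * X)) := Real.one_le_exp (by positivity)
      have h2 : ‖q X‖ ≤ ‖q X‖ * Real.exp (-Γ X) * Real.exp (Γ X) := by
        rw [mul_assoc, ← Real.exp_add]; simp
      calc ‖q X i‖ ≤ ‖q X‖ := norm_le_pi_norm _ _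
        _ ≤ ‖q X‖ * Real.exp (-Γ X) * Real.exp (Γ X) := h2
        _ ≤ (‖q X‖ * Real.exp (-Γ X) + Real.exp (-X)) * Real.exp (Γ X) := by
          gcongr
          linarith [Real.exp_pos (-X)]
        _ ≤ (w i * S) * ((‖q X‖ * Real.exp (-Γ X) + Real.exp (-X)) * Real.exp (Γ X)) *
            Real.exp (A * Real.exp (-β * X)) := by
          have hp : 0 ≤ (‖q X‖ * Real.exp (-Γ X) + Real.exp (-X)) * Real.exp (Γ X) := by
            positivity
          have h3 := mul_le_mul_of_nonneg_right (hSi i) hp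
          rw [one_mul] at h3
          refine h3.trans (le_mul_of_one_le_right ?_ h1)
          exact hp.trans h3
        _ = w i * B X := by
          simp only [hB, hD]
          rw [Real.exp_add]
          ring
    · intro t ht hle i hi
      by_cases h0 : i = 0
      · subst h0
        rw [hq0 t ht.1, norm_zero] at hi
        exact absurd hi (mul_pos (hw 0) (hBpos t)).ne
      set k := C * Real.exp (-β * t) with hk
      have he : 0 < Real.exp (-β * t) := Real.exp_pos _
      have hkle : k ≤ |C| * Real.exp (-β * t) := by
        rw [hk]; exact mul_le_mul_of_nonneg_right (le_abs_self C) he.le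
      have hk0 : 0 ≤ k := (norm_nonneg _).trans (hM.row_zero t ht.1 0)
      have h1 := inner_ge_of_dominance
        (r := -((∑ j, M t 0 j * q t j) / Zs t 0 * Zs t i)) h0 (hBpos t).le
        (fun j _ => hle j) hi (hM.dominance t ht.1 i h0)
      refine lt_of_lt_of_le ?_ h1
      rw [hq0 t ht.1, norm_zero, mul_zero, sub_zero, hi]
      refine mul_lt_mul_of_pos_left ?_ (mul_pos (hw i) (hBpos t))
      have h2 := norm_row_zero_le (hBpos t).le hw (fun j _ => hle j) (hM.row_zero t ht.1)
      rw [hq0 t ht.1, norm_zero, zero_add] at h2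
      have h3 : ‖-((∑ j, M t 0 j * q t j) / Zs t 0 * Zs t i)‖ ≤ k * (W * B t) / c * C' := by
        rw [norm_neg, norm_mul, norm_div]
        have hBt := hBpos t
        refine mul_le_mul ?_ (hup t ht.1 i) (norm_nonneg _) (by positivity)
        exact div_le_div₀ (by positivity) h2 hc (hlow t ht.1)
      have h4 : k * (1 + W * (C' / c)) < w i * (β * A) * Real.exp (-β * t) := by
        calc k * (1 + W * (C' / c)) ≤ |C| * Real.exp (-β * t) * (1 + W * (C' / c)) := by gcongr
          _ = (|C| * (1 + W * (C' / c))) * Real.exp (-β * t) := by ring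
          _ < _ := mul_lt_mul_of_pos_right (hAi i) he
      have h5 := mul_lt_mul_of_pos_right h4 (hBpos t)
      have h6 : k * (1 + W * (C' / c)) * B t = k * B t + k * (W * B t) / c * C' := by
        field_simp
      rw [sub_mul]
      linarith
  have hqz : ∀ t, 0 ≤ t → q t = 0 := by
    intro t ht
    funext i
    rw [Pi.zero_apply, ← norm_le_zero_iff]
    have hlim : Tendsto (fun X => w i * (((‖q X‖ * Real.exp (-Γ X) + Real.exp (-X)) * S) *
        Real.exp (A * Real.exp (-β * t) + Γ t))) atTop (𝓝 (w i * (((0 + 0) * S) *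
        Real.exp (A * Real.exp (-β * t) + Γ t)))) :=
      (((hq.add (Real.tendsto_exp_atBot.comp tendsto_neg_atTop_atBot)).mul_const S).mul_const
        _).const_mul _
    rw [add_zero, zero_mul, zero_mul, mul_zero] at hlim
    exact ge_of_tendsto hlim ((eventually_ge_atTop t).mono fun X hX => key X t ⟨ht, hX⟩ i)
  refine ⟨κ 0, fun t ht => ?_⟩
  have hconst : κ t = κ 0 :=
    constant_of_has_deriv_right_zero (a := 0) (b := t)
      (fun s hs => (hκd s hs.1).continuousWithinAt.mono Icc_subset_Ici_self)
      (fun s hs => by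
        have := (hκd s hs.1).mono (Ici_subset_Ici.2 hs.1)
        rw [hqz s hs.1] at this
        simpa using this) t ⟨ht, le_rfl⟩
  have := hqz t ht
  simp only [hqdef] at this
  rw [sub_eq_zero] at this
  rw [this, hconst]

end ZND

namespace ZND

/-! ### Coefficient families with exponentially decaying derivatives -/

section Families

variable {ι : Type*}

/-- The family `f p`, `p ∈ K`, is bounded on `[0, ∞)`, uniformly in `p`. -/
def UBdd (K : Set ι) (f : ι → ℝ → ℂ) : Prop :=
  ∃ C, ∀ p ∈ K, ∀ x, 0 ≤ x → ‖f p x‖ ≤ C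

/-- The family `f p`, `p ∈ K`, is `O(e^{-βx})`, uniformly in `p`. -/
def UDecay (K : Set ι) (β : ℝ) (f : ι → ℝ → ℂ) : Prop :=
  ∃ C, ∀ p ∈ K, ∀ x, 0 ≤ x → ‖f p x‖ ≤ C * Real.exp (-β * x)

/-- The family `f p`, `p ∈ K`, is uniformly bounded and has `k` continuous derivatives on `[0, ∞)`,
all of which are uniformly `O(e^{-βx})`. -/
def ULevel (K : Set ι) (β : ℝ) : ℕ → (ι → ℝ → ℂ) → Prop
  | 0, f => UBdd K f ∧ ∀ p ∈ K, ContinuousOn (f p) (Ici 0)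
  | k + 1, f => UBdd K f ∧ ∃ f' : ι → ℝ → ℂ,
      (∀ p ∈ K, ∀ x, 0 ≤ x → HasDerivWithinAt (f p) (f' p x) (Ici 0) x) ∧
      UDecay K β f' ∧ ULevel K β k f'

variable {K : Set ι} {β : ℝ} {f g : ι → ℝ → ℂ} {k : ℕ}

lemma UBdd.add (hf : UBdd K f) (hg : UBdd K g) : UBdd K (fun p x => f p x + g p x) := by
  obtain ⟨C, hC⟩ := hf
  obtain ⟨D, hD⟩ := hg
  exact ⟨C + D, fun p hp x hx => (norm_add_le _ _).trans (add_le_add (hC p hp x hx) (hD p hp x hx))⟩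

lemma UBdd.mul (hf : UBdd K f) (hg : UBdd K g) : UBdd K (fun p x => f p x * g p x) := by
  obtain ⟨C, hC⟩ := hf
  obtain ⟨D, hD⟩ := hg
  refine ⟨C * D, fun p hp x hx => ?_⟩
  rw [norm_mul]
  exact mul_le_mul (hC p hp x hx) (hD p hp x hx) (norm_nonneg _)
    ((norm_nonneg _).trans (hC p hp x hx))

lemma UBdd.congr (hf : UBdd K f) (h : ∀ p ∈ K, ∀ x, 0 ≤ x → g p x = f p x) : UBdd K g := by
  obtain ⟨C, hC⟩ := hf
  exact ⟨C, fun p hp x hx => by rw [h p hp x hx]; exact hC p hp x hx⟩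

lemma UDecay.congr (hf : UDecay K β f) (h : ∀ p ∈ K, ∀ x, 0 ≤ x → g p x = f p x) :
    UDecay K β g := by
  obtain ⟨C, hC⟩ := hf
  exact ⟨C, fun p hp x hx => by rw [h p hp x hx]; exact hC p hp x hx⟩

lemma UDecay.zero : UDecay K β (fun _ _ => 0) := ⟨0, fun p _ x _ => by simp⟩

lemma UDecay.add (hf : UDecay K β f) (hg : UDecay K β g) :
    UDecay K β (fun p x => f p x + g p x) := by
  obtain ⟨C, hC⟩ := hf
  obtain ⟨D, hD⟩ := hg
  refine ⟨C + D, fun p hp x hx => ?_⟩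
  rw [add_mul]
  exact (norm_add_le _ _).trans (add_le_add (hC p hp x hx) (hD p hp x hx))

lemma UDecay.mul_bdd (hf : UDecay K β f) (hg : UBdd K g) :
    UDecay K β (fun p x => f p x * g p x) := by
  obtain ⟨C, hC⟩ := hf
  obtain ⟨D, hD⟩ := hg
  refine ⟨C * D, fun p hp x hx => ?_⟩
  rw [norm_mul, mul_right_comm]
  exact mul_le_mul (hC p hp x hx) (hD p hp x hx) (norm_nonneg _)
    ((norm_nonneg _).trans (hC p hp x hx))

lemma UDecay.bdd_mul (hf : UBdd K f) (hg : UDecay K β g) :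
    UDecay K β (fun p x => f p x * g p x) :=
  (hg.mul_bdd hf).congr fun _ _ _ _ => mul_comm _ _

lemma UDecay.neg (hf : UDecay K β f) : UDecay K β (fun p x => -f p x) := by
  obtain ⟨C, hC⟩ := hf
  exact ⟨C, fun p hp x hx => by rw [norm_neg]; exact hC p hp x hx⟩

lemma UDecay.sub (hf : UDecay K β f) (hg : UDecay K β g) :
    UDecay K β (fun p x => f p x - g p x) :=
  (hf.add hg.neg).congr fun _ _ _ _ => sub_eq_add_neg _ _

lemma UDecay.sum {α : Type*} (s : Finset α) {f : α → ι → ℝ → ℂ} (hf : ∀ a ∈ s, UDecay K β (f a)) :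
    UDecay K β (fun p x => ∑ a ∈ s, f a p x) := by
  classical
  induction s using Finset.induction_on with
  | empty => simpa using UDecay.zero
  | insert a s ha ih =>
    simp only [Finset.sum_insert ha]
    exact (hf a (Finset.mem_insert_self _ _)).add
      (ih fun b hb => hf b (Finset.mem_insert_of_mem hb))

lemma ULevel.bdd (hf : ULevel K β k f) : UBdd K f := by
  cases k <;> exact hf.1

lemma ULevel.cont (hf : ULevel K β k f) : ∀ p ∈ K, ContinuousOn (f p) (Ici 0) := by
  cases k with
  | zero => exact hf.2
  | succ k =>
    obtain ⟨-, f', hd, -⟩ := hf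
    exact fun p hp x hx => (hd p hp x hx).continuousWithinAt

lemma ULevel.pred (hf : ULevel K β (k + 1) f) : ULevel K β k f := by
  induction k generalizing f with
  | zero => exact ⟨hf.bdd, hf.cont⟩
  | succ k ih =>
    obtain ⟨hb, f', hd, hdec, hl⟩ := hf
    exact ⟨hb, f', hd, hdec, ih hl⟩

lemma ULevel.congr (hf : ULevel K β k f) (h : ∀ p ∈ K, ∀ x, 0 ≤ x → g p x = f p x) :
    ULevel K β k g := by
  cases k with
  | zero => exact ⟨hf.bdd.congr h, fun p hp => (hf.2 p hp).congr fun x hx => h p hp x hx⟩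
  | succ k =>
    obtain ⟨hb, f', hd, hdec, hl⟩ := hf
    exact ⟨hb.congr h, f', fun p hp x hx => (hd p hp x hx).congr (fun y hy => h p hp y hy)
      (h p hp x hx), hdec, hl⟩

lemma ULevel.const {c : ι → ℂ} (hc : ∃ C, ∀ p ∈ K, ‖c p‖ ≤ C) :
    ULevel K β k (fun p _ => c p) := by
  induction k generalizing c with
  | zero => exact ⟨hc.imp fun C h p hp _ _ => h p hp, fun p _ => continuousOn_const⟩
  | succ k ih =>
    exact ⟨hc.imp fun C h p hp _ _ => h p hp, fun _ _ => 0,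
      fun p _ x _ => hasDerivWithinAt_const _ _ _, UDecay.zero, ih ⟨0, by simp⟩⟩

lemma ULevel.cst (c : ℂ) : ULevel K β k (fun _ _ => c) := ULevel.const ⟨‖c‖, fun _ _ => le_rfl⟩

lemma ULevel.add (hf : ULevel K β k f) (hg : ULevel K β k g) :
    ULevel K β k (fun p x => f p x + g p x) := by
  induction k generalizing f g with
  | zero => exact ⟨hf.bdd.add hg.bdd, fun p hp => (hf.2 p hp).add (hg.2 p hp)⟩
  | succ k ih =>
    obtain ⟨hb, f', hd, hdec, hl⟩ := hf
    obtain ⟨hb2, g', hd2, hdec2, hl2⟩ := hg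
    exact ⟨hb.add hb2, fun p x => f' p x + g' p x,
      fun p hp x hx => (hd p hp x hx).add (hd2 p hp x hx), hdec.add hdec2, ih hl hl2⟩

lemma ULevel.mul (hf : ULevel K β k f) (hg : ULevel K β k g) :
    ULevel K β k (fun p x => f p x * g p x) := by
  induction k generalizing f g with
  | zero => exact ⟨hf.bdd.mul hg.bdd, fun p hp => (hf.2 p hp).mul (hg.2 p hp)⟩
  | succ k ih =>
    have hf0 := hf.pred
    have hg0 := hg.pred
    obtain ⟨hb, f', hd, hdec, hl⟩ := hf
    obtain ⟨hb2, g', hd2, hdec2, hl2⟩ := hg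
    exact ⟨hb.mul hb2, fun p x => f' p x * g p x + f p x * g' p x,
      fun p hp x hx => (hd p hp x hx).mul (hd2 p hp x hx),
      (hdec.mul_bdd hb2).add (UDecay.bdd_mul hb hdec2), (ih hl hg0).add (ih hf0 hl2)⟩

lemma ULevel.neg (hf : ULevel K β k f) : ULevel K β k (fun p x => -f p x) :=
  ((ULevel.cst (-1)).mul hf).congr fun _ _ _ _ => by ring

lemma ULevel.sub (hf : ULevel K β k f) (hg : ULevel K β k g) :
    ULevel K β k (fun p x => f p x - g p x) :=
  (hf.add hg.neg).congr fun _ _ _ _ => sub_eq_add_neg _ _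

lemma ULevel.inv (hf : ULevel K β k f) {c : ℝ} (hc : 0 < c)
    (h : ∀ p ∈ K, ∀ x, 0 ≤ x → c ≤ ‖f p x‖) : ULevel K β k (fun p x => (f p x)⁻¹) := by
  have hne : ∀ p ∈ K, ∀ x, 0 ≤ x → f p x ≠ 0 := fun p hp x hx => by
    rw [← norm_pos_iff]; exact hc.trans_le (h p hp x hx)
  have hb : UBdd K (fun p x => (f p x)⁻¹) := ⟨c⁻¹, fun p hp x hx => by
    rw [norm_inv]; exact inv_anti₀ hc (h p hp x hx)⟩
  induction k generalizing f with
  | zero => exact ⟨hb, fun p hp => (hf.2 p hp).inv₀ fun x hx => hne p hp x hx⟩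
  | succ k ih =>
    have hi := ih hf.pred h hne hb
    obtain ⟨-, f', hd, hdec, hl⟩ := hf
    refine ⟨hb, fun p x => -(f' p x * ((f p x)⁻¹ * (f p x)⁻¹)), fun p hp x hx => ?_,
      (hdec.mul_bdd (hb.mul hb)).neg, (hl.mul (hi.mul hi)).neg⟩
    refine ((hd p hp x hx).inv (hne p hp x hx)).congr_deriv ?_
    have := hne p hp x hx
    field_simp

lemma ULevel.div (hf : ULevel K β k f) (hg : ULevel K β k g) {c : ℝ} (hc : 0 < c)
    (h : ∀ p ∈ K, ∀ x, 0 ≤ x → c ≤ ‖g p x‖) : ULevel K β k (fun p x => f p x / g p x) :=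
  (hf.mul (hg.inv hc h)).congr fun _ _ _ _ => div_eq_mul_inv _ _

lemma ULevel.sum {α : Type*} (s : Finset α) {f : α → ι → ℝ → ℂ}
    (hf : ∀ a ∈ s, ULevel K β k (f a)) : ULevel K β k (fun p x => ∑ a ∈ s, f a p x) := by
  classical
  induction s using Finset.induction_on with
  | empty => simpa using ULevel.cst 0
  | insert a s ha ih =>
    simp only [Finset.sum_insert ha]
    exact (hf a (Finset.mem_insert_self _ _)).add
      (ih fun b hb => hf b (Finset.mem_insert_of_mem hb))

lemma cpow_half_mul_self (z : ℂ) : z ^ (1 / 2 : ℂ) * z ^ (1 / 2 : ℂ) = z := by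
  by_cases hz : z = 0
  · simp [hz]
  · rw [← Complex.cpow_add _ _ hz]
    norm_num

lemma ULevel.cpow_half (hf : ULevel K β k f) {c : ℝ} (hc : 0 < c)
    (h : ∀ p ∈ K, ∀ x, 0 ≤ x → c ≤ ‖f p x‖) (hre : ∀ p ∈ K, ∀ x, 0 ≤ x → 0 ≤ (f p x).re) :
    ULevel K β k (fun p x => f p x ^ (1 / 2 : ℂ)) := by
  have hsl : ∀ p ∈ K, ∀ x, 0 ≤ x → f p x ∈ Complex.slitPlane := fun p hp x hx => by
    rw [Complex.mem_slitPlane_iff]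
    by_contra hcon
    push Not at hcon
    have h1 : (f p x).re = 0 := le_antisymm hcon.1 (hre p hp x hx)
    have h2 : f p x = 0 := Complex.ext h1 hcon.2
    have h3 := h p hp x hx
    rw [h2, norm_zero] at h3
    linarith
  have hsq : ∀ p x, ‖f p x ^ (1 / 2 : ℂ)‖ * ‖f p x ^ (1 / 2 : ℂ)‖ = ‖f p x‖ := fun p x => by
    rw [← norm_mul, cpow_half_mul_self]
  have hb : UBdd K (fun p x => f p x ^ (1 / 2 : ℂ)) := by
    obtain ⟨C, hC⟩ := hf.bdd
    refine ⟨C + 1, fun p hp x hx => ?_⟩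
    nlinarith [hsq p x, hC p hp x hx, norm_nonneg (f p x ^ (1 / 2 : ℂ))]
  have hlow : ∀ p ∈ K, ∀ x, 0 ≤ x → Real.sqrt c ≤ ‖f p x ^ (1 / 2 : ℂ)‖ := fun p hp x hx => by
    rw [Real.sqrt_le_left (norm_nonneg _), sq, hsq]
    exact h p hp x hx
  have hcont : ∀ p ∈ K, ContinuousOn (f p) (Ici 0) →
      ContinuousOn (fun x => f p x ^ (1 / 2 : ℂ)) (Ici 0) := fun p hp hc x hx =>
    (continuousAt_cpow_const (hsl p hp x hx)).comp_continuousWithinAt (hc x hx)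
  induction k generalizing f with
  | zero => exact ⟨hb, fun p hp => hcont p hp (hf.2 p hp)⟩
  | succ k ih =>
    have hi := ih hf.pred h hre hsl hsq hb hlow hcont
    have hinv := hi.inv (Real.sqrt_pos.2 hc) hlow
    obtain ⟨-, f', hd, hdec, hl⟩ := hf
    refine ⟨hb, fun p x => f' p x * (1 / 2 * (f p x ^ (1 / 2 : ℂ))⁻¹), fun p hp x hx => ?_,
      hdec.mul_bdd ((ULevel.cst (k := k) (β := β) (1 / 2)).mul hinv).bdd,
      hl.mul ((ULevel.cst (1 / 2)).mul hinv)⟩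
    have h1 := (Complex.hasStrictDerivAt_cpow_const (c := 1 / 2) (hsl p hp x hx)).hasDerivAt
    have h2 := h1.comp_hasDerivWithinAt x (hd p hp x hx)
    refine h2.congr_deriv ?_
    have h3 : (1 / 2 : ℂ) - 1 = -(1 / 2) := by norm_num
    rw [h3, Complex.cpow_neg]
    ring

lemma ULevel.exists_tendsto (hβ : 0 < β) (hf : ULevel K β (k + 1) f) :
    ∀ p ∈ K, ∃ l, Tendsto (f p) atTop (𝓝 l) := by
  obtain ⟨-, f', hd, ⟨C, hC⟩, -⟩ := hf
  exact fun p hp => exists_tendsto_of_deriv_decay hβ (hd p hp) (hC p hp)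

end Families

/-! ### The branch of the square root -/

/-- The principal square root maps the closed right half plane to the sector `|Im| ≤ Re`. -/
lemma abs_im_cpow_half_le {z : ℂ} (hz : 0 ≤ z.re) :
    |(z ^ (1 / 2 : ℂ)).im| ≤ (z ^ (1 / 2 : ℂ)).re := by
  set r := z ^ (1 / 2 : ℂ) with hr
  have h1 : 0 ≤ r.re := by
    by_cases h0 : z = 0
    · simp [hr, h0]
    · rw [hr, Complex.cpow_def_of_ne_zero h0, Complex.exp_re]
      refine mul_nonneg (Real.exp_pos _).le (Real.cos_nonneg_of_mem_Icc ?_)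
      have h2 : (Complex.log z * (1 / 2)).im = z.arg / 2 := by
        rw [Complex.mul_im, Complex.log_im]
        norm_num
        ring
      rw [h2]
      have h3 := Complex.neg_pi_lt_arg z
      have h4 := Complex.arg_le_pi z
      constructor <;> linarith
  have h2 : r.re * r.re - r.im * r.im = z.re := by
    rw [← Complex.mul_re, hr, cpow_half_mul_self]
  exact abs_le_of_sq_le_sq (by nlinarith) h1

lemma sqrtBranch_sq (a : ℝ) (z : ℂ) : sqrtBranch a z ^ 2 = z ^ 2 + (a : ℂ) ^ 2 := by
  have h1 := cpow_half_mul_self (z - Complex.I * a)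
  have h2 := cpow_half_mul_self (z + Complex.I * a)
  rw [sqrtBranch]
  calc _ = ((z - Complex.I * a) ^ (1 / 2 : ℂ) * (z - Complex.I * a) ^ (1 / 2 : ℂ)) *
        ((z + Complex.I * a) ^ (1 / 2 : ℂ) * (z + Complex.I * a) ^ (1 / 2 : ℂ)) := by ring
    _ = _ := by
      rw [h1, h2]
      linear_combination (-(a : ℂ) ^ 2) * Complex.I_sq

lemma le_of_sq_le_sq_of_nonneg {x y : ℝ} (h : x ^ 2 ≤ y ^ 2) (hy : 0 ≤ y) : x ≤ y :=
  (le_abs_self x).trans (abs_le_of_sq_le_sq h hy)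

/-- If `z = p + i q` and `z' = p' + i q'` lie in the right half plane and `z²`, `z'²` have the same
nonnegative real part, then `Im (z² + z'²)` and `Im (z z')` do not have opposite signs. -/
lemma mul_cross_nonneg {p q p' q' c : ℝ} (hc : 0 ≤ c) (hp : 0 ≤ p) (hp' : 0 ≤ p')
    (h : p * p - q * q = c) (h' : p' * p' - q' * q' = c) :
    0 ≤ (p * q + p' * q') * (p * q' + q * p') := by
  have aux : ∀ x y X Y : ℝ, 0 ≤ x → 0 ≤ y → 0 ≤ X → 0 ≤ Y → Y ≤ X → x * x - X * X = c →
      y * y - Y * Y = c → 0 ≤ (x * X - y * Y) * (y * X - x * Y) := by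
    intro x y X Y hx hy hX hY hXY h1 h2
    have hXX : Y * Y ≤ X * X := mul_self_le_mul_self hY hXY
    have hxy : y ≤ x := le_of_sq_le_sq_of_nonneg (by rw [sq, sq]; linarith) hx
    refine mul_nonneg (sub_nonneg.2 (mul_le_mul hxy hXY hY hx)) (sub_nonneg.2 ?_)
    refine le_of_sq_le_sq_of_nonneg ?_ (mul_nonneg hy hX)
    have h3 : (y * X) ^ 2 - (x * Y) ^ 2 = c * (X * X - Y * Y) := by
      have e1 : x * x = c + X * X := by linarith
      have e2 : y * y = c + Y * Y := by linarith
      calc _ = (y * y) * (X * X) - (x * x) * (Y * Y) := by ring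
        _ = _ := by rw [e1, e2]; ring
    have h4 : 0 ≤ c * (X * X - Y * Y) := mul_nonneg hc (by linarith)
    linarith
  have hexpand : (p * q + p' * q') * (p * q' + q * p') =
      q * q' * (p * p + p' * p') + p * p' * (q * q + q' * q') := by ring
  have hbase : 0 ≤ (p * |q| - p' * |q'|) * (p' * |q| - p * |q'|) := by
    rcases le_total |q'| |q| with hq | hq
    · exact aux p p' _ _ hp hp' (abs_nonneg _) (abs_nonneg _) hq
        (by rw [abs_mul_abs_self]; exact h) (by rw [abs_mul_abs_self]; exact h')
    · have := aux p' p _ _ hp' hp (abs_nonneg _) (abs_nonneg _) hq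
        (by rw [abs_mul_abs_self]; exact h') (by rw [abs_mul_abs_self]; exact h)
      linarith
  have hfac : (p * |q| - p' * |q'|) * (p' * |q| - p * |q'|) =
      p * p' * (|q| * |q| + |q'| * |q'|) - |q * q'| * (p * p + p' * p') := by
    rw [abs_mul]
    ring
  rw [hfac, abs_mul_abs_self, abs_mul_abs_self] at hbase
  have hcross := mul_le_mul_of_nonneg_right (neg_abs_le (q * q'))
    (add_nonneg (mul_self_nonneg p) (mul_self_nonneg p'))
  rw [hexpand]
  linarith

/-- The branch maps the closed first and fourth quadrants to themselves. -/
lemma sqrtBranch_quadrant (a : ℝ) {z : ℂ} (hz : 0 ≤ z.re) :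
    0 ≤ (sqrtBranch a z).re ∧ 0 ≤ z.im * (sqrtBranch a z).im := by
  have hre1 : (z - Complex.I * a).re = z.re := by simp
  have hre2 : (z + Complex.I * a).re = z.re := by simp
  have him1 : (z - Complex.I * a).im = z.im - a := by simp
  have him2 : (z + Complex.I * a).im = z.im + a := by simp
  have hs1 := abs_im_cpow_half_le (z := z - Complex.I * a) (by rw [hre1]; exact hz)
  have hs2 := abs_im_cpow_half_le (z := z + Complex.I * a) (by rw [hre2]; exact hz)
  have hq1 := cpow_half_mul_self (z - Complex.I * a)
  have hq2 := cpow_half_mul_self (z + Complex.I * a)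
  rw [sqrtBranch]
  generalize (z - Complex.I * a) ^ (1 / 2 : ℂ) = r at hs1 hq1 ⊢
  generalize (z + Complex.I * a) ^ (1 / 2 : ℂ) = t at hs2 hq2 ⊢
  have e1 := congrArg Complex.re hq1
  have e2 := congrArg Complex.re hq2
  have e3 := congrArg Complex.im hq1
  have e4 := congrArg Complex.im hq2
  rw [Complex.mul_re, hre1] at e1
  rw [Complex.mul_re, hre2] at e2
  rw [Complex.mul_im, him1] at e3
  rw [Complex.mul_im, him2] at e4
  rw [Complex.mul_re, Complex.mul_im]
  obtain ⟨p, q⟩ := r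
  obtain ⟨p', q'⟩ := t
  simp only at *
  rw [abs_le] at hs1 hs2
  have hp : 0 ≤ p := by linarith
  have hp' : 0 ≤ p' := by linarith
  refine ⟨by nlinarith, ?_⟩
  have him : z.im = p * q + p' * q' := by linarith
  rw [him]
  exact mul_cross_nonneg hz hp hp' (by linarith) (by linarith)

/-- The branch does not decrease the real part. -/
lemma re_le_re_sqrtBranch {a : ℝ} (ha : 0 < a) {z : ℂ} (hz : 0 ≤ z.re) :
    z.re ≤ (sqrtBranch a z).re := by
  obtain ⟨h1, h2⟩ := sqrtBranch_quadrant a hz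
  have hs := sqrtBranch_sq a z
  have e1 := congrArg Complex.re hs
  have e2 := congrArg Complex.im hs
  simp only [sq, Complex.mul_re, Complex.mul_im, Complex.add_re, Complex.add_im,
    Complex.ofReal_re, Complex.ofReal_im] at e1 e2
  set s := sqrtBranch a z
  by_contra hlt
  push Not at hlt
  have h3 : s.re * s.im = z.re * z.im := by linarith
  have h4 : s.im * s.im ≥ z.im * z.im := by
    rcases h1.eq_or_lt with h | h
    · rw [← h, zero_mul] at h3
      have : z.im = 0 := by
        rcases mul_eq_zero.1 h3.symm with h' | h'
        · linarith
        · exact h'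
      rw [this]
      nlinarith
    · have h5 : s.re * s.re * (z.im * z.im) ≤ s.re * s.re * (s.im * s.im) := by
        have h6 : s.re * s.re * (s.im * s.im) = z.re * z.re * (z.im * z.im) := by
          calc _ = (s.re * s.im) * (s.re * s.im) := by ring
            _ = _ := by rw [h3]; ring
        rw [h6]
        refine mul_le_mul_of_nonneg_right ?_ (mul_self_nonneg _)
        nlinarith
      exact le_of_mul_le_mul_left h5 (by positivity)
  nlinarith

/-- Since `ζ` and `s` lie in the same quadrant, they do not cancel. -/
lemma norm_sqrtBranch_le_norm_add (a : ℝ) {z : ℂ} (hz : 0 ≤ z.re) {κ : ℝ} (hκ : 0 ≤ κ) :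
    κ * ‖sqrtBranch a z‖ ≤ ‖z + κ * sqrtBranch a z‖ := by
  obtain ⟨h1, h2⟩ := sqrtBranch_quadrant a hz
  set s := sqrtBranch a z
  refine le_of_sq_le_sq_of_nonneg ?_ (norm_nonneg _)
  rw [mul_pow, ← Complex.normSq_eq_norm_sq, ← Complex.normSq_eq_norm_sq, Complex.normSq_apply,
    Complex.normSq_apply]
  simp only [Complex.add_re, Complex.add_im, Complex.mul_re, Complex.mul_im, Complex.ofReal_re,
    Complex.ofReal_im]
  nlinarith [mul_nonneg hκ (mul_nonneg hz h1), mul_nonneg hκ h2, sq_nonneg z.re, sq_nonneg z.im]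

/-- Lipschitz dependence of the branch on `ζ` away from the branch points. -/
lemma norm_sqrtBranch_sub_le {a d ρ : ℝ} (hd : 0 < d) {z z' : ℂ} (hz : 0 ≤ z.re) (hz' : 0 ≤ z'.re)
    (hm : d ≤ ‖z - Complex.I * a‖) (hp : d ≤ ‖z + Complex.I * a‖)
    (hm' : ‖z' - Complex.I * a‖ ≤ ρ) (hp' : ‖z + Complex.I * a‖ ≤ ρ) :
    ‖sqrtBranch a z - sqrtBranch a z'‖ ≤ 2 * Real.sqrt ρ / Real.sqrt d * ‖z - z'‖ := by
  have hsq : ∀ y : ℂ, ‖y ^ (1 / 2 : ℂ)‖ * ‖y ^ (1 / 2 : ℂ)‖ = ‖y‖ := fun y => by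
    rw [← norm_mul, cpow_half_mul_self]
  have hnorm : ∀ y : ℂ, ‖y ^ (1 / 2 : ℂ)‖ = Real.sqrt ‖y‖ := fun y => by
    rw [← hsq y, Real.sqrt_mul_self (norm_nonneg _)]
  have hroot : ∀ y y' : ℂ, 0 ≤ y.re → 0 ≤ y'.re → d ≤ ‖y‖ →
      ‖y ^ (1 / 2 : ℂ) - y' ^ (1 / 2 : ℂ)‖ ≤ ‖y - y'‖ / Real.sqrt d := by
    intro y y' hy hy' hdy
    have h1 := abs_im_cpow_half_le hy
    have h2 := abs_im_cpow_half_le hy'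
    have h3 := cpow_half_mul_self y
    have h4 := cpow_half_mul_self y'
    have h5 : Real.sqrt d ≤ ‖y ^ (1 / 2 : ℂ)‖ := by
      rw [hnorm]; exact Real.sqrt_le_sqrt hdy
    generalize y ^ (1 / 2 : ℂ) = r at *
    generalize y' ^ (1 / 2 : ℂ) = t at *
    have h6 : ‖r‖ ≤ ‖r + t‖ := by
      refine le_of_sq_le_sq_of_nonneg ?_ (norm_nonneg _)
      rw [← Complex.normSq_eq_norm_sq, ← Complex.normSq_eq_norm_sq, Complex.normSq_apply,
        Complex.normSq_apply]
      simp only [Complex.add_re, Complex.add_im]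
      rw [abs_le] at h1 h2
      nlinarith
    rw [le_div_iff₀ (Real.sqrt_pos.2 hd), ← h3, ← h4,
      show r * r - t * t = (r - t) * (r + t) by ring, norm_mul]
    exact mul_le_mul_of_nonneg_left (h5.trans h6) (norm_nonneg _)
  rw [sqrtBranch, sqrtBranch]
  have r1 := hroot (z - Complex.I * a) (z' - Complex.I * a) (by simpa using hz)
    (by simpa using hz') hm
  have r2 := hroot (z + Complex.I * a) (z' + Complex.I * a) (by simpa using hz)
    (by simpa using hz') hp
  rw [sub_sub_sub_cancel_right] at r1
  rw [add_sub_add_right_eq_sub] at r2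
  have n1 : ‖(z' - Complex.I * a) ^ (1 / 2 : ℂ)‖ ≤ Real.sqrt ρ := by
    rw [hnorm]; exact Real.sqrt_le_sqrt hm'
  have n2 : ‖(z + Complex.I * a) ^ (1 / 2 : ℂ)‖ ≤ Real.sqrt ρ := by
    rw [hnorm]; exact Real.sqrt_le_sqrt hp'
  generalize (z - Complex.I * a) ^ (1 / 2 : ℂ) = A at *
  generalize (z' - Complex.I * a) ^ (1 / 2 : ℂ) = A' at *
  generalize (z + Complex.I * a) ^ (1 / 2 : ℂ) = E at *
  generalize (z' + Complex.I * a) ^ (1 / 2 : ℂ) = E' at *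
  calc ‖A * E - A' * E'‖ = ‖(A - A') * E + A' * (E - E')‖ := by ring_nf
    _ ≤ ‖(A - A') * E‖ + ‖A' * (E - E')‖ := norm_add_le _ _
    _ ≤ ‖z - z'‖ / Real.sqrt d * Real.sqrt ρ + Real.sqrt ρ * (‖z - z'‖ / Real.sqrt d) := by
      rw [norm_mul, norm_mul]
      gcongr
    _ = _ := by ring

end ZND

namespace ZND

/-! ### Smooth functions along the profile -/

/-- The thermodynamic part `(v, S, lam)` of a state `(v, u, S, lam)`. -/
def thermo (z : ℝ × ℝ × ℝ × ℝ) : ℝ × ℝ × ℝ := (z.1, z.2.2.1, z.2.2.2)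

lemma contDiff_thermo : ContDiff ℝ ∞ thermo := by
  unfold thermo
  fun_prop

namespace ThermoModel

variable (M : ThermoModel)

/-- The admissible states `(v, u, S, lam)` with `0 < u < c₀`. -/
def subsonic : Set (ℝ × ℝ × ℝ × ℝ) :=
  {z | thermo z ∈ M.U ∧ 0 < z.2.1 ∧ z.2.1 ^ 2 < -(z.1 ^ 2 * partialV M.p (thermo z))}

/-- The vector field on subsonic states whose integral curves are the steady profiles: the ZND
equations solved for `(v', u', S', lam')`. -/
def field (z : ℝ × ℝ × ℝ × ℝ) : ℝ × ℝ × ℝ × ℝ :=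
  let u' := -(z.1 * (partialS M.p (thermo z) * M.entropySource (thermo z) +
    partialLam M.p (thermo z) * M.r (thermo z))) / (z.2.1 ^ 2 + z.1 ^ 2 * partialV M.p (thermo z))
  (z.1 / z.2.1 * u', u', M.entropySource (thermo z) / z.2.1, M.r (thermo z) / z.2.1)

/-- Derivative along `field`. -/
def along (f : ℝ × ℝ × ℝ × ℝ → ℝ) (z : ℝ × ℝ × ℝ × ℝ) : ℝ := fderiv ℝ f z (M.field z)

variable {M}

lemma contDiffOn_fderiv_apply {f : ℝ × ℝ × ℝ → ℝ} (hf : ContDiffOn ℝ ∞ f M.U) (e : ℝ × ℝ × ℝ) :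
    ContDiffOn ℝ ∞ (fun z => fderiv ℝ f z e) M.U :=
  (hf.fderiv_of_isOpen M.isOpen_U (by simp)).clm_apply contDiffOn_const

lemma contDiffOn_partialV {f : ℝ × ℝ × ℝ → ℝ} (hf : ContDiffOn ℝ ∞ f M.U) :
    ContDiffOn ℝ ∞ (partialV f) M.U := contDiffOn_fderiv_apply hf _

lemma contDiffOn_partialS {f : ℝ × ℝ × ℝ → ℝ} (hf : ContDiffOn ℝ ∞ f M.U) :
    ContDiffOn ℝ ∞ (partialS f) M.U := contDiffOn_fderiv_apply hf _

lemma contDiffOn_partialLam {f : ℝ × ℝ × ℝ → ℝ} (hf : ContDiffOn ℝ ∞ f M.U) :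
    ContDiffOn ℝ ∞ (partialLam f) M.U := contDiffOn_fderiv_apply hf _

variable (M) in
lemma contDiffOn_entropySource : ContDiffOn ℝ ∞ M.entropySource M.U :=
  ((M.contDiffOn_r.mul M.contDiffOn_deltaF).neg).div M.contDiffOn_temp
    fun z hz => (M.temp_pos z hz).ne'

lemma contDiffOn_comp_thermo {f : ℝ × ℝ × ℝ → ℝ} (hf : ContDiffOn ℝ ∞ f M.U) :
    ContDiffOn ℝ ∞ (fun z => f (thermo z)) M.subsonic :=
  hf.comp contDiff_thermo.contDiffOn fun _ hz => hz.1

variable (M)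

lemma isOpen_subsonic : IsOpen M.subsonic := by
  have h1 : IsOpen (thermo ⁻¹' M.U) := M.isOpen_U.preimage contDiff_thermo.continuous
  have h2 : ContinuousOn (fun z : ℝ × ℝ × ℝ × ℝ =>
      -(z.1 ^ 2 * partialV M.p (thermo z)) - z.2.1 ^ 2) (thermo ⁻¹' M.U) := by
    have h3 : ContinuousOn (fun z => partialV M.p (thermo z)) (thermo ⁻¹' M.U) :=
      (contDiffOn_partialV M.contDiffOn_p).continuousOn.comp
        contDiff_thermo.continuous.continuousOn fun _ hz => hz
    fun_prop
  have h3 := h2.isOpen_inter_preimage h1 (isOpen_Ioi (a := (0 : ℝ)))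
  have h4 : IsOpen {z : ℝ × ℝ × ℝ × ℝ | 0 < z.2.1} := isOpen_lt continuous_const (by fun_prop)
  convert h3.inter h4 using 1
  ext z
  simp only [subsonic, mem_ofPred_eq, mem_inter_iff, mem_preimage, mem_Ioi, sub_pos]
  tauto

variable {M}

lemma contDiffOn_vol : ContDiffOn ℝ ∞ (fun z : ℝ × ℝ × ℝ × ℝ => z.1) M.subsonic := by fun_prop

lemma contDiffOn_vel : ContDiffOn ℝ ∞ (fun z : ℝ × ℝ × ℝ × ℝ => z.2.1) M.subsonic := by fun_prop

lemma denom_neg {z : ℝ × ℝ × ℝ × ℝ} (hz : z ∈ M.subsonic) :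
    z.2.1 ^ 2 + z.1 ^ 2 * partialV M.p (thermo z) < 0 := by linarith [hz.2.2]

variable (M) in
lemma contDiffOn_field : ContDiffOn ℝ ∞ M.field M.subsonic := by
  have hΦ := contDiffOn_comp_thermo M.contDiffOn_entropySource
  have hr := contDiffOn_comp_thermo M.contDiffOn_r
  have hv := contDiffOn_comp_thermo (contDiffOn_partialV M.contDiffOn_p)
  have hS := contDiffOn_comp_thermo (contDiffOn_partialS M.contDiffOn_p)
  have hL := contDiffOn_comp_thermo (contDiffOn_partialLam M.contDiffOn_p)
  have hu0 : ∀ z ∈ M.subsonic, z.2.1 ≠ 0 := fun z hz => hz.2.1.ne'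
  have hu' : ContDiffOn ℝ ∞ (fun z : ℝ × ℝ × ℝ × ℝ =>
      -(z.1 * (partialS M.p (thermo z) * M.entropySource (thermo z) +
    partialLam M.p (thermo z) * M.r (thermo z))) / (z.2.1 ^ 2 + z.1 ^ 2 * partialV M.p (thermo z)))
      M.subsonic :=
    ((contDiffOn_vol.mul ((hS.mul hΦ).add (hL.mul hr))).neg).div
      ((contDiffOn_vel.pow 2).add ((contDiffOn_vol.pow 2).mul hv)) fun z hz => (denom_neg hz).ne
  exact ((contDiffOn_vol.div contDiffOn_vel hu0).mul hu').prodMk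
    (hu'.prodMk ((hΦ.div contDiffOn_vel hu0).prodMk (hr.div contDiffOn_vel hu0)))

lemma contDiffOn_along {f : ℝ × ℝ × ℝ × ℝ → ℝ} (hf : ContDiffOn ℝ ∞ f M.subsonic) :
    ContDiffOn ℝ ∞ (M.along f) M.subsonic :=
  (hf.fderiv_of_isOpen M.isOpen_subsonic (by simp)).clm_apply M.contDiffOn_field

/-- The sound speed as a function of `(v, u, S, lam)`. -/
lemma contDiffOn_sound : ContDiffOn ℝ ∞ (fun z => M.c0 (thermo z)) M.subsonic := by
  have hv := contDiffOn_comp_thermo (contDiffOn_partialV M.contDiffOn_p)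
  exact ((contDiffOn_vol.pow 2).mul hv).neg.sqrt fun z hz => by
    have := hz.2.2
    have h2 := sq_nonneg z.2.1
    simp only [thermo] at *
    exact (h2.trans_lt this).ne'

lemma sound_sq {z : ℝ × ℝ × ℝ × ℝ} (hz : z ∈ M.subsonic) :
    M.c0 (thermo z) ^ 2 = -(z.1 ^ 2 * partialV M.p (thermo z)) := by
  rw [c0, Real.sq_sqrt]
  · rfl
  · have := hz.2.2
    have h2 := sq_nonneg z.2.1
    simp only [thermo] at *
    linarith

lemma vel_lt_sound {z : ℝ × ℝ × ℝ × ℝ} (hz : z ∈ M.subsonic) : z.2.1 < M.c0 (thermo z) :=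
  lt_of_pow_lt_pow_left₀ 2 (Real.sqrt_nonneg _) (by rw [sound_sq hz]; exact hz.2.2)

lemma fderiv_apply_eq (f : ℝ × ℝ × ℝ → ℝ) (z : ℝ × ℝ × ℝ) (a b c : ℝ) :
    fderiv ℝ f z (a, b, c) = partialV f z * a + partialS f z * b + partialLam f z * c := by
  have : ((a, b, c) : ℝ × ℝ × ℝ) = a • (1, 0, 0) + b • (0, 1, 0) + c • (0, 0, 1) := by
    simp
  rw [this, map_add, map_add, map_smul, map_smul, map_smul]
  simp only [partialV, partialS, partialLam, smul_eq_mul]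
  ring

end ThermoModel

namespace Profile

variable {M : ThermoModel} (D : Profile M)

/-- The profile as a curve of states `(v, u, S, lam)`. -/
def path (x : ℝ) : ℝ × ℝ × ℝ × ℝ := (D.v x, D.u x, D.S x, D.lam x)

/-- The end state `(v, u, S, lam)`. -/
def pathInf : ℝ × ℝ × ℝ × ℝ := (D.vInf, D.uInf, D.SInf, D.lamInf)

/-- `β` is an exponential rate of convergence of the profile to its end state. -/
def HasRate (β : ℝ) : Prop :=
  0 < β ∧ ∃ C, ∀ x, 0 ≤ x → ‖D.path x - D.pathInf‖ ≤ C * Real.exp (-β * x)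

lemma exists_hasRate : ∃ β, D.HasRate β := by
  obtain ⟨C, β, -, hβ, h⟩ := D.exp_decay
  refine ⟨β, hβ, C, fun x hx => ?_⟩
  obtain ⟨h1, h2, h3, h4⟩ := h x hx
  simp only [path, pathInf, Prod.mk_sub_mk, Prod.norm_mk, Real.norm_eq_abs]
  exact max_le h1 (max_le h2 (max_le h3 h4))

lemma tendsto_exp_neg {β : ℝ} (hβ : 0 < β) (C : ℝ) :
    Tendsto (fun x : ℝ => C * Real.exp (-β * x)) atTop (𝓝 0) := by
  have : Tendsto (fun x : ℝ => Real.exp (-β * x)) atTop (𝓝 0) :=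
    Real.tendsto_exp_atBot.comp
      ((tendsto_const_mul_atBot_of_neg (by linarith : -β < 0)).2 tendsto_id)
  simpa using this.const_mul C

lemma tendsto_path : Tendsto D.path atTop (𝓝 D.pathInf) := by
  obtain ⟨β, hβ, C, hC⟩ := D.exists_hasRate
  rw [tendsto_iff_norm_sub_tendsto_zero]
  exact squeeze_zero' (Eventually.of_forall fun _ => norm_nonneg _)
    ((eventually_ge_atTop 0).mono hC) (tendsto_exp_neg hβ C)

lemma vel_pos {x : ℝ} (hx : 0 ≤ x) : 0 < D.u x := by
  obtain ⟨C₁, C₂, h1, h⟩ := D.u_bounds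
  exact h1.trans_le (h x hx).1

lemma path_mem {x : ℝ} (hx : 0 ≤ x) : D.path x ∈ M.subsonic := by
  refine ⟨D.mem_U x hx, D.vel_pos hx, ?_⟩
  obtain ⟨C₁, C₂, h1, h2, h⟩ := D.kappa_bounds
  obtain ⟨h3, h4⟩ := h x hx
  have hu := D.vel_pos hx
  have hc0 : 0 ≤ M.c0 (D.v x, D.S x, D.lam x) := Real.sqrt_nonneg _
  have hc : 0 < M.c0 (D.v x, D.S x, D.lam x) := by
    rcases hc0.eq_or_lt with hc | hc
    · rw [kappaOf, ← hc, div_zero] at h3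
      linarith
    · exact hc
  rw [kappaOf, div_le_iff₀ hc] at h4
  have h5 : D.u x < M.c0 (D.v x, D.S x, D.lam x) := by nlinarith
  exact (Real.lt_sqrt hu.le).1 h5

lemma thermo_pathInf : thermo D.pathInf = (D.vInf, D.SInf, D.lamInf) := rfl

lemma continuousAt_thermo {f : ℝ × ℝ × ℝ → ℝ} (hf : ContDiffOn ℝ ∞ f M.U) :
    ContinuousAt (fun z => f (thermo z)) D.pathInf := by
  have h1 := (hf.continuousOn.continuousAt (M.isOpen_U.mem_nhds D.inf_mem_U))
  exact ContinuousAt.comp (f := thermo) (g := f) h1 contDiff_thermo.continuous.continuousAt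

lemma pathInf_mem : D.pathInf ∈ M.subsonic := by
  obtain ⟨C₁, C₂, h1, h2, h⟩ := D.kappa_bounds
  obtain ⟨C₃, C₄, h3, h4⟩ := D.u_bounds
  have hu : Tendsto (fun x => (D.path x).2.1) atTop (𝓝 D.pathInf.2.1) :=
    (continuous_fst.comp continuous_snd).continuousAt.tendsto.comp D.tendsto_path
  have hu0 : 0 < D.pathInf.2.1 := h3.trans_le
    (ge_of_tendsto hu ((eventually_ge_atTop 0).mono fun x hx => (h4 x hx).1))
  refine ⟨D.inf_mem_U, hu0, ?_⟩
  have hc : Tendsto (fun x => -((D.path x).1 ^ 2 * partialV M.p (thermo (D.path x)))) atTop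
      (𝓝 (-(D.pathInf.1 ^ 2 * partialV M.p (thermo D.pathInf)))) := by
    have h5 := D.continuousAt_thermo (ThermoModel.contDiffOn_partialV M.contDiffOn_p)
    have h6 : ContinuousAt (fun z : ℝ × ℝ × ℝ × ℝ => -(z.1 ^ 2 * partialV M.p (thermo z)))
      D.pathInf := by fun_prop
    exact h6.tendsto.comp D.tendsto_path
  have hle : ∀ x, 0 ≤ x → (D.path x).2.1 ^ 2 ≤ C₂ ^ 2 *
      -((D.path x).1 ^ 2 * partialV M.p (thermo (D.path x))) := by
    intro x hx
    have hm := D.path_mem hx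
    have h7 := (h x hx).2
    have h8 : 0 < M.c0 (thermo (D.path x)) := hm.2.1.trans (ThermoModel.vel_lt_sound hm)
    rw [kappaOf] at h7
    have h9 : (D.path x).2.1 ≤ C₂ * M.c0 (thermo (D.path x)) := (div_le_iff₀ h8).1 h7
    rw [← ThermoModel.sound_sq hm, ← mul_pow]
    exact pow_le_pow_left₀ hm.2.1.le h9 2
  have hlim := le_of_tendsto_of_tendsto (hu.pow 2) (hc.const_mul (C₂ ^ 2))
    ((eventually_ge_atTop 0).mono hle)
  have hC₂ : 0 < C₂ := by linarith [(h 0 le_rfl).1, (h 0 le_rfl).2]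
  have h5 : 0 < D.pathInf.2.1 ^ 2 := by positivity
  have h6 : C₂ ^ 2 < 1 := by nlinarith
  have h7 : 0 < C₂ ^ 2 := by positivity
  nlinarith

lemma hasDerivWithinAt_state {f : ℝ × ℝ × ℝ → ℝ} (hf : ContDiffOn ℝ ∞ f M.U) {x : ℝ}
    (hx : 0 ≤ x) {v' S' lam' : ℝ} (hv : HasDerivWithinAt D.v v' (Ici 0) x)
    (hS : HasDerivWithinAt D.S S' (Ici 0) x) (hlam : HasDerivWithinAt D.lam lam' (Ici 0) x) :
    HasDerivWithinAt (fun y => f (D.v y, D.S y, D.lam y)) (partialV f (D.state x) * v' +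
      partialS f (D.state x) * S' + partialLam f (D.state x) * lam') (Ici 0) x := by
  have h1 : HasFDerivAt f (fderiv ℝ f (D.state x)) (D.state x) :=
    ((hf.contDiffAt (M.isOpen_U.mem_nhds (D.mem_U x hx))).differentiableAt (by simp)).hasFDerivAt
  have h2 := h1.comp_hasDerivWithinAt x (hv.prodMk (hS.prodMk hlam))
  rw [ThermoModel.fderiv_apply_eq] at h2
  exact h2

lemma hasDerivWithinAt_path {x : ℝ} (hx : 0 ≤ x) :
    HasDerivWithinAt D.path (M.field (D.path x)) (Ici 0) x := by
  have hd : ∀ f : ℝ → ℝ, ContDiffOn ℝ ∞ f (Ici 0) →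
      HasDerivWithinAt f (derivWithin f (Ici 0) x) (Ici 0) x := fun f hf =>
    (hf.differentiableOn (by simp) x hx).hasDerivWithinAt
  have hv := hd _ D.contDiffOn_v
  have hu := hd _ D.contDiffOn_u
  have hS := hd _ D.contDiffOn_S
  have hl := hd _ D.contDiffOn_lam
  have hmass := D.mass x hx
  have hmom := D.momentum x hx
  have hent := D.entropy x hx
  have hrea := D.reaction x hx
  have hp := (D.hasDerivWithinAt_state M.contDiffOn_p hx hv hS hl).derivWithin
    (uniqueDiffOn_Ici 0 x hx)
  rw [hp] at hmom
  have hmem := D.path_mem hx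
  have hu0 : D.u x ≠ 0 := (D.vel_pos hx).ne'
  have hden := (ThermoModel.denom_neg hmem).ne
  generalize derivWithin D.v (Ici 0) x = v' at *
  generalize derivWithin D.u (Ici 0) x = u' at *
  generalize derivWithin D.S (Ici 0) x = S' at *
  generalize derivWithin D.lam (Ici 0) x = l' at *
  refine (hv.prodMk (hu.prodMk (hS.prodMk hl))).congr_deriv ?_
  have hst : thermo (D.path x) = D.state x := rfl
  have hst' : (D.v x, D.S x, D.lam x) = D.state x := rfl
  rw [hst'] at hent hrea
  have hS' : S' = M.entropySource (D.state x) / D.u x := by rw [eq_div_iff hu0, ← hent]; ring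
  have hl' : l' = M.r (D.state x) / D.u x := by rw [eq_div_iff hu0, ← hrea]; ring
  have hv' : v' = D.v x / D.u x * u' := by field_simp; linarith
  have hu' : u' = -(D.v x * (partialS M.p (D.state x) * M.entropySource (D.state x) +
    partialLam M.p (D.state x) * M.r (D.state x))) /
      (D.u x ^ 2 + D.v x ^ 2 * partialV M.p (D.state x)) := by
    rw [hst] at hden
    simp only [path] at hden
    rw [eq_div_iff hden]
    rw [hv', hS', hl'] at hmom
    field_simp at hmom
    linear_combination hmom
  simp only [ThermoModel.field, hst]
  simp only [path]
  rw [← hu', ← hv', ← hS', ← hl']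

lemma hasDerivWithinAt_comp_path {f : ℝ × ℝ × ℝ × ℝ → ℝ} (hf : ContDiffOn ℝ ∞ f M.subsonic)
    {x : ℝ} (hx : 0 ≤ x) :
    HasDerivWithinAt (fun y => f (D.path y)) (M.along f (D.path x)) (Ici 0) x := by
  have h1 : HasFDerivAt f (fderiv ℝ f (D.path x)) (D.path x) :=
    ((hf.contDiffAt (M.isOpen_subsonic.mem_nhds (D.path_mem hx))).differentiableAt
      (by simp)).hasFDerivAt
  exact h1.comp_hasDerivWithinAt x (D.hasDerivWithinAt_path hx)

/-- The operator `ddx` of the coefficient matrices is differentiation along `field`. -/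
lemma ddx_eq_along {f : ℝ × ℝ × ℝ × ℝ → ℝ} (hf : ContDiffOn ℝ ∞ f M.subsonic) {g : ℝ → ℝ}
    (hg : ∀ y, 0 ≤ y → g y = f (D.path y)) {x : ℝ} (hx : 0 ≤ x) :
    ddx g x = M.along f (D.path x) :=
  ((D.hasDerivWithinAt_comp_path hf hx).congr (fun y hy => hg y hy) (hg x hx)).derivWithin
    (uniqueDiffOn_Ici 0 x hx)

lemma tendsto_comp_path {f : ℝ × ℝ × ℝ × ℝ → ℝ} (hf : ContDiffOn ℝ ∞ f M.subsonic) :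
    Tendsto (fun x => f (D.path x)) atTop (𝓝 (f D.pathInf)) :=
  (hf.continuousOn.continuousAt (M.isOpen_subsonic.mem_nhds D.pathInf_mem)).tendsto.comp
    D.tendsto_path

/-- The end state is an equilibrium. -/
lemma along_pathInf {f : ℝ × ℝ × ℝ × ℝ → ℝ} (hf : ContDiffOn ℝ ∞ f M.subsonic) :
    M.along f D.pathInf = 0 :=
  deriv_limit_eq_zero_real (fun _ hx => D.hasDerivWithinAt_comp_path hf hx)
    (D.tendsto_comp_path hf) (D.tendsto_comp_path (ThermoModel.contDiffOn_along hf))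

lemma continuousOn_comp_path {f : ℝ × ℝ × ℝ × ℝ → ℝ} (hf : ContDiffOn ℝ ∞ f M.subsonic) :
    ContinuousOn (fun x => f (D.path x)) (Ici 0) :=
  fun _ hx => (D.hasDerivWithinAt_comp_path hf hx).continuousWithinAt

variable {D} {β : ℝ} {ι : Type*} {K : Set ι}

lemma HasRate.exists_bound (hβ : D.HasRate β) {f : ℝ × ℝ × ℝ × ℝ → ℝ}
    (hf : ContDiffOn ℝ ∞ f M.subsonic) :
    ∃ C, ∀ x, 0 ≤ x → |f (D.path x) - f D.pathInf| ≤ C * Real.exp (-β * x) := by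
  obtain ⟨hβ, C, hC⟩ := hβ
  obtain ⟨L, t, ht, hL⟩ := ((hf.contDiffAt (M.isOpen_subsonic.mem_nhds
    D.pathInf_mem)).of_le (by simp : (1 : WithTop ℕ∞) ≤ ∞)).exists_lipschitzOnWith
  obtain ⟨X, hX⟩ := eventually_atTop.1 (D.tendsto_path.eventually ht)
  obtain ⟨b, hb⟩ := (isCompact_Icc (a := (0 : ℝ)) (b := X)).exists_bound_of_continuousOn
    (((D.continuousOn_comp_path hf).mono Icc_subset_Ici_self).sub
      (continuousOn_const (c := f D.pathInf)))
  refine ⟨L * |C| + |b| * Real.exp (β * X), fun x hx => ?_⟩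
  have he := Real.exp_pos (-β * x)
  rcases le_total X x with h | h
  · have h1 := hL.dist_le_mul _ (hX x h) _ (mem_of_mem_nhds ht)
    rw [dist_eq_norm, dist_eq_norm, Real.norm_eq_abs] at h1
    have h2 : ‖D.path x - D.pathInf‖ ≤ |C| * Real.exp (-β * x) :=
      (hC x hx).trans (mul_le_mul_of_nonneg_right (le_abs_self C) he.le)
    calc _ ≤ (L : ℝ) * (|C| * Real.exp (-β * x)) := h1.trans (by gcongr)
      _ ≤ (L : ℝ) * (|C| * Real.exp (-β * x)) + |b| * Real.exp (β * X) * Real.exp (-β * x) := by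
        have : 0 ≤ |b| * Real.exp (β * X) * Real.exp (-β * x) := by positivity
        linarith
      _ = _ := by ring
  · have h1 := hb x ⟨hx, h⟩
    rw [Real.norm_eq_abs] at h1
    have h2 : 1 ≤ Real.exp (β * X) * Real.exp (-β * x) := by
      rw [← Real.exp_add]
      exact Real.one_le_exp (by nlinarith)
    have h3 : |b| ≤ |b| * (Real.exp (β * X) * Real.exp (-β * x)) :=
      le_mul_of_one_le_right (abs_nonneg _) h2
    have h4 : 0 ≤ (L : ℝ) * |C| * Real.exp (-β * x) := by positivity
    calc _ ≤ |b| := h1.trans (le_abs_self b)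
      _ ≤ _ := by linarith

lemma HasRate.decay_sub (hβ : D.HasRate β) {f : ℝ × ℝ × ℝ × ℝ → ℝ}
    (hf : ContDiffOn ℝ ∞ f M.subsonic) :
    UDecay K β (fun _ x => ((f (D.path x) - f D.pathInf : ℝ) : ℂ)) := by
  obtain ⟨C, hC⟩ := hβ.exists_bound hf
  exact ⟨C, fun p _ x hx => by rw [Complex.norm_real]; exact hC x hx⟩

lemma HasRate.decay (hβ : D.HasRate β) {f : ℝ × ℝ × ℝ × ℝ → ℝ}
    (hf : ContDiffOn ℝ ∞ f M.subsonic) (h0 : f D.pathInf = 0) :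
    UDecay K β (fun _ x => (f (D.path x) : ℂ)) := by
  simpa [h0] using hβ.decay_sub (K := K) hf

lemma HasRate.level (hβ : D.HasRate β) {f : ℝ × ℝ × ℝ × ℝ → ℝ}
    (hf : ContDiffOn ℝ ∞ f M.subsonic) (k : ℕ) :
    ULevel K β k (fun _ x => (f (D.path x) : ℂ)) := by
  have hb : ∀ g : ℝ × ℝ × ℝ × ℝ → ℝ, ContDiffOn ℝ ∞ g M.subsonic →
      UBdd K (fun _ x => (g (D.path x) : ℂ)) := by
    intro g hg
    obtain ⟨C, hC⟩ := hβ.exists_bound hg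
    refine ⟨|C| + |g D.pathInf|, fun p _ x hx => ?_⟩
    rw [Complex.norm_real, Real.norm_eq_abs]
    have h1 := hC x hx
    have h2 : Real.exp (-β * x) ≤ 1 := by
      rw [Real.exp_le_one_iff]; nlinarith [hβ.1]
    have h3 : C * Real.exp (-β * x) ≤ |C| := by
      calc _ ≤ |C| * Real.exp (-β * x) :=
            mul_le_mul_of_nonneg_right (le_abs_self C) (Real.exp_pos _).le
        _ ≤ _ := mul_le_of_le_one_right (abs_nonneg _) h2
    have h4 := abs_sub_abs_le_abs_sub (g (D.path x)) (g D.pathInf)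
    linarith
  induction k generalizing f with
  | zero => exact ⟨hb f hf, fun p _ => Complex.continuous_ofReal.comp_continuousOn
      (D.continuousOn_comp_path hf)⟩
  | succ k ih =>
    have ha := ThermoModel.contDiffOn_along hf
    exact ⟨hb f hf, fun _ x => (M.along f (D.path x) : ℂ),
      fun p _ x hx => (D.hasDerivWithinAt_comp_path hf hx).ofReal_comp,
      hβ.decay ha (D.along_pathInf hf), ih ha⟩

/-- A positive smooth function is bounded below along the profile. -/
lemma exists_pos_le {f : ℝ × ℝ × ℝ × ℝ → ℝ} (hf : ContDiffOn ℝ ∞ f M.subsonic)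
    (hpos : ∀ z ∈ M.subsonic, 0 < f z) : ∃ c, 0 < c ∧ ∀ x, 0 ≤ x → c ≤ f (D.path x) := by
  have hI := hpos _ D.pathInf_mem
  obtain ⟨X, hX⟩ := eventually_atTop.1
    ((D.tendsto_comp_path hf).eventually (lt_mem_nhds (half_lt_self hI)))
  have hne : (Icc 0 (max X 0)).Nonempty := ⟨0, le_rfl, le_max_right _ _⟩
  obtain ⟨y, hy, hmin⟩ := isCompact_Icc.exists_isMinOn hne
    ((D.continuousOn_comp_path hf).mono Icc_subset_Ici_self)
  refine ⟨min (f D.pathInf / 2) (f (D.path y)), lt_min (by positivity)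
    (hpos _ (D.path_mem hy.1)), fun x hx => ?_⟩
  rcases le_total x (max X 0) with h | h
  · exact (min_le_right _ _).trans (hmin ⟨hx, h⟩)
  · exact (min_le_left _ _).trans (hX x ((le_max_left _ _).trans h)).le

variable (D)

/-- No reactant is left at the end state. -/
lemma lamInf_eq_zero (hrate : M.RateAssumption) : D.lamInf = 0 := by
  have hmem := D.inf_mem_U
  have hr0 : M.r (D.vInf, D.SInf, D.lamInf) = 0 := by
    have h1 := D.along_pathInf (f := fun z => z.2.2.2) (by fun_prop)
    have h2 : M.along (fun z => z.2.2.2) D.pathInf = M.r (thermo D.pathInf) / D.uInf := by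
      have : HasFDerivAt (fun z : ℝ × ℝ × ℝ × ℝ => z.2.2.2) _ D.pathInf :=
        ((ContinuousLinearMap.snd ℝ ℝ ℝ).comp ((ContinuousLinearMap.snd ℝ ℝ (ℝ × ℝ)).comp
            (ContinuousLinearMap.snd ℝ ℝ (ℝ × ℝ × ℝ)))).hasFDerivAt
      rw [ThermoModel.along, this.fderiv]
      rfl
    rw [h2, div_eq_zero_iff] at h1
    rcases h1 with h1 | h1
    · exact h1
    · exact absurd h1 D.pathInf_mem.2.1.ne'
  by_contra hne
  have hU : ∀ t ∈ Icc (0 : ℝ) 1, (D.vInf, D.SInf, t * D.lamInf) ∈ M.U := fun t ht =>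
    M.burn_mem _ _ _ t hmem ht.1 ht.2
  have hd : ∀ t ∈ Icc (0 : ℝ) 1, HasDerivAt (fun t => M.r (D.vInf, D.SInf, t * D.lamInf))
      (partialLam M.r (D.vInf, D.SInf, t * D.lamInf) * D.lamInf) t := by
    intro t ht
    have h1 : HasFDerivAt M.r (fderiv ℝ M.r (D.vInf, D.SInf, t * D.lamInf))
        (D.vInf, D.SInf, t * D.lamInf) :=
      ((M.contDiffOn_r.contDiffAt (M.isOpen_U.mem_nhds (hU t ht))).differentiableAt
        (by simp)).hasFDerivAt
    have h2 : HasDerivAt (fun t => (D.vInf, D.SInf, t * D.lamInf)) (0, 0, D.lamInf) t :=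
      (hasDerivAt_const _ _).prodMk ((hasDerivAt_const _ _).prodMk
        (by simpa using (hasDerivAt_id t).mul_const D.lamInf))
    have h3 := h1.comp_hasDerivAt t h2
    rw [ThermoModel.fderiv_apply_eq] at h3
    simp only [mul_zero, zero_add] at h3
    exact h3
  obtain ⟨t, ht, hdt⟩ := exists_hasDerivAt_eq_zero
    (f := fun t => M.r (D.vInf, D.SInf, t * D.lamInf))
    (f' := fun t => partialLam M.r (D.vInf, D.SInf, t * D.lamInf) * D.lamInf) zero_lt_one
    (fun t ht => (hd t ht).continuousAt.continuousWithinAt)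
    (by
      have h0 := hU 0 ⟨le_rfl, zero_le_one⟩
      simp only [zero_mul] at h0
      simp only [zero_mul, one_mul]
      rw [hrate.r_eq_zero _ _ h0, hr0])
    (fun t ht => hd t (Ioo_subset_Icc_self ht))
  have := hrate.r_lam_neg _ (hU t (Ioo_subset_Icc_self ht))
  rcases mul_eq_zero.1 hdt with h | h
  · linarith
  · exact hne h

end Profile

end ZND

namespace ZND

/-! ### Reduction of a block triangular system to normal form -/

/-- The leading matrix after triangularization: the acoustic modes `μ₁`, `μ₂`, the triple mode `μ₃`,
and the coupling `b` of the vorticity mode into the second acoustic mode. -/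
def leading (m₁ m₂ m₃ b : ℂ) : Matrix (Fin 5) (Fin 5) ℂ :=
  !![m₁, 0, 0, 0, 0;
     0, m₂, b, 0, 0;
     0, 0, m₃, 0, 0;
     0, 0, 0, m₃, 0;
     0, 0, 0, 0, m₃]

/-- The matrix whose column `0` is `c` and whose other columns vanish. -/
def colZero (c : Fin 5 → ℂ) : Matrix (Fin 5) (Fin 5) ℂ :=
  Matrix.of fun i j => if j = 0 then c i else 0

lemma colZero_mul (c : Fin 5 → ℂ) (X : Matrix (Fin 5) (Fin 5) ℂ) (i j : Fin 5) :
    (colZero c * X) i j = c i * X 0 j := by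
  simp [colZero, Matrix.mul_apply, ite_mul]

lemma mul_colZero (c : Fin 5 → ℂ) (X : Matrix (Fin 5) (Fin 5) ℂ) (i j : Fin 5) :
    (X * colZero c) i j = if j = 0 then ∑ k, X i k * c k else 0 := by
  by_cases hj : j = 0 <;> simp [colZero, Matrix.mul_apply, hj]

lemma colZero_mul_colZero {c d : Fin 5 → ℂ} (hd : d 0 = 0) : colZero c * colZero d = 0 := by
  ext i j
  rw [colZero_mul]
  by_cases hj : j = 0 <;> simp [colZero, hj, hd]

/-- The elementary change of variables `Z = (1 + c/ε) y`, which removes the leading action of the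
mode `0` on the others. -/
def shear (e : ℂ) (c : Fin 5 → ℂ) : Matrix (Fin 5) (Fin 5) ℂ := 1 + e • colZero c

lemma shear_mul_shear_neg {e : ℂ} {c : Fin 5 → ℂ} (hc : c 0 = 0) :
    shear e c * shear (-e) c = 1 := by
  have := colZero_mul_colZero (c := c) hc
  simp only [shear, add_mul, mul_add, one_mul, mul_one, smul_mul_assoc, mul_smul_comm, this]
  module

/-- The part of the sheared coefficient matrix that is not multiplied by `ε`. -/
def sheared (e : ℂ) (L N : Matrix (Fin 5) (Fin 5) ℂ) (c c' : Fin 5 → ℂ) (i j : Fin 5) : ℂ :=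
  N i j + e * c i * N 0 j + if j = 0 then e * c' i - ∑ k, L i k * c k -
    e * ∑ k, (N i k + e * c i * N 0 k) * c k else 0

lemma sheared_eq {e ε : ℂ} (he : e * ε = 1) {m₂ m₃ b : ℂ} {N : Matrix (Fin 5) (Fin 5) ℂ}
    {c c' : Fin 5 → ℂ} (hc : c 0 = 0) :
    (e • colZero c' + shear e c * (ε • leading 0 m₂ m₃ b + N)) * shear (-e) c =
      ε • leading 0 m₂ m₃ b + Matrix.of (sheared e (leading 0 m₂ m₃ b) N c c') := by
  set L := leading 0 m₂ m₃ b with hL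
  have hL0 : ∀ j, L 0 j = 0 := by
    intro j
    fin_cases j <;> rfl
  have h1 : colZero c' * colZero c = 0 := colZero_mul_colZero hc
  set X := ε • L + N with hX
  have hX0 : ∀ j, X 0 j = N 0 j := fun j => by
    simp [hX, hL0]
  set Y := X + e • (colZero c * X) with hY
  have hYij : ∀ i j, Y i j = X i j + e * (c i * N 0 j) := fun i j => by
    rw [hY, Matrix.add_apply, Matrix.smul_apply, colZero_mul, hX0, smul_eq_mul]
  have h2 : (e • colZero c' + shear e c * X) * shear (-e) c =
      e • colZero c' + Y - e • (Y * colZero c) := by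
    have h3 : shear e c * X = Y := by rw [shear, add_mul, one_mul, smul_mul_assoc]
    rw [h3, shear, neg_smul, ← sub_eq_add_neg, mul_sub, mul_one, mul_smul_comm, add_mul,
      smul_mul_assoc, h1, smul_zero, zero_add]
  rw [h2]
  ext i j
  rw [Matrix.sub_apply, Matrix.add_apply, Matrix.smul_apply, Matrix.smul_apply, mul_colZero,
    Matrix.add_apply, Matrix.smul_apply, Matrix.of_apply, sheared, hYij]
  have hXij : X i j = ε * L i j + N i j := by simp [hX]
  rw [hXij]
  by_cases hj : j = 0
  · subst hj
    have e1 : ∑ k, Y i k * c k =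
        ε * ∑ k, L i k * c k + ∑ k, (N i k + e * c i * N 0 k) * c k := by
      rw [Finset.mul_sum, ← Finset.sum_add_distrib]
      refine Finset.sum_congr rfl fun k _ => ?_
      rw [hYij]
      simp only [hX, Matrix.add_apply, Matrix.smul_apply, smul_eq_mul]
      ring
    simp only [if_true, colZero, Matrix.of_apply, smul_eq_mul, e1]
    linear_combination (-∑ k, L i k * c k) * he
  · simp only [hj, if_false, colZero, Matrix.of_apply, smul_eq_mul, mul_zero]
    ring

variable {ι : Type*}

/-- Families of systems `y' = (ε leading + N) y` with the structure of the linearized ZND equations: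
`μ₁` is the only mode in the left half plane, it stays away from the other modes, the coupling `b`
is dominated by the growth of the second mode, and in the limit the perturbation `N` feeds only into
the last mode, which it makes grow at the rate `h`. -/
structure SpectralData (K : Set ι) (β : ℝ) (eps : ι → ℝ) (m₁ m₂ m₃ b : ι → ℝ → ℂ)
    (N : ι → ℝ → Matrix (Fin 5) (Fin 5) ℂ) (h : ℝ) : Prop where
  eps_ge : ∀ p ∈ K, 1 ≤ eps p
  h_pos : 0 < h
  level_gap₂ : ULevel K β 1 (fun p x => m₂ p x - m₁ p x)
  level_gap₃ : ULevel K β 1 (fun p x => m₃ p x - m₁ p x)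
  level_b : ULevel K β 1 b
  level_N : ∀ i j, ULevel K β 1 (fun p x => N p x i j)
  gap : ∃ c, 0 < c ∧ ∀ p ∈ K, ∀ x, 0 ≤ x → c ≤ ‖m₂ p x - m₁ p x‖ ∧ c ≤ ‖m₃ p x - m₁ p x‖
  re₁ : ∀ p ∈ K, ∀ x, 0 ≤ x → (m₁ p x).re ≤ 0
  re₂ : ∀ p ∈ K, ∀ x, 0 ≤ x → 0 ≤ (m₂ p x).re
  re₃ : ∀ p ∈ K, ∀ x, 0 ≤ x → 0 ≤ (m₃ p x).re
  coupling : ∃ l, 0 < l ∧ ∀ p ∈ K, ∀ x, 0 ≤ x → ‖b p x‖ ≤ l * (m₂ p x).re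
  decay_N : ∀ i j, i ≠ 4 → UDecay K β (fun p x => N p x i j)
  decay_N_last : UDecay K β (fun p x => N p x 4 4 - h)

/-- The reduced leading matrix: the mode `0` is scaled out. -/
def reduced (m₁ m₂ m₃ b : ι → ℝ → ℂ) (p : ι) (x : ℝ) : Matrix (Fin 5) (Fin 5) ℂ :=
  leading 0 (m₂ p x - m₁ p x) (m₃ p x - m₁ p x) (b p x)

/-- The part of `N` that survives in the limit and that is not removed by the shear. -/
def persistent (N : ι → ℝ → Matrix (Fin 5) (Fin 5) ℂ) (h : ℝ) (p : ι) (x : ℝ) (i j : Fin 5) : ℂ :=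
  if i = 4 then (if j = 4 then (h : ℂ) else if j = 0 then 0 else N p x 4 j) else 0

namespace SpectralData

variable {K : Set ι} {β : ℝ} {eps : ι → ℝ} {m₁ m₂ m₃ b : ι → ℝ → ℂ}
  {N : ι → ℝ → Matrix (Fin 5) (Fin 5) ℂ} {h : ℝ}

/-- The shear coefficients `c` solve `(leading - μ₁) c = N e₀`, with the growth rate of the last
mode corrected by `h / ε` so that the remaining action on it decays, too. -/
lemma exists_shear (hD : SpectralData K β eps m₁ m₂ m₃ b N h) :
    ∃ c c' : Fin 5 → ι → ℝ → ℂ, (∀ p x, c 0 p x = 0) ∧ (∀ p x, c' 0 p x = 0) ∧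
      (∀ i, ULevel K β 1 (c i)) ∧
      (∀ i, ∀ p ∈ K, ∀ x, 0 ≤ x → HasDerivWithinAt (c i p) (c' i p x) (Ici 0) x) ∧
      (∀ i, UDecay K β (c' i)) ∧ (∀ i, ULevel K β 0 (c' i)) ∧
      (∀ i, i ≠ 4 → UDecay K β (c i)) ∧
      (∀ p ∈ K, ∀ x, 0 ≤ x → ∀ i, i ≠ 0 → i ≠ 4 →
        ∑ k, reduced m₁ m₂ m₃ b p x i k * c k p x = N p x i 0) ∧
      (∀ p ∈ K, ∀ x, 0 ≤ x → ∑ k, reduced m₁ m₂ m₃ b p x 4 k * c k p x =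
        N p x 4 0 - ((eps p)⁻¹ : ℝ) * h * c 4 p x) := by
  obtain ⟨g, hg0, hg⟩ := hD.gap
  have hinv2 := hD.level_gap₂.inv hg0 fun p hp x hx => (hg p hp x hx).1
  have hinv3 := hD.level_gap₃.inv hg0 fun p hp x hx => (hg p hp x hx).2
  have hne2 : ∀ p ∈ K, ∀ x, 0 ≤ x → m₂ p x - m₁ p x ≠ 0 := fun p hp x hx => by
    rw [← norm_pos_iff]; exact hg0.trans_le (hg p hp x hx).1
  have hne3 : ∀ p ∈ K, ∀ x, 0 ≤ x → m₃ p x - m₁ p x ≠ 0 := fun p hp x hx => by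
    rw [← norm_pos_iff]; exact hg0.trans_le (hg p hp x hx).2
  have heps : ULevel K β 1 (fun p _ => (((eps p)⁻¹ : ℝ) : ℂ) * (h : ℂ)) :=
    (ULevel.const ⟨1, fun p hp => by
      rw [Complex.norm_real, Real.norm_eq_abs, abs_of_nonneg (by
        have := hD.eps_ge p hp; positivity)]
      exact inv_le_one_of_one_le₀ (hD.eps_ge p hp)⟩).mul (ULevel.cst _)
  -- a nonnegative shift does not bring a number of the right half plane closer to zero
  have hge4 : ∀ p ∈ K, ∀ x, 0 ≤ x →
      g ≤ ‖(m₃ p x - m₁ p x) + (((eps p)⁻¹ : ℝ) : ℂ) * (h : ℂ)‖ := fun p hp x hx => by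
    refine (hg p hp x hx).2.trans ?_
    have h1 : 0 ≤ (m₃ p x - m₁ p x).re := by
      rw [Complex.sub_re]; linarith [hD.re₁ p hp x hx, hD.re₃ p hp x hx]
    have h2 : 0 ≤ (eps p)⁻¹ * h := by
      have := hD.eps_ge p hp; have := hD.h_pos; positivity
    rw [← Complex.ofReal_mul]
    generalize m₃ p x - m₁ p x = z at *
    generalize (eps p)⁻¹ * h = t at *
    refine le_of_sq_le_sq_of_nonneg ?_ (norm_nonneg _)
    rw [← Complex.normSq_eq_norm_sq, ← Complex.normSq_eq_norm_sq, Complex.normSq_apply,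
      Complex.normSq_apply]
    simp only [Complex.add_re, Complex.add_im, Complex.ofReal_re, Complex.ofReal_im]
    nlinarith
  have hne4 : ∀ p ∈ K, ∀ x, 0 ≤ x →
      (m₃ p x - m₁ p x) + (((eps p)⁻¹ : ℝ) : ℂ) * (h : ℂ) ≠ 0 := fun p hp x hx => by
    rw [← norm_pos_iff]; exact hg0.trans_le (hge4 p hp x hx)
  have hinv4 := (hD.level_gap₃.add heps).inv hg0 hge4
  set c2 : ι → ℝ → ℂ := fun p x => N p x 2 0 * (m₃ p x - m₁ p x)⁻¹ with hc2
  set c3 : ι → ℝ → ℂ := fun p x => N p x 3 0 * (m₃ p x - m₁ p x)⁻¹ with hc3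
  set c4 : ι → ℝ → ℂ := fun p x =>
    N p x 4 0 * ((m₃ p x - m₁ p x) + (((eps p)⁻¹ : ℝ) : ℂ) * (h : ℂ))⁻¹ with hc4
  set c1 : ι → ℝ → ℂ := fun p x =>
    (N p x 1 0 - b p x * c2 p x) * (m₂ p x - m₁ p x)⁻¹ with hc1
  have l2 : ULevel K β 1 c2 := (hD.level_N 2 0).mul hinv3
  have l3 : ULevel K β 1 c3 := (hD.level_N 3 0).mul hinv3
  have l4 : ULevel K β 1 c4 := (hD.level_N 4 0).mul hinv4
  have l1 : ULevel K β 1 c1 := ((hD.level_N 1 0).sub (hD.level_b.mul l2)).mul hinv2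
  have d2 : UDecay K β c2 := (hD.decay_N 2 0 (by decide)).mul_bdd hinv3.bdd
  have d3 : UDecay K β c3 := (hD.decay_N 3 0 (by decide)).mul_bdd hinv3.bdd
  have d1 : UDecay K β c1 := ((hD.decay_N 1 0 (by decide)).sub
    (UDecay.bdd_mul hD.level_b.bdd d2)).mul_bdd hinv2.bdd
  obtain ⟨-, c1', e1, f1, g1⟩ := id l1
  obtain ⟨-, c2', e2, f2, g2⟩ := id l2
  obtain ⟨-, c3', e3, f3, g3⟩ := id l3
  obtain ⟨-, c4', e4, f4, g4⟩ := id l4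
  refine ⟨![fun _ _ => 0, c1, c2, c3, c4], ![fun _ _ => 0, c1', c2', c3', c4'], fun _ _ => rfl,
    fun _ _ => rfl, ?_, ?_, ?_, ?_, ?_, ?_, ?_⟩
  · intro i
    fin_cases i
    exacts [ULevel.cst 0, l1, l2, l3, l4]
  · intro i
    fin_cases i
    exacts [fun p _ x _ => hasDerivWithinAt_const _ _ _, e1, e2, e3, e4]
  · intro i
    fin_cases i
    exacts [UDecay.zero, f1, f2, f3, f4]
  · intro i
    fin_cases i
    exacts [ULevel.cst 0, g1, g2, g3, g4]
  · intro i hi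
    fin_cases i
    exacts [UDecay.zero, d1, d2, d3, absurd rfl hi]
  · intro p hp x hx i hi hi'
    have := hne2 p hp x hx
    have := hne3 p hp x hx
    fin_cases i
    · exact absurd rfl hi
    · simp [Fin.sum_univ_five, reduced, leading, hc1]
      field_simp
      ring
    · simp [Fin.sum_univ_five, reduced, leading, hc2]
      field_simp
    · simp [Fin.sum_univ_five, reduced, leading, hc3]
      field_simp
    · exact absurd rfl hi'
  · intro p hp x hx
    have h4 := hne4 p hp x hx
    simp only [Fin.sum_univ_five, reduced, leading, hc4, Matrix.of_apply, Matrix.cons_val]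
    generalize N p x 4 0 = n4 at *
    generalize m₃ p x - m₁ p x = z at *
    generalize (((eps p)⁻¹ : ℝ) : ℂ) * (h : ℂ) = t at *
    have : n4 * (z + t)⁻¹ * (z + t) = n4 := by field_simp
    linear_combination this

/-- The sheared coefficient matrix. -/
def systemMatrix (eps : ι → ℝ) (m₁ m₂ m₃ b : ι → ℝ → ℂ) (N : ι → ℝ → Matrix (Fin 5) (Fin 5) ℂ)
    (c c' : Fin 5 → ι → ℝ → ℂ) (p : ι) (x : ℝ) : Matrix (Fin 5) (Fin 5) ℂ :=
  (eps p : ℂ) • reduced m₁ m₂ m₃ b p x + Matrix.of (sheared (((eps p)⁻¹ : ℝ) : ℂ)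
    (reduced m₁ m₂ m₃ b p x) (N p x) (fun i => c i p x) (fun i => c' i p x))

lemma systemMatrix_apply (eps : ι → ℝ) (m₁ m₂ m₃ b : ι → ℝ → ℂ)
    (N : ι → ℝ → Matrix (Fin 5) (Fin 5) ℂ) (c c' : Fin 5 → ι → ℝ → ℂ) (p : ι) (x : ℝ)
    (i j : Fin 5) :
    systemMatrix eps m₁ m₂ m₃ b N c c' p x i j = (eps p : ℂ) * reduced m₁ m₂ m₃ b p x i j +
      sheared (((eps p)⁻¹ : ℝ) : ℂ) (reduced m₁ m₂ m₃ b p x) (N p x) (fun i => c i p x)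
        (fun i => c' i p x) i j := by
  simp [systemMatrix]

lemma level_reduced (hD : SpectralData K β eps m₁ m₂ m₃ b N h) (i j : Fin 5) :
    ULevel K β 1 (fun p x => reduced m₁ m₂ m₃ b p x i j) := by
  have h2 := hD.level_gap₂
  have h3 := hD.level_gap₃
  have hb := hD.level_b
  have h0 : ULevel K β 1 (fun _ _ => 0) := ULevel.cst 0
  fin_cases i <;> fin_cases j <;>
    first
    | exact h0
    | exact h2
    | exact h3
    | exact hb

lemma level_inv_eps (hD : SpectralData K β eps m₁ m₂ m₃ b N h) (k : ℕ) :
    ULevel K β k (fun p _ => (((eps p)⁻¹ : ℝ) : ℂ)) :=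
  ULevel.const ⟨1, fun p hp => by
    rw [Complex.norm_real, Real.norm_eq_abs, abs_of_nonneg (by
      have := hD.eps_ge p hp; positivity)]
    exact inv_le_one_of_one_le₀ (hD.eps_ge p hp)⟩

lemma level_sheared (hD : SpectralData K β eps m₁ m₂ m₃ b N h) {c c' : Fin 5 → ι → ℝ → ℂ}
    (hc : ∀ i, ULevel K β 1 (c i)) (hc' : ∀ i, ULevel K β 0 (c' i)) (i j : Fin 5) :
    ULevel K β 0 (fun p x => sheared (((eps p)⁻¹ : ℝ) : ℂ) (reduced m₁ m₂ m₃ b p x) (N p x)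
      (fun i => c i p x) (fun i => c' i p x) i j) := by
  have he := hD.level_inv_eps 0
  have hN := fun i j => (hD.level_N i j).pred
  have hc0 := fun i => (hc i).pred
  have hL := fun i j => (hD.level_reduced i j).pred
  unfold sheared
  refine ((hN i j).add ((he.mul (hc0 i)).mul (hN 0 j))).add ?_
  by_cases hj : j = 0
  · simp only [hj, if_true]
    exact ((he.mul (hc' i)).sub (ULevel.sum _ fun k _ => (hL i k).mul (hc0 k))).sub
      (he.mul (ULevel.sum _ fun k _ =>
        ((hN i k).add ((he.mul (hc0 i)).mul (hN 0 k))).mul (hc0 k)))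
  · simp only [hj, if_false]
    exact ULevel.cst 0

/-- In the sheared system the mode `0` acts on the others through `O(1/ε)` integrable terms. -/
lemma decay_col_zero (hD : SpectralData K β eps m₁ m₂ m₃ b N h) {c c' : Fin 5 → ι → ℝ → ℂ}
    (hc : ∀ i, ULevel K β 1 (c i)) (hc' : ∀ i, UDecay K β (c' i))
    (hcd : ∀ i, i ≠ 4 → UDecay K β (c i))
    (hs : ∀ p ∈ K, ∀ x, 0 ≤ x → ∀ i, i ≠ 0 → i ≠ 4 →
        ∑ k, reduced m₁ m₂ m₃ b p x i k * c k p x = N p x i 0)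
    (hs4 : ∀ p ∈ K, ∀ x, 0 ≤ x → ∑ k, reduced m₁ m₂ m₃ b p x 4 k * c k p x =
        N p x 4 0 - ((eps p)⁻¹ : ℝ) * h * c 4 p x) {i : Fin 5} (hi : i ≠ 0) :
    UDecay K β (fun p x => (eps p : ℂ) * systemMatrix eps m₁ m₂ m₃ b N c c' p x i 0) := by
  have he := (hD.level_inv_eps 0).bdd
  have hNb := fun i j => (hD.level_N i j).bdd
  have hN0 := fun j => hD.decay_N 0 j (by decide)
  have hi0 : ∀ p x, reduced m₁ m₂ m₃ b p x i 0 = 0 := fun p x => by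
    fin_cases i <;> rfl
  have hε : ∀ p ∈ K, (eps p : ℂ) * (((eps p)⁻¹ : ℝ) : ℂ) = 1 := fun p hp => by
    have h1 : eps p ≠ 0 := by have := hD.eps_ge p hp; positivity
    rw [← Complex.ofReal_mul, mul_inv_cancel₀ h1, Complex.ofReal_one]
  have hrow : UDecay K β (fun p x => (((eps p)⁻¹ : ℝ) : ℂ) *
      (c i p x * ∑ k, N p x 0 k * c k p x)) :=
    UDecay.bdd_mul he (UDecay.bdd_mul (hc i).bdd
      (UDecay.sum _ fun k _ => (hN0 k).mul_bdd (hc k).bdd))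
  have hbase : UDecay K β (fun p x => c i p x * N p x 0 0 + c' i p x - (((eps p)⁻¹ : ℝ) : ℂ) *
      (c i p x * ∑ k, N p x 0 k * c k p x)) :=
    ((UDecay.bdd_mul (hc i).bdd (hN0 0)).add (hc' i)).sub hrow
  have hsplit : ∀ p x, ∑ k, (N p x i k + (((eps p)⁻¹ : ℝ) : ℂ) * c i p x * N p x 0 k) * c k p x =
      ∑ k, N p x i k * c k p x + (((eps p)⁻¹ : ℝ) : ℂ) * (c i p x * ∑ k, N p x 0 k * c k p x) := by
    intro p x
    rw [Finset.mul_sum, Finset.mul_sum, ← Finset.sum_add_distrib]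
    exact Finset.sum_congr rfl fun k _ => by ring
  by_cases h4 : i = 4
  · subst h4
    have hlast : UDecay K β (fun p x => (N p x 4 4 - h) * c 4 p x +
        ∑ k ∈ Finset.univ.erase 4, N p x 4 k * c k p x) :=
      (hD.decay_N_last.mul_bdd (hc 4).bdd).add (UDecay.sum _ fun k hk =>
        UDecay.bdd_mul (hNb 4 k) (hcd k (Finset.ne_of_mem_erase hk)))
    refine (hbase.sub hlast).congr fun p hp x hx => ?_
    rw [systemMatrix_apply, hi0]
    simp only [sheared, if_true]
    rw [hs4 p hp x hx, hsplit]
    rw [← Finset.add_sum_erase Finset.univ (fun k => N p x 4 k * c k p x) (Finset.mem_univ 4)]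
    linear_combination (c 4 p x * N p x 0 0 + c' 4 p x + h * c 4 p x -
      (N p x 4 4 * c 4 p x + ∑ k ∈ Finset.univ.erase 4, N p x 4 k * c k p x) -
      (((eps p)⁻¹ : ℝ) : ℂ) * (c 4 p x * ∑ k, N p x 0 k * c k p x)) * hε p hp
  · have hmid : UDecay K β (fun p x => ∑ k, N p x i k * c k p x) :=
      UDecay.sum _ fun k _ => (hD.decay_N i k h4).mul_bdd (hc k).bdd
    refine (hbase.sub hmid).congr fun p hp x hx => ?_
    rw [systemMatrix_apply, hi0]
    simp only [sheared, if_true]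
    rw [hs p hp x hx i hi h4, hsplit]
    linear_combination (c i p x * N p x 0 0 + c' i p x - ∑ k, N p x i k * c k p x -
      (((eps p)⁻¹ : ℝ) : ℂ) * (c i p x * ∑ k, N p x 0 k * c k p x)) * hε p hp

lemma decay_row_zero (hD : SpectralData K β eps m₁ m₂ m₃ b N h) {c c' : Fin 5 → ι → ℝ → ℂ}
    (hc : ∀ i, ULevel K β 1 (c i)) (hc0 : ∀ p x, c 0 p x = 0) (hc0' : ∀ p x, c' 0 p x = 0)
    (j : Fin 5) :
    UDecay K β (fun p x => systemMatrix eps m₁ m₂ m₃ b N c c' p x 0 j) := by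
  have he := (hD.level_inv_eps 0).bdd
  have hN0 := fun j => hD.decay_N 0 j (by decide)
  have h0j : ∀ p x j, reduced m₁ m₂ m₃ b p x 0 j = 0 := fun p x j => by
    fin_cases j <;> rfl
  by_cases hj : j = 0
  · subst hj
    refine ((hN0 0).sub (UDecay.bdd_mul he (UDecay.sum Finset.univ fun k _ =>
      (hN0 k).mul_bdd (hc k).bdd))).congr fun p hp x hx => ?_
    rw [systemMatrix_apply]
    simp only [sheared, if_true, h0j, hc0, hc0', mul_zero, zero_mul, add_zero, zero_add,
      Finset.sum_const_zero, sub_zero, zero_sub]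
    ring
  · refine (hN0 j).congr fun p hp x hx => ?_
    rw [systemMatrix_apply]
    simp [sheared, hj, h0j, hc0]

/-- The shear changes the columns other than the first by decaying terms only. -/
lemma decay_block (hD : SpectralData K β eps m₁ m₂ m₃ b N h) {c c' : Fin 5 → ι → ℝ → ℂ}
    (hc : ∀ i, ULevel K β 1 (c i)) (i : Fin 5) {j : Fin 5} (hj : j ≠ 0) :
    UDecay K β (fun p x => systemMatrix eps m₁ m₂ m₃ b N c c' p x i j -
      ((eps p : ℂ) * reduced m₁ m₂ m₃ b p x i j + persistent N h p x i j)) := by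
  have he := (hD.level_inv_eps 0).bdd
  have hN0 := hD.decay_N 0 j (by decide)
  have h1 : UDecay K β (fun p x => N p x i j - persistent N h p x i j) := by
    by_cases hi : i = 4
    · subst hi
      by_cases hj4 : j = 4
      · subst hj4
        simpa [persistent] using hD.decay_N_last
      · simpa [persistent, hj, hj4] using UDecay.zero
    · simpa [persistent, hi] using hD.decay_N i j hi
  refine (h1.add (UDecay.bdd_mul he (UDecay.bdd_mul (hc i).bdd hN0))).congr fun p hp x hx => ?_
  rw [systemMatrix_apply]
  simp only [sheared, hj, if_false]
  ring

/-- The sheared systems are in normal form, uniformly in the parameters, and limits at infinity of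
their solutions are multiples of `e₀`, since the limiting matrix is invertible on the other modes.
Here `c` is the shear. -/
lemma normalForm (hβ : 0 < β) (hD : SpectralData K β eps m₁ m₂ m₃ b N h) :
    ∃ c c' : Fin 5 → ι → ℝ → ℂ, (∀ p x, c 0 p x = 0) ∧ (∀ p x, c' 0 p x = 0) ∧
      (∀ i, ULevel K β 1 (c i)) ∧
      (∀ i, ∀ p ∈ K, ∀ x, 0 ≤ x → HasDerivWithinAt (c i p) (c' i p x) (Ici 0) x) ∧
      (∃ (w : Fin 5 → ℝ) (C : ℝ), (∀ i, 0 < w i) ∧ ∀ p ∈ K, ∀ γ : ℝ → ℝ,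
        (∀ x, 0 ≤ x → γ x ≤ eps p * (-(m₁ p x).re + (m₂ p x).re / 2) ∧
          γ x ≤ eps p * (-(m₁ p x).re + (m₃ p x).re)) →
        NormalForm (systemMatrix eps m₁ m₂ m₃ b N c c' p) w C β (eps p) γ) ∧
      ∀ p ∈ K, ∀ (Z : ℝ → Fin 5 → ℂ) (Z₁ : Fin 5 → ℂ),
        (∀ x, 0 ≤ x → HasDerivWithinAt Z (systemMatrix eps m₁ m₂ m₃ b N c c' p x *ᵥ Z x)
          (Ici 0) x) → Tendsto Z atTop (𝓝 Z₁) → ∀ i, i ≠ 0 → Z₁ i = 0 := by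
  obtain ⟨c, c', hc0, hc0', hc, hcd, hc', hc'0, hcdec, hs, hs4⟩ := hD.exists_shear
  refine ⟨c, c', hc0, hc0', hc, hcd, ?_, ?_⟩
  · have hrow := fun j => hD.decay_row_zero hc hc0 hc0' j
    have hcol := fun i (hi : i ≠ 0) => hD.decay_col_zero hc hc' hcdec hs hs4 hi
    have hblock := fun i j (hj : j ≠ 0) => hD.decay_block (c' := c') hc i hj
    choose Cr hCr using hrow
    choose! Cc hCc using hcol
    choose! Cb hCb using hblock
    obtain ⟨l, hl0, hl⟩ := hD.coupling
    choose Hb hHb using fun j => (hD.level_N 4 j).bdd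
    have hh := hD.h_pos
    set H := ∑ j, |Hb j| with hH
    have hHj : ∀ j, |Hb j| ≤ H := fun j =>
      Finset.single_le_sum (f := fun j => |Hb j|) (fun _ _ => abs_nonneg _) (Finset.mem_univ j)
    have hH0 : 0 ≤ H := (abs_nonneg _).trans (hHj 0)
    -- the weights make the block row diagonally dominant: `2 l` beats the coupling `b`, and a
    -- large last weight beats what `N` feeds into the last mode
    set w : Fin 5 → ℝ := ![1, 2 * l, 1, 1, (H * (2 * l + 2) + 1) / h] with hw
    have hwpos : ∀ i, 0 < w i := by
      intro i
      fin_cases i <;> simp [hw] <;> positivity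
    set C := ∑ j, |Cr j| + ∑ i, |Cc i| + ∑ i, ∑ j, w j * |Cb i j| with hC
    have hn1 : 0 ≤ ∑ j, |Cr j| := Finset.sum_nonneg fun _ _ => abs_nonneg _
    have hn2 : 0 ≤ ∑ i, |Cc i| := Finset.sum_nonneg fun _ _ => abs_nonneg _
    have hn3' : ∀ i, 0 ≤ ∑ j, w j * |Cb i j| := fun i =>
      Finset.sum_nonneg fun j _ => mul_nonneg (hwpos j).le (abs_nonneg _)
    have hn3 : 0 ≤ ∑ i, ∑ j, w j * |Cb i j| := Finset.sum_nonneg fun i _ => hn3' i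
    refine ⟨w, C, hwpos, fun p hp γ hγ => ⟨fun i j => ?_, ?_, fun x hx j => ?_,
      fun x hx i hi => ?_, fun x hx i hi => ?_⟩⟩
    · have h1 := ((hD.level_reduced i j).cont p hp)
      have h2 := ((hD.level_sheared hc hc'0 i j).cont p hp)
      simp only [systemMatrix_apply]
      exact (continuousOn_const.mul h1).add h2
    · choose A hA using fun i j => (hD.level_reduced i j).bdd
      choose A' hA' using fun i j => (hD.level_sheared hc hc'0 i j).bdd
      refine ⟨∑ i, ∑ j, (|eps p| * |A i j| + |A' i j|), fun x hx i j => ?_⟩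
      rw [systemMatrix_apply]
      have h1 : |eps p| * |A i j| + |A' i j| ≤ ∑ i, ∑ j, (|eps p| * |A i j| + |A' i j|) :=
        (Finset.single_le_sum (f := fun j => |eps p| * |A i j| + |A' i j|)
          (fun _ _ => by positivity) (Finset.mem_univ j)).trans
          (Finset.single_le_sum (f := fun i => ∑ j, (|eps p| * |A i j| + |A' i j|))
          (fun _ _ => Finset.sum_nonneg fun _ _ => by positivity) (Finset.mem_univ i))
      refine (norm_add_le _ _).trans (le_trans ?_ h1)
      rw [norm_mul, Complex.norm_real, Real.norm_eq_abs]
      exact add_le_add (mul_le_mul_of_nonneg_left ((hA i j p hp x hx).trans (le_abs_self _))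
        (abs_nonneg _)) ((hA' i j p hp x hx).trans (le_abs_self _))
    · have h1 : |Cr j| ≤ ∑ j, |Cr j| :=
        Finset.single_le_sum (f := fun j => |Cr j|) (fun _ _ => abs_nonneg _) (Finset.mem_univ j)
      refine (hCr j p hp x hx).trans (mul_le_mul_of_nonneg_right ?_ (Real.exp_pos _).le)
      linarith [le_abs_self (Cr j)]
    · have h1 : |Cc i| ≤ ∑ j, |Cc j| :=
        Finset.single_le_sum (f := fun j => |Cc j|) (fun _ _ => abs_nonneg _) (Finset.mem_univ i)
      have h2 := hCc i hi p hp x hx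
      have hε : 0 < eps p := by linarith [hD.eps_ge p hp]
      rw [norm_mul, Complex.norm_real, Real.norm_eq_abs, abs_of_pos hε] at h2
      rw [div_mul_eq_mul_div, le_div_iff₀ hε, mul_comm]
      refine h2.trans (mul_le_mul_of_nonneg_right ?_ (Real.exp_pos _).le)
      linarith [le_abs_self (Cc i)]
    · set Mx := systemMatrix eps m₁ m₂ m₃ b N c c' p x with hMx
      set Pm : Fin 5 → ℂ := fun j =>
        (eps p : ℂ) * reduced m₁ m₂ m₃ b p x i j + persistent N h p x i j with hPm
      have he := Real.exp_pos (-β * x)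
      have hE : ∀ j, j ≠ 0 → ‖Mx i j - Pm j‖ ≤ |Cb i j| * Real.exp (-β * x) := fun j hj =>
        (hCb i j hj p hp x hx).trans (mul_le_mul_of_nonneg_right (le_abs_self _) he.le)
      have hmain : w i * γ x ≤ w i * (Pm i).re -
          ∑ j ∈ Finset.univ.filter (fun j => j ≠ 0 ∧ j ≠ i), w j * ‖Pm j‖ := by
        have hε : 0 < eps p := by linarith [hD.eps_ge p hp]
        obtain ⟨hγ1, hγ2⟩ := hγ x hx
        have hr1 := hD.re₁ p hp x hx
        have hr2 := hD.re₂ p hp x hx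
        have hr3 := hD.re₃ p hp x hx
        rw [Finset.sum_filter, Fin.sum_univ_five]
        fin_cases i
        · exact absurd rfl hi
        · simp [hPm, reduced, leading, persistent, hw]
          rw [abs_of_pos hε]
          have h2 := mul_le_mul_of_nonneg_left (hl p hp x hx) hε.le
          have h3 := mul_le_mul_of_nonneg_left hγ1 hl0.le
          nlinarith
        · simp [hPm, reduced, leading, persistent, hw]
          nlinarith
        · simp [hPm, reduced, leading, persistent, hw]
          nlinarith
        · simp [hPm, reduced, leading, persistent, hw]
          have hb : ∀ j, ‖N p x 4 j‖ ≤ H := fun j =>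
            (hHb j p hp x hx).trans ((le_abs_self _).trans (hHj j))
          have e1 : (H * (2 * l + 2) + 1) / h * (eps p * ((m₃ p x).re - (m₁ p x).re) + h) =
              (H * (2 * l + 2) + 1) / h * (eps p * ((m₃ p x).re - (m₁ p x).re)) +
                (H * (2 * l + 2) + 1) := by
            field_simp
          have e2 : (H * (2 * l + 2) + 1) / h * γ x ≤
              (H * (2 * l + 2) + 1) / h * (eps p * ((m₃ p x).re - (m₁ p x).re)) := by
            refine mul_le_mul_of_nonneg_left ?_ (by positivity)
            linarith
          have e3 : 2 * l * ‖N p x 4 1‖ ≤ 2 * l * H :=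
            mul_le_mul_of_nonneg_left (hb 1) (by positivity)
          rw [e1]
          linarith [hb 2, hb 3]
      have hterm : ∀ j, j ≠ 0 → w j * ‖Mx i j‖ ≤
          w j * ‖Pm j‖ + w j * (|Cb i j| * Real.exp (-β * x)) := fun j hj => by
        rw [← mul_add]
        refine mul_le_mul_of_nonneg_left ?_ (hwpos j).le
        have h3 : ‖Mx i j‖ ≤ ‖Pm j‖ + ‖Mx i j - Pm j‖ := by
          calc ‖Mx i j‖ = ‖Pm j + (Mx i j - Pm j)‖ := by ring_nf
            _ ≤ _ := norm_add_le _ _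
        linarith [hE j hj]
      set F := Finset.univ.filter (fun j : Fin 5 => j ≠ 0 ∧ j ≠ i) with hF
      have hsum : ∑ j ∈ F, w j * ‖Mx i j‖ ≤ ∑ j ∈ F, w j * ‖Pm j‖ +
          ∑ j ∈ F, w j * (|Cb i j| * Real.exp (-β * x)) := by
        rw [← Finset.sum_add_distrib]
        exact Finset.sum_le_sum fun j hj => hterm j (Finset.mem_filter.1 hj).2.1
      have hdiag : (Pm i).re - |Cb i i| * Real.exp (-β * x) ≤ (Mx i i).re := by
        have h3 := (Complex.abs_re_le_norm (Mx i i - Pm i)).trans (hE i hi)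
        rw [Complex.sub_re, abs_le] at h3
        linarith [h3.1]
      have hdiag' := mul_le_mul_of_nonneg_left hdiag (hwpos i).le
      have hins : w i * (|Cb i i| * Real.exp (-β * x)) +
          ∑ j ∈ F, w j * (|Cb i j| * Real.exp (-β * x)) ≤ C * Real.exp (-β * x) := by
        have hnot : i ∉ F := by simp [hF]
        rw [← Finset.sum_insert (f := fun j => w j * (|Cb i j| * Real.exp (-β * x))) hnot]
        have h4 : ∑ j ∈ insert i F, w j * (|Cb i j| * Real.exp (-β * x)) ≤
            ∑ j, w j * (|Cb i j| * Real.exp (-β * x)) :=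
          Finset.sum_le_sum_of_subset_of_nonneg (Finset.subset_univ _) fun j _ _ =>
            mul_nonneg (hwpos j).le (by positivity)
        refine h4.trans ?_
        have h5 : ∑ j, w j * (|Cb i j| * Real.exp (-β * x)) =
            (∑ j, w j * |Cb i j|) * Real.exp (-β * x) := by
          rw [Finset.sum_mul]
          exact Finset.sum_congr rfl fun j _ => by ring
        rw [h5]
        refine mul_le_mul_of_nonneg_right ?_ he.le
        have h6 := Finset.single_le_sum (f := fun i => ∑ j, w j * |Cb i j|)
          (fun i _ => hn3' i) (Finset.mem_univ i)
        linarith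
      rw [mul_sub] at hdiag'
      linarith
  · intro p hp Z Z₁ hZ hlim
    have hε : 0 < eps p := by linarith [hD.eps_ge p hp]
    have hexp0 : Tendsto (fun x : ℝ => Real.exp (-β * x)) atTop (𝓝 0) := by
      simpa using Profile.tendsto_exp_neg hβ 1
    have hdec : ∀ f : ι → ℝ → ℂ, UDecay K β f → Tendsto (f p) atTop (𝓝 0) := by
      rintro f ⟨C, hC⟩
      rw [tendsto_zero_iff_norm_tendsto_zero]
      exact squeeze_zero' (Eventually.of_forall fun _ => norm_nonneg _)
        ((eventually_ge_atTop 0).mono fun x hx => hC p hp x hx) (Profile.tendsto_exp_neg hβ C)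
    obtain ⟨A₂, hA₂⟩ := hD.level_gap₂.exists_tendsto hβ p hp
    obtain ⟨A₃, hA₃⟩ := hD.level_gap₃.exists_tendsto hβ p hp
    obtain ⟨b₁, hb₁⟩ := hD.level_b.exists_tendsto hβ p hp
    choose N₁ hN₁ using fun i j => (hD.level_N i j).exists_tendsto hβ p hp
    obtain ⟨g, hg0, hg⟩ := hD.gap
    have hA₂0 : A₂ ≠ 0 := by
      rw [← norm_pos_iff]
      exact hg0.trans_le (ge_of_tendsto hA₂.norm
        ((eventually_ge_atTop 0).mono fun x hx => (hg p hp x hx).1))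
    have hA₃0 : A₃ ≠ 0 := by
      rw [← norm_pos_iff]
      exact hg0.trans_le (ge_of_tendsto hA₃.norm
        ((eventually_ge_atTop 0).mono fun x hx => (hg p hp x hx).2))
    have hA₃re : 0 ≤ A₃.re := by
      refine ge_of_tendsto ((Complex.continuous_re.tendsto A₃).comp hA₃)
        ((eventually_ge_atTop 0).mono fun x hx => ?_)
      simp only [Function.comp_apply, Complex.sub_re]
      linarith [hD.re₁ p hp x hx, hD.re₃ p hp x hx]
    set R : Matrix (Fin 5) (Fin 5) ℂ := leading 0 A₂ A₃ b₁ with hR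
    set Q : Fin 5 → Fin 5 → ℂ := fun i j =>
      if i = 4 then (if j = 4 then (h : ℂ) else if j = 0 then 0 else N₁ 4 j) else 0 with hQ
    have hred : ∀ i j, Tendsto (fun x => reduced m₁ m₂ m₃ b p x i j) atTop (𝓝 (R i j)) := by
      intro i j
      fin_cases i <;> fin_cases j <;>
        first
        | exact tendsto_const_nhds
        | exact hA₂
        | exact hA₃
        | exact hb₁
    have hper : ∀ i j, Tendsto (fun x => persistent N h p x i j) atTop (𝓝 (Q i j)) := by
      intro i j
      simp only [persistent, hQ]
      split_ifs
      exacts [tendsto_const_nhds, tendsto_const_nhds, hN₁ 4 j, tendsto_const_nhds]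
    have hMlim : ∀ i j, i ≠ 0 → Tendsto (fun x => systemMatrix eps m₁ m₂ m₃ b N c c' p x i j) atTop
        (𝓝 (if j = 0 then 0 else eps p * R i j + Q i j)) := by
      intro i j hi
      by_cases hj : j = 0
      · subst hj
        simp only [if_true]
        have h1 := (hdec _ (hD.decay_col_zero hc hc' hcdec hs hs4 hi)).const_mul ((eps p : ℂ)⁻¹)
        have hne : (eps p : ℂ) ≠ 0 := by exact_mod_cast hε.ne'
        simpa [← mul_assoc, inv_mul_cancel₀ hne] using h1
      · simp only [hj, if_false]
        have h1 := (hdec _ (hD.decay_block (c' := c') hc i hj)).add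
          (((hred i j).const_mul (eps p : ℂ)).add (hper i j))
        simpa using h1
    have heq : ∀ i, i ≠ 0 → ∑ j, (if j = 0 then 0 else (eps p : ℂ) * R i j + Q i j) * Z₁ j = 0 := by
      intro i hi
      exact deriv_limit_eq_zero (fun x hx => hasDerivWithinAt_apply (hZ x hx) i)
        (tendsto_pi_nhds.1 hlim i)
        (tendsto_finsetSum _ fun j _ => (hMlim i j hi).mul (tendsto_pi_nhds.1 hlim j))
    have hεc : (eps p : ℂ) ≠ 0 := by exact_mod_cast hε.ne'
    have z2 : Z₁ 2 = 0 := by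
      have := heq 2 (by decide)
      simpa [Fin.sum_univ_five, hR, leading, hQ, hεc, hA₃0, hε.ne'] using this
    have z3 : Z₁ 3 = 0 := by
      have := heq 3 (by decide)
      simpa [Fin.sum_univ_five, hR, leading, hQ, hεc, hA₃0, hε.ne'] using this
    have z1 : Z₁ 1 = 0 := by
      have := heq 1 (by decide)
      simpa [Fin.sum_univ_five, hR, leading, hQ, hεc, hA₂0, hε.ne', z2] using this
    have z4 : Z₁ 4 = 0 := by
      have h1 := heq 4 (by decide)
      have hne : (eps p : ℂ) * A₃ + h ≠ 0 := by
        intro h0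
        have h2 := congrArg Complex.re h0
        rw [Complex.add_re, Complex.re_ofReal_mul, Complex.ofReal_re, Complex.zero_re] at h2
        have := mul_nonneg hε.le hA₃re
        linarith [hD.h_pos]
      have h2 : ((eps p : ℂ) * A₃ + h) * Z₁ 4 = 0 := by
        simpa [Fin.sum_univ_five, hR, leading, hQ, z1, z2, z3] using h1
      exact (mul_eq_zero.1 h2).resolve_left hne
    intro i hi
    fin_cases i
    exacts [absurd rfl hi, z1, z2, z3, z4]

end SpectralData

end ZND

namespace ZND

/-! ### Decaying solutions of systems conjugate to a block triangular one -/

/-- `θ` solves `θ' = A θ` on `[0, ∞)`. -/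
def Solves {n : ℕ} (A : ℝ → Matrix (Fin n) (Fin n) ℂ) (θ : ℝ → Fin n → ℂ) : Prop :=
  ∀ x, 0 ≤ x → HasDerivWithinAt θ (A x *ᵥ θ x) (Ici 0) x

section Conjugation

variable {n : ℕ} {Q Q' R A : ℝ → Matrix (Fin n) (Fin n) ℂ}

lemma hasDerivWithinAt_mulVec {x : ℝ} {Q'x : Matrix (Fin n) (Fin n) ℂ} {θ : ℝ → Fin n → ℂ}
    {θ' : Fin n → ℂ} (hQ : ∀ i j, HasDerivWithinAt (fun y => Q y i j) (Q'x i j) (Ici 0) x)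
    (hθ : HasDerivWithinAt θ θ' (Ici 0) x) :
    HasDerivWithinAt (fun y => Q y *ᵥ θ y) (Q'x *ᵥ θ x + Q x *ᵥ θ') (Ici 0) x := by
  rw [hasDerivWithinAt_pi]
  intro i
  simp only [Matrix.mulVec, dotProduct, Pi.add_apply, ← Finset.sum_add_distrib]
  exact HasDerivWithinAt.fun_sum fun j _ => (hQ i j).mul (hasDerivWithinAt_pi.1 hθ j)

lemma Solves.conj (hQ : ∀ x, 0 ≤ x → ∀ i j,
      HasDerivWithinAt (fun y => Q y i j) (Q' x i j) (Ici 0) x)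
    (hRQ : ∀ x, 0 ≤ x → R x * Q x = 1) {θ : ℝ → Fin n → ℂ} (hθ : Solves A θ) :
    Solves (fun x => (Q' x + Q x * A x) * R x) (fun x => Q x *ᵥ θ x) := by
  intro x hx
  refine (hasDerivWithinAt_mulVec (hQ x hx) (hθ x hx)).congr_deriv ?_
  rw [Matrix.mulVec_mulVec, Matrix.mulVec_mulVec, mul_assoc, hRQ x hx, mul_one, Matrix.add_mulVec]

/-- The inverse change of variables.  The derivative of the inverse matrix `R` is `-R Q' R`. -/
lemma Solves.conj_symm (hQ : ∀ x, 0 ≤ x → ∀ i j,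
      HasDerivWithinAt (fun y => Q y i j) (Q' x i j) (Ici 0) x)
    {R' : ℝ → Matrix (Fin n) (Fin n) ℂ}
    (hR : ∀ x, 0 ≤ x → ∀ i j, HasDerivWithinAt (fun y => R y i j) (R' x i j) (Ici 0) x)
    (hRQ : ∀ x, 0 ≤ x → R x * Q x = 1) {Z : ℝ → Fin n → ℂ}
    (hZ : Solves (fun x => (Q' x + Q x * A x) * R x) Z) :
    Solves A (fun x => R x *ᵥ Z x) := by
  intro x hx
  have hQR : Q x * R x = 1 := mul_eq_one_comm.1 (hRQ x hx)
  have hzero : R' x * Q x + R x * Q' x = 0 := by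
    ext i j
    have h1 : HasDerivWithinAt (fun y => (R y * Q y) i j) ((R' x * Q x + R x * Q' x) i j)
        (Ici 0) x := by
      simp only [Matrix.mul_apply, Matrix.add_apply, ← Finset.sum_add_distrib]
      exact HasDerivWithinAt.fun_sum fun k _ => (hR x hx i k).mul (hQ x hx k j)
    have h2 : HasDerivWithinAt (fun y => (R y * Q y) i j) 0 (Ici 0) x :=
      (hasDerivWithinAt_const x (Ici 0) ((1 : Matrix (Fin n) (Fin n) ℂ) i j)).congr
        (fun y hy => by rw [hRQ y hy]) (by rw [hRQ x hx])
    exact (uniqueDiffOn_Ici (0 : ℝ) x hx).eq_deriv _ h1 h2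
  have hR' : R' x = -(R x * Q' x * R x) := by
    calc R' x = R' x * (Q x * R x) := by rw [hQR, mul_one]
      _ = (R' x * Q x) * R x := by rw [mul_assoc]
      _ = -(R x * Q' x) * R x := by rw [eq_neg_of_add_eq_zero_left hzero]
      _ = _ := by rw [neg_mul]
  refine (hasDerivWithinAt_mulVec (hR x hx) (hZ x hx)).congr_deriv ?_
  rw [Matrix.mulVec_mulVec, Matrix.mulVec_mulVec, ← Matrix.add_mulVec, hR']
  congr 1
  change -(R x * Q' x * R x) + R x * ((Q' x + Q x * A x) * R x) = A x * R x
  rw [add_mul, mul_add, ← mul_assoc, ← mul_assoc (R x) (Q x * A x), ← mul_assoc (R x) (Q x),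
    hRQ x hx, one_mul]
  abel

lemma Solves.smul_exp {I m : ℝ → ℂ} (hI : ∀ x, 0 ≤ x → HasDerivWithinAt I (m x) (Ici 0) x)
    {θ : ℝ → Fin n → ℂ} (hθ : Solves A θ) :
    Solves (fun x => A x + m x • (1 : Matrix (Fin n) (Fin n) ℂ))
      (fun x => Complex.exp (I x) • θ x) := by
  intro x hx
  refine ((hI x hx).cexp.smul (hθ x hx)).congr_deriv ?_
  rw [Matrix.add_mulVec, Matrix.smul_mulVec, Matrix.one_mulVec, Matrix.mulVec_smul, smul_smul,
    mul_comm]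

lemma Solves.const_smul (a : ℂ) {θ : ℝ → Fin n → ℂ} (hθ : Solves A θ) :
    Solves A (fun x => a • θ x) := by
  intro x hx
  rw [Matrix.mulVec_smul]
  exact (hθ x hx).const_smul a

lemma Solves.congr {B : ℝ → Matrix (Fin n) (Fin n) ℂ} {θ : ℝ → Fin n → ℂ} (hθ : Solves A θ)
    (h : ∀ x, 0 ≤ x → A x = B x) : Solves B θ := by
  intro x hx
  rw [← h x hx]
  exact hθ x hx

end Conjugation

lemma exists_primitive {m : ℝ → ℂ} (hm : ContinuousOn m (Ici 0)) :
    ∃ I : ℝ → ℂ, I 0 = 0 ∧ ∀ x, 0 ≤ x → HasDerivWithinAt I (m x) (Ici 0) x := by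
  have hc : Continuous fun t : ℝ => m (max t 0) :=
    hm.comp_continuous (continuous_id.max continuous_const) fun t => mem_Ici.2 (le_max_right _ _)
  refine ⟨fun x => ∫ t in (0:ℝ)..x, m (max t 0), by simp, fun x hx => ?_⟩
  have := intervalIntegral.integral_hasDerivAt_right (hc.intervalIntegrable 0 x)
    (hc.stronglyMeasurableAtFilter _ _) hc.continuousAt
  rw [max_eq_left hx] at this
  exact this.hasDerivWithinAt

lemma re_nonpos_of_deriv {I m : ℝ → ℂ} (h0 : I 0 = 0)
    (hI : ∀ x, 0 ≤ x → HasDerivWithinAt I (m x) (Ici 0) x) (hm : ∀ x, 0 ≤ x → (m x).re ≤ 0) {x : ℝ}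
    (hx : 0 ≤ x) : (I x).re ≤ 0 := by
  have hd : ∀ x, 0 ≤ x → HasDerivWithinAt (fun x => (I x).re) (m x).re (Ici 0) x := fun x hx =>
    Complex.reCLM.hasFDerivAt.comp_hasDerivWithinAt x (hI x hx)
  have := image_le_of_deriv_right_le_deriv_boundary (f := fun x => (I x).re)
    (f' := fun x => (m x).re) (a := 0) (b := x) (B := fun _ => 0) (B' := fun _ => 0)
    (fun y hy => (hd y hy.1).continuousWithinAt.mono Icc_subset_Ici_self)
    (fun y hy => (hd y hy.1).mono (Ici_subset_Ici.2 hy.1)) (by simp [h0]) continuousOn_const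
    (fun y _ => hasDerivWithinAt_const _ _ _) (fun y hy => hm y hy.1)
  exact this ⟨hx, le_rfl⟩

lemma leading_eq (m₁ m₂ m₃ b : ℂ) :
    leading m₁ m₂ m₃ b = leading 0 (m₂ - m₁) (m₃ - m₁) b + m₁ • (1 : Matrix (Fin 5) (Fin 5) ℂ) := by
  ext i j
  fin_cases i <;> fin_cases j <;> simp [leading]

lemma norm_mulVec_apply_le {X : Matrix (Fin 5) (Fin 5) ℂ} {B : ℝ} (hX : ∀ i j, ‖X i j‖ ≤ B)
    (z : Fin 5 → ℂ) : ‖X *ᵥ z‖ ≤ 5 * B * ‖z‖ := by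
  have hB : 0 ≤ B := (norm_nonneg _).trans (hX 0 0)
  rw [pi_norm_le_iff_of_nonneg (by positivity)]
  intro i
  simp only [Matrix.mulVec, dotProduct]
  calc ‖∑ j, X i j * z j‖ ≤ ∑ j, ‖X i j * z j‖ := norm_sum_le _ _
    _ ≤ ∑ _j : Fin 5, B * ‖z‖ := Finset.sum_le_sum fun j _ => by
      rw [norm_mul]
      exact mul_le_mul (hX i j) (norm_le_pi_norm z j) (norm_nonneg _) hB
    _ = _ := by simp; ring

lemma tendsto_mulVec {X : ℝ → Matrix (Fin 5) (Fin 5) ℂ} {X₁ : Matrix (Fin 5) (Fin 5) ℂ}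
    {z : ℝ → Fin 5 → ℂ} {z₁ : Fin 5 → ℂ}
    (hX : ∀ i j, Tendsto (fun x => X x i j) atTop (𝓝 (X₁ i j))) (hz : Tendsto z atTop (𝓝 z₁)) :
    Tendsto (fun x => X x *ᵥ z x) atTop (𝓝 (X₁ *ᵥ z₁)) := by
  rw [tendsto_pi_nhds]
  intro i
  simp only [Matrix.mulVec, dotProduct]
  exact tendsto_finsetSum _ fun j _ => (hX i j).mul (tendsto_pi_nhds.1 hz j)

variable {ι : Type*} {K : Set ι} {β : ℝ} {eps : ι → ℝ} {m₁ m₂ m₃ b : ι → ℝ → ℂ}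
  {N : ι → ℝ → Matrix (Fin 5) (Fin 5) ℂ} {h : ℝ}

/-- The change of variables `Z = e^{-ε I} (1 + c/ε) S θ` to normal form, for each parameter:
solutions correspond to solutions, where `T` and `R` are mutually inverse, bounded, and
convergent at infinity. -/
lemma SpectralData.exists_transform (hβ : 0 < β) (hD : SpectralData K β eps m₁ m₂ m₃ b N h)
    {A S S' R : ι → ℝ → Matrix (Fin 5) (Fin 5) ℂ}
    (hSd : ∀ p ∈ K, ∀ x, 0 ≤ x → ∀ i j,
      HasDerivWithinAt (fun y => S p y i j) (S' p x i j) (Ici 0) x)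
    (hS : ∀ i j, ULevel K β 1 (fun p x => S p x i j))
    (hR : ∀ i j, ULevel K β 1 (fun p x => R p x i j))
    (hRS : ∀ p ∈ K, ∀ x, 0 ≤ x → R p x * S p x = 1)
    (hconj : ∀ p ∈ K, ∀ x, 0 ≤ x → (S' p x + S p x * A p x) * R p x =
      (eps p : ℂ) • leading (m₁ p x) (m₂ p x) (m₃ p x) (b p x) + N p x)
    {c c' : Fin 5 → ι → ℝ → ℂ} (hc0 : ∀ p x, c 0 p x = 0)
    (hc : ∀ i, ULevel K β 1 (c i))
    (hcd : ∀ i, ∀ p ∈ K, ∀ x, 0 ≤ x → HasDerivWithinAt (c i p) (c' i p x) (Ici 0) x)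
    {p : ι} (hp : p ∈ K) {I : ℝ → ℂ}
    (hI : ∀ x, 0 ≤ x → HasDerivWithinAt I (m₁ p x) (Ici 0) x) :
    let V := fun x => R p x * shear (-(((eps p)⁻¹ : ℝ) : ℂ)) (fun i => c i p x)
    ∃ T : ℝ → Matrix (Fin 5) (Fin 5) ℂ,
      (∀ x, 0 ≤ x → V x * T x = 1) ∧
      (∃ B, ∀ x, 0 ≤ x → ∀ i j, ‖T x i j‖ ≤ B ∧ ‖V x i j‖ ≤ B) ∧
      (∃ T₁ : Matrix (Fin 5) (Fin 5) ℂ, ∀ i j, Tendsto (fun x => T x i j) atTop (𝓝 (T₁ i j))) ∧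
      (∃ V₁ : Matrix (Fin 5) (Fin 5) ℂ, ∀ i j, Tendsto (fun x => V x i j) atTop (𝓝 (V₁ i j))) ∧
      (∀ θ, Solves (A p) θ → Solves (SpectralData.systemMatrix eps m₁ m₂ m₃ b N c c' p)
        (fun x => Complex.exp (-(eps p * I x)) • (T x *ᵥ θ x))) ∧
      (∀ Z, Solves (SpectralData.systemMatrix eps m₁ m₂ m₃ b N c c' p) Z →
        Solves (A p) (fun x => V x *ᵥ (Complex.exp (eps p * I x) • Z x))) := by
  intro V
  set e : ℂ := (((eps p)⁻¹ : ℝ) : ℂ) with he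
  have hε0 : eps p ≠ 0 := by have := hD.eps_ge p hp; positivity
  have heε : e * eps p = 1 := by
    rw [he, ← Complex.ofReal_mul, inv_mul_cancel₀ hε0, Complex.ofReal_one]
  set cx : ℝ → Fin 5 → ℂ := fun x i => c i p x with hcx
  set cx' : ℝ → Fin 5 → ℂ := fun x i => c' i p x with hcx'
  set T : ℝ → Matrix (Fin 5) (Fin 5) ℂ := fun x => shear e (cx x) * S p x with hT
  set T' : ℝ → Matrix (Fin 5) (Fin 5) ℂ := fun x =>
    e • colZero (cx' x) * S p x + shear e (cx x) * S' p x with hT'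
  have hcx0 : ∀ x, cx x 0 = 0 := fun x => hc0 p x
  have hshear_level : ∀ a : ℂ, ∀ i j, ULevel K β 1 (fun q x => shear a (fun i => c i q x) i j) := by
    intro a i j
    simp only [shear, Matrix.add_apply, Matrix.smul_apply, colZero, Matrix.of_apply, smul_eq_mul]
    refine (ULevel.cst _).add ((ULevel.cst a).mul ?_)
    by_cases hj : j = 0
    · simp only [hj, if_true]; exact hc i
    · simp only [hj, if_false]; exact ULevel.cst 0
  have hTlev : ∀ i j, ULevel K β 1 (fun q x => (shear e (fun i => c i q x) * S q x) i j) := by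
    intro i j
    simp only [Matrix.mul_apply]
    exact ULevel.sum _ fun k _ => (hshear_level e i k).mul (hS k j)
  have hVlev : ∀ i j, ULevel K β 1 (fun q x => (R q x * shear (-e) (fun i => c i q x)) i j) := by
    intro i j
    simp only [Matrix.mul_apply]
    exact ULevel.sum _ fun k _ => (hR i k).mul (hshear_level (-e) k j)
  have hVT : ∀ x, 0 ≤ x → V x * T x = 1 := by
    intro x hx
    have h1 : shear (-e) (cx x) * shear e (cx x) = 1 :=
      mul_eq_one_comm.1 (shear_mul_shear_neg (hcx0 x))
    calc V x * T x = R p x * ((shear (-e) (cx x) * shear e (cx x)) * S p x) := by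
          simp only [V, hT, mul_assoc, hcx, he]
      _ = 1 := by rw [h1, one_mul, hRS p hp x hx]
  have hshd : ∀ x, 0 ≤ x → ∀ i j, HasDerivWithinAt (fun y => shear e (cx y) i j)
      ((e • colZero (cx' x)) i j) (Ici 0) x := by
    intro x hx i j
    simp only [shear, Matrix.add_apply, Matrix.smul_apply, colZero, Matrix.of_apply, smul_eq_mul]
    by_cases hj : j = 0
    · simp only [hj, if_true]
      exact ((hcd i p hp x hx).const_mul e).const_add _
    · simp only [hj, if_false]
      simpa using hasDerivWithinAt_const x (Ici 0) ((1 : Matrix (Fin 5) (Fin 5) ℂ) i j)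
  have hTd : ∀ x, 0 ≤ x → ∀ i j, HasDerivWithinAt (fun y => T y i j) (T' x i j) (Ici 0) x := by
    intro x hx i j
    simp only [hT, hT', Matrix.mul_apply, Matrix.add_apply, ← Finset.sum_add_distrib]
    exact HasDerivWithinAt.fun_sum fun k _ => (hshd x hx i k).mul (hSd p hp x hx k j)
  have hVd : ∃ V' : ℝ → Matrix (Fin 5) (Fin 5) ℂ, ∀ x, 0 ≤ x → ∀ i j,
      HasDerivWithinAt (fun y => V y i j) (V' x i j) (Ici 0) x := by
    choose hb V' hV' hrest using hVlev
    exact ⟨fun x => Matrix.of fun i j => V' i j p x, fun x hx i j => hV' i j p hp x hx⟩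
  obtain ⟨V', hV'⟩ := hVd
  have hmat : ∀ x, 0 ≤ x → (T' x + T x * A p x) * V x =
      SpectralData.systemMatrix eps m₁ m₂ m₃ b N c c' p x +
        (eps p * m₁ p x) • (1 : Matrix (Fin 5) (Fin 5) ℂ) := by
    intro x hx
    have hSR : S p x * R p x = 1 := mul_eq_one_comm.1 (hRS p hp x hx)
    have h1 : (T' x + T x * A p x) * V x = (e • colZero (cx' x) +
        shear e (cx x) * ((S' p x + S p x * A p x) * R p x)) * shear (-e) (cx x) := by
      have h2 : (e • colZero (cx' x)) = (e • colZero (cx' x)) * (S p x * R p x) := by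
        rw [hSR, mul_one]
      rw [h2]
      simp only [V, hT, hT', hcx]
      noncomm_ring
    rw [h1, hconj p hp x hx, leading_eq, smul_add, smul_smul, add_right_comm, mul_add,
      ← add_assoc, add_mul, sheared_eq heε (hcx0 x), mul_smul_comm, mul_one, smul_mul_assoc,
      shear_mul_shear_neg (hcx0 x)]
    rfl
  refine ⟨T, hVT, ?_, ?_, ?_, fun θ hθ => ?_, fun Z hZ => ?_⟩
  · choose B₁ hB₁ using fun i j => (hTlev i j).bdd
    choose B₂ hB₂ using fun i j => (hVlev i j).bdd
    refine ⟨∑ i, ∑ j, (|B₁ i j| + |B₂ i j|), fun x hx i j => ?_⟩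
    have h1 : |B₁ i j| + |B₂ i j| ≤ ∑ i, ∑ j, (|B₁ i j| + |B₂ i j|) :=
      (Finset.single_le_sum (f := fun j => |B₁ i j| + |B₂ i j|)
        (fun _ _ => by positivity) (Finset.mem_univ j)).trans
        (Finset.single_le_sum (f := fun i => ∑ j, (|B₁ i j| + |B₂ i j|))
        (fun _ _ => Finset.sum_nonneg fun _ _ => by positivity) (Finset.mem_univ i))
    have h2 := (hB₁ i j p hp x hx).trans (le_abs_self _)
    have h3 := (hB₂ i j p hp x hx).trans (le_abs_self _)
    have h4 := abs_nonneg (B₁ i j)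
    have h5 := abs_nonneg (B₂ i j)
    exact ⟨h2.trans (by linarith), h3.trans (by linarith)⟩
  · choose T₁ hT₁ using fun i j => (hTlev i j).exists_tendsto hβ p hp
    exact ⟨Matrix.of T₁, hT₁⟩
  · choose V₁ hV₁ using fun i j => (hVlev i j).exists_tendsto hβ p hp
    exact ⟨Matrix.of V₁, hV₁⟩
  · have h1 := (hθ.conj hTd hVT).congr hmat
    have h2 := h1.smul_exp (I := fun x => -(eps p * I x)) (m := fun x => -(eps p * m₁ p x))
      fun x hx => ((hI x hx).const_mul (eps p : ℂ)).neg
    refine h2.congr fun x hx => ?_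
    rw [neg_smul, add_neg_cancel_right]
  · have h1 := hZ.smul_exp (I := fun x => eps p * I x) (m := fun x => eps p * m₁ p x)
      fun x hx => (hI x hx).const_mul (eps p : ℂ)
    exact (h1.congr fun x hx => (hmat x hx).symm).conj_symm hTd hV' hVT

/-- Existence and uniqueness of the solution carried by the mode `μ₁`, together with its value at
`x = 0` up to `O(1/ε)`: the first column of the matrix `R` of eigenvectors. -/
theorem SpectralData.exists_decaying (hβ : 0 < β) (hD : SpectralData K β eps m₁ m₂ m₃ b N h)
    {A S S' R : ι → ℝ → Matrix (Fin 5) (Fin 5) ℂ}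
    (hSd : ∀ p ∈ K, ∀ x, 0 ≤ x → ∀ i j,
      HasDerivWithinAt (fun y => S p y i j) (S' p x i j) (Ici 0) x)
    (hS : ∀ i j, ULevel K β 1 (fun p x => S p x i j))
    (hR : ∀ i j, ULevel K β 1 (fun p x => R p x i j))
    (hRS : ∀ p ∈ K, ∀ x, 0 ≤ x → R p x * S p x = 1)
    (hconj : ∀ p ∈ K, ∀ x, 0 ≤ x → (S' p x + S p x * A p x) * R p x =
      (eps p : ℂ) • leading (m₁ p x) (m₂ p x) (m₃ p x) (b p x) + N p x)
    {mInf : ι → ℂ} (hmc : ∀ p ∈ K, ContinuousOn (m₁ p) (Ici 0))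
    (hm : UDecay K β (fun p x => m₁ p x - mInf p)) :
    ∃ C ε₀ : ℝ, 1 ≤ ε₀ ∧ ∀ p ∈ K, ε₀ ≤ eps p → ∃ θ : ℝ → Fin 5 → ℂ,
      Solves (A p) θ ∧ (∃ B, ∀ x, 0 ≤ x → ‖θ x‖ ≤ B) ∧
      (∃ l : Fin 5 → ℂ, l ≠ 0 ∧
        Tendsto (fun x : ℝ => Complex.exp (-(eps p * mInf p * x)) • θ x) atTop (𝓝 l)) ∧
      (∀ ψ, Solves (A p) ψ → (∃ l : Fin 5 → ℂ,
        Tendsto (fun x : ℝ => Complex.exp (-(eps p * mInf p * x)) • ψ x) atTop (𝓝 l)) →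
        ∃ a : ℂ, ∀ x, 0 ≤ x → ψ x = a • θ x) ∧
      (∀ δ : ℝ, 0 < δ → (∀ x, 0 ≤ x → δ ≤ (m₂ p x).re ∧ δ ≤ (m₃ p x).re) →
        ∀ ψ, Solves (A p) ψ → (∃ B, ∀ x, 0 ≤ x → ‖ψ x‖ ≤ B) →
        ∃ a : ℂ, ∀ x, 0 ≤ x → ψ x = a • θ x) ∧
      ∀ i, ‖θ 0 i - R p 0 i 0‖ ≤ C / eps p := by
  obtain ⟨c, c', hc0, hc0', hc, hcd, ⟨w, C, hw, hNF⟩, htail⟩ := hD.normalForm hβ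
  obtain ⟨C₁, hC₁, hex⟩ := NormalForm.exists_solution (C := C) hw hβ
  obtain ⟨l₀, ε₀, hl₀, hε₀, hlow⟩ := NormalForm.lower_bound (w := w) (C := C) hβ C₁
  choose Br hBr using fun i j => (hR i j).bdd
  choose Bc hBc using fun i => (hc i).bdd
  refine ⟨∑ i, ∑ k, |Br i k| * (C₁ / l₀ + |Bc k|), ε₀, hε₀, fun p hp hpε => ?_⟩
  have hε1 : 1 ≤ eps p := hD.eps_ge p hp
  have hε : 0 < eps p := by linarith
  have hNF0 : NormalForm (SpectralData.systemMatrix eps m₁ m₂ m₃ b N c c' p) w C β (eps p)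
      (fun _ => 0) := by
    refine hNF p hp _ fun x hx => ?_
    have h1 := hD.re₁ p hp x hx
    have h2 := hD.re₂ p hp x hx
    have h3 := hD.re₃ p hp x hx
    exact ⟨mul_nonneg hε.le (by linarith), mul_nonneg hε.le (by linarith)⟩
  obtain ⟨Z, hZ, hZb⟩ := hex (eps p) hε1 _ _ hNF0 fun _ _ => le_rfl
  have hZlow := hlow (eps p) hpε _ _ hNF0 Z hZ hZb
  have hZup : ∀ x, 0 ≤ x → ∀ i, ‖Z x i‖ ≤ 1 + C₁ := by
    intro x hx i
    have he : Real.exp (-β * x) ≤ 1 := by rw [Real.exp_le_one_iff]; nlinarith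
    have he0 := Real.exp_pos (-β * x)
    obtain ⟨h1, h2⟩ := hZb x hx
    by_cases hi : i = 0
    · subst hi
      calc ‖Z x 0‖ = ‖1 + (Z x 0 - 1)‖ := by ring_nf
        _ ≤ ‖(1:ℂ)‖ + ‖Z x 0 - 1‖ := norm_add_le _ _
        _ ≤ _ := by rw [norm_one]; nlinarith
    · have h3 := h2 i hi
      have h4 : C₁ / eps p ≤ C₁ := div_le_self hC₁.le hε1
      have h5 : 0 ≤ C₁ / eps p := by positivity
      nlinarith
  have hZlim : Tendsto Z atTop (𝓝 (Pi.single 0 1)) := by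
    rw [tendsto_pi_nhds]
    intro i
    by_cases hi : i = 0
    · subst hi
      rw [Pi.single_eq_same, tendsto_iff_norm_sub_tendsto_zero]
      exact squeeze_zero' (Eventually.of_forall fun _ => norm_nonneg _)
        ((eventually_ge_atTop 0).mono fun x hx => (hZb x hx).1) (Profile.tendsto_exp_neg hβ C₁)
    · rw [Pi.single_eq_of_ne hi, tendsto_zero_iff_norm_tendsto_zero]
      exact squeeze_zero' (Eventually.of_forall fun _ => norm_nonneg _)
        ((eventually_ge_atTop 0).mono fun x hx => (hZb x hx).2 i hi)
        (Profile.tendsto_exp_neg hβ _)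
  have hZ00 : Z 0 0 ≠ 0 := by
    rw [← norm_pos_iff]; exact hl₀.trans_le (hZlow 0 le_rfl)
  obtain ⟨I, hI0, hI⟩ := exists_primitive (hmc p hp)
  obtain ⟨T, hVT, ⟨B, hB⟩, ⟨T₁, hT₁⟩, ⟨V₁, hV₁⟩, hfwd, hbwd⟩ :=
    hD.exists_transform hβ hSd hS hR hRS hconj hc0 hc hcd hp hI
  set V : ℝ → Matrix (Fin 5) (Fin 5) ℂ := fun x =>
    R p x * shear (-(((eps p)⁻¹ : ℝ) : ℂ)) (fun i => c i p x) with hV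
  have hB0 : 0 ≤ B := (norm_nonneg _).trans (hB 0 le_rfl 0 0).1
  have hTV : ∀ x, 0 ≤ x → T x * V x = 1 := fun x hx => mul_eq_one_comm.1 (hVT x hx)
  obtain ⟨J, hJ⟩ : ∃ J, Tendsto (fun x : ℝ => I x - mInf p * x) atTop (𝓝 J) := by
    obtain ⟨Cm, hCm⟩ := hm
    refine exists_tendsto_of_deriv_decay hβ (f' := fun x => m₁ p x - mInf p)
      (fun x hx => (hI x hx).sub ?_) (hCm p hp)
    simpa using ((hasDerivAt_id x).ofReal_comp.const_mul (mInf p)).hasDerivWithinAt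
  have hIre : ∀ x, 0 ≤ x → (I x).re ≤ 0 := fun x hx =>
    re_nonpos_of_deriv hI0 hI (hD.re₁ p hp) hx
  set θ : ℝ → Fin 5 → ℂ := fun x =>
    (Z 0 0)⁻¹ • (V x *ᵥ (Complex.exp (eps p * I x) • Z x)) with hθ
  -- a solution whose transform is a multiple of `Z` is a multiple of `θ`
  have hmult : ∀ ψ : ℝ → Fin 5 → ℂ, (∃ a : ℂ, ∀ x, 0 ≤ x →
      Complex.exp (-(eps p * I x)) • (T x *ᵥ ψ x) = a • Z x) →
      ∃ a : ℂ, ∀ x, 0 ≤ x → ψ x = a • θ x := by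
    rintro ψ ⟨a, ha⟩
    refine ⟨a * Z 0 0, fun x hx => ?_⟩
    have h1 : T x *ᵥ ψ x = Complex.exp (eps p * I x) • a • Z x := by
      rw [← ha x hx, smul_smul, ← Complex.exp_add]
      simp
    calc ψ x = V x *ᵥ (T x *ᵥ ψ x) := by rw [Matrix.mulVec_mulVec, hVT x hx, Matrix.one_mulVec]
      _ = a • (V x *ᵥ (Complex.exp (eps p * I x) • Z x)) := by
        rw [h1, smul_comm, Matrix.mulVec_smul]
      _ = _ := by simp only [hθ]; rw [smul_smul, mul_assoc, mul_inv_cancel₀ hZ00, mul_one]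
  refine ⟨θ, (hbwd Z hZ).const_smul _, ?_, ?_, ?_, ?_, ?_⟩
  · refine ⟨‖(Z 0 0)⁻¹‖ * (5 * B * (1 + C₁)), fun x hx => ?_⟩
    rw [hθ, norm_smul]
    refine mul_le_mul_of_nonneg_left ?_ (norm_nonneg _)
    refine (norm_mulVec_apply_le (fun i j => (hB x hx i j).2) _).trans ?_
    refine mul_le_mul_of_nonneg_left ?_ (by positivity)
    rw [norm_smul, Complex.norm_exp, Complex.re_ofReal_mul]
    have h1 : Real.exp (eps p * (I x).re) ≤ 1 := by
      rw [Real.exp_le_one_iff]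
      exact mul_nonpos_of_nonneg_of_nonpos hε.le (hIre x hx)
    have h2 : ‖Z x‖ ≤ 1 + C₁ := (pi_norm_le_iff_of_nonneg (by positivity)).2 (hZup x hx)
    calc _ ≤ 1 * (1 + C₁) := mul_le_mul h1 h2 (norm_nonneg _) zero_le_one
      _ = _ := one_mul _
  · set l : Fin 5 → ℂ := (Z 0 0)⁻¹ • (V₁ *ᵥ (Complex.exp (eps p * J) • Pi.single 0 1)) with hl
    have hlim : Tendsto (fun x : ℝ => Complex.exp (-(eps p * mInf p * x)) • θ x) atTop (𝓝 l) := by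
      have h1 : Tendsto (fun x : ℝ => Complex.exp (eps p * (I x - mInf p * x)) • Z x) atTop
          (𝓝 (Complex.exp (eps p * J) • Pi.single 0 1)) :=
        ((Complex.continuous_exp.tendsto _).comp (hJ.const_mul _)).smul hZlim
      refine ((tendsto_mulVec hV₁ h1).const_smul ((Z 0 0)⁻¹)).congr fun x => ?_
      simp only [hθ, Matrix.mulVec_smul]
      rw [smul_comm (Complex.exp (-(eps p * mInf p * x))), smul_smul (Complex.exp _)
        (Complex.exp (eps p * I x)), ← Complex.exp_add]
      congr 3
      ring
    refine ⟨l, fun hl0 => ?_, hlim⟩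
    have h2 : Tendsto (fun x : ℝ => T x *ᵥ (Complex.exp (-(eps p * mInf p * x)) • θ x)) atTop
        (𝓝 (T₁ *ᵥ (0 : Fin 5 → ℂ))) := tendsto_mulVec hT₁ (by rw [← hl0]; exact hlim)
    have h3 : Tendsto (fun x : ℝ => T x *ᵥ (Complex.exp (-(eps p * mInf p * x)) • θ x)) atTop
        (𝓝 ((Z 0 0)⁻¹ • Complex.exp (eps p * J) • Pi.single 0 1)) := by
      have h1 : Tendsto (fun x : ℝ => Complex.exp (eps p * (I x - mInf p * x)) • Z x) atTop
          (𝓝 (Complex.exp (eps p * J) • Pi.single 0 1)) :=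
        ((Complex.continuous_exp.tendsto _).comp (hJ.const_mul _)).smul hZlim
      refine (h1.const_smul ((Z 0 0)⁻¹)).congr' ((eventually_ge_atTop 0).mono fun x hx => ?_)
      simp only [hθ, Matrix.mulVec_smul]
      rw [Matrix.mulVec_mulVec, hTV x hx, Matrix.one_mulVec,
        smul_comm (Complex.exp (-(eps p * mInf p * x))), smul_smul (Complex.exp _)
        (Complex.exp (eps p * I x)), ← Complex.exp_add]
      congr 3
      ring
    have h4 := congrFun (tendsto_nhds_unique h2 h3) 0
    rw [Matrix.mulVec_zero] at h4
    simp only [Pi.zero_apply, Pi.smul_apply, Pi.single_eq_same, smul_eq_mul, mul_one] at h4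
    exact mul_ne_zero (inv_ne_zero hZ00) (Complex.exp_ne_zero _) h4.symm
  · rintro ψ hψ ⟨l, hl⟩
    refine hmult ψ ?_
    have hsol := hfwd ψ hψ
    set Y : ℝ → Fin 5 → ℂ := fun x => Complex.exp (-(eps p * I x)) • (T x *ᵥ ψ x) with hY
    have hYlim : Tendsto Y atTop (𝓝 (Complex.exp (-(eps p * J)) • (T₁ *ᵥ l))) := by
      have h1 : Tendsto (fun x : ℝ => Complex.exp (-(eps p * (I x - mInf p * x)))) atTop
          (𝓝 (Complex.exp (-(eps p * J)))) :=
        (Complex.continuous_exp.tendsto _).comp (hJ.const_mul _).neg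
      refine (h1.smul (tendsto_mulVec hT₁ hl)).congr fun x => ?_
      simp only [hY, Matrix.mulVec_smul]
      rw [smul_smul, ← Complex.exp_add]
      congr 2
      ring
    have hY0 := htail p hp Y _ hsol hYlim
    set Y₁ := Complex.exp (-(eps p * J)) • (T₁ *ᵥ l) with hY₁
    refine hNF0.unique hw hβ (Γ := fun _ => 0) (fun x _ => hasDerivWithinAt_const _ _ _) hZ hsol
      hl₀ hZlow hZup ?_
    have hdiv : Tendsto (fun x => Y x 0 / Z x 0) atTop (𝓝 (Y₁ 0 / 1)) :=
      (tendsto_pi_nhds.1 hYlim 0).div (by simpa using tendsto_pi_nhds.1 hZlim 0) one_ne_zero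
    have h2 := hYlim.sub (hdiv.smul hZlim)
    have h3 : Y₁ - (Y₁ 0 / 1) • (Pi.single 0 1 : Fin 5 → ℂ) = 0 := by
      funext i
      by_cases hi : i = 0
      · subst hi; simp
      · simp [hi, hY0 i hi]
    rw [h3] at h2
    have h4 := h2.norm
    rw [norm_zero] at h4
    simp only [neg_zero, Real.exp_zero, mul_one]
    exact h4
  · rintro δ hδ hδx ψ hψ ⟨D, hD'⟩
    refine hmult ψ ?_
    have hsol := hfwd ψ hψ
    set Y : ℝ → Fin 5 → ℂ := fun x => Complex.exp (-(eps p * I x)) • (T x *ᵥ ψ x) with hY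
    have hNFδ := hNF p hp (fun x => eps p * (-(m₁ p x).re + δ / 2)) fun x hx => by
      obtain ⟨h1, h2⟩ := hδx x hx
      exact ⟨mul_le_mul_of_nonneg_left (by linarith) hε.le,
        mul_le_mul_of_nonneg_left (by linarith) hε.le⟩
    refine hNFδ.unique hw hβ (Γ := fun x => eps p * (-(I x).re + δ / 2 * x)) (fun x hx => ?_)
      hZ hsol hl₀ hZlow hZup ?_
    · have h1 : HasDerivWithinAt (fun x => (I x).re) (m₁ p x).re (Ici 0) x :=
        Complex.reCLM.hasFDerivAt.comp_hasDerivWithinAt x (hI x hx)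
      have h2 : HasDerivWithinAt (fun x : ℝ => δ / 2 * x) (δ / 2) (Ici 0) x := by
        simpa using ((hasDerivAt_id x).const_mul (δ / 2)).hasDerivWithinAt
      exact (h1.neg.add h2).const_mul _
    have hYb : ∀ x, 0 ≤ x → ‖Y x‖ ≤ Real.exp (-(eps p * (I x).re)) * (5 * B * |D|) := by
      intro x hx
      simp only [hY]
      rw [norm_smul, Complex.norm_exp, Complex.neg_re, Complex.re_ofReal_mul]
      refine mul_le_mul_of_nonneg_left ?_ (Real.exp_pos _).le
      refine (norm_mulVec_apply_le (fun i j => (hB x hx i j).1) _).trans ?_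
      exact mul_le_mul_of_nonneg_left ((hD' x hx).trans (le_abs_self D)) (by positivity)
    set F := 5 * B * |D| * (1 + (1 + C₁) / l₀) with hF
    have hlim : Tendsto (fun x : ℝ => F * Real.exp (-(eps p * (δ / 2)) * x)) atTop (𝓝 0) :=
      Profile.tendsto_exp_neg (by positivity) F
    refine squeeze_zero' (Eventually.of_forall fun x => by positivity)
      ((eventually_ge_atTop 0).mono fun x hx => ?_) hlim
    have h1 : ‖Y x - (Y x 0 / Z x 0) • Z x‖ ≤ ‖Y x‖ * (1 + (1 + C₁) / l₀) := by
      refine (norm_sub_le _ _).trans ?_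
      rw [norm_smul (Y x 0 / Z x 0) (Z x), norm_div, mul_add, mul_one]
      refine add_le_add le_rfl ?_
      have h2 : ‖Z x‖ ≤ 1 + C₁ := (pi_norm_le_iff_of_nonneg (by positivity)).2 (hZup x hx)
      calc ‖Y x 0‖ / ‖Z x 0‖ * ‖Z x‖ ≤ ‖Y x‖ / l₀ * (1 + C₁) := by
            refine mul_le_mul ?_ h2 (norm_nonneg _) (by positivity)
            exact div_le_div₀ (norm_nonneg _) (norm_le_pi_norm _ _) hl₀ (hZlow x hx)
        _ = _ := by ring
    calc _ ≤ (Real.exp (-(eps p * (I x).re)) * (5 * B * |D|) * (1 + (1 + C₁) / l₀)) *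
          Real.exp (-(eps p * (-(I x).re + δ / 2 * x))) := by
          refine mul_le_mul_of_nonneg_right (h1.trans ?_) (Real.exp_pos _).le
          exact mul_le_mul_of_nonneg_right (hYb x hx) (by positivity)
      _ = F * (Real.exp (-(eps p * (I x).re)) *
          Real.exp (-(eps p * (-(I x).re + δ / 2 * x)))) := by rw [hF]; ring
      _ = _ := by
        rw [← Real.exp_add]
        congr 2
        ring
  · intro i
    have hcomp : θ 0 i = ∑ k, R p 0 i k *
        ((Z 0 0)⁻¹ * Z 0 k - (((eps p)⁻¹ : ℝ) : ℂ) * c k p 0) := by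
      simp only [hθ, hI0, mul_zero, Complex.exp_zero, one_smul, hV, Pi.smul_apply, smul_eq_mul]
      rw [← Matrix.mulVec_mulVec]
      have hsh : shear (-(((eps p)⁻¹ : ℝ) : ℂ)) (fun i => c i p 0) *ᵥ Z 0 =
          fun k => Z 0 k - (((eps p)⁻¹ : ℝ) : ℂ) * c k p 0 * Z 0 0 := by
        funext k
        rw [shear, Matrix.add_mulVec, Matrix.one_mulVec, Matrix.smul_mulVec]
        simp [Matrix.mulVec, dotProduct, colZero, ite_mul]
        ring
      rw [hsh]
      simp only [Matrix.mulVec, dotProduct]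
      rw [Finset.mul_sum]
      refine Finset.sum_congr rfl fun k _ => ?_
      field_simp
    have hsub : θ 0 i - R p 0 i 0 = ∑ k, R p 0 i k *
        ((Z 0 0)⁻¹ * Z 0 k - (((eps p)⁻¹ : ℝ) : ℂ) * c k p 0 - if k = 0 then 1 else 0) := by
      rw [hcomp]
      simp only [mul_sub, Finset.sum_sub_distrib]
      simp
    rw [hsub]
    have hterm : ∀ k, ‖R p 0 i k *
        ((Z 0 0)⁻¹ * Z 0 k - (((eps p)⁻¹ : ℝ) : ℂ) * c k p 0 - if k = 0 then 1 else 0)‖ ≤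
        |Br i k| * (C₁ / l₀ + |Bc k|) / eps p := by
      intro k
      rw [norm_mul, mul_div_assoc]
      refine mul_le_mul ((hBr i k p hp 0 le_rfl).trans (le_abs_self _)) ?_ (norm_nonneg _)
        (abs_nonneg _)
      by_cases hk : k = 0
      · subst hk
        rw [inv_mul_cancel₀ hZ00, hc0]
        simp only [mul_zero, sub_zero, if_true, sub_self, norm_zero]
        positivity
      · simp only [hk, if_false, sub_zero]
        refine (norm_sub_le _ _).trans ?_
        rw [norm_mul, norm_mul, norm_inv, Complex.norm_real, Real.norm_eq_abs,
          abs_of_pos (inv_pos.2 hε), add_div]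
        refine add_le_add ?_ ?_
        · have h1 := (hZb 0 le_rfl).2 k hk
          rw [mul_zero, Real.exp_zero, mul_one] at h1
          calc ‖Z 0 0‖⁻¹ * ‖Z 0 k‖ ≤ l₀⁻¹ * (C₁ / eps p) :=
                mul_le_mul (inv_anti₀ hl₀ (hZlow 0 le_rfl)) h1 (norm_nonneg _) (by positivity)
            _ = _ := by field_simp
        · rw [mul_comm, ← div_eq_mul_inv]
          exact div_le_div_of_nonneg_right
            ((hBc k p hp 0 le_rfl).trans (le_abs_self _)) hε.le
    refine (norm_sum_le _ _).trans ((Finset.sum_le_sum fun k _ => hterm k).trans ?_)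
    rw [← Finset.sum_div]
    refine div_le_div_of_nonneg_right ?_ hε.le
    exact Finset.single_le_sum (f := fun i => ∑ k, |Br i k| * (C₁ / l₀ + |Bc k|))
      (fun i _ => Finset.sum_nonneg fun k _ => by positivity) (Finset.mem_univ i)

end ZND

namespace ZND

/-! ### Eigenvectors of the leading-order matrix -/

/-- The transpose of `A_x⁻¹ (ζ I + i A_y)`, in terms of the speeds `u`, `c`, of `q = c² - u²`, of
`e = p_S / p_v` and of `f = p_λ / p_v`. -/
def symbol (u v c q e f ζ : ℂ) : Matrix (Fin 5) (Fin 5) ℂ :=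
  !![-(u * ζ / q), -(c ^ 2 * ζ / (v * q)), -(Complex.I * c ^ 2 / (u * v)), 0, 0;
     -(v * ζ / q), -(u * ζ / q), 0, 0, 0;
     Complex.I * u * v / q, Complex.I * c ^ 2 / q, ζ / u, 0, 0;
     -(c ^ 2 * e * ζ / (u * q)), -(c ^ 2 * e * ζ / (v * q)), -(Complex.I * c ^ 2 * e / (u * v)),
       ζ / u, 0;
     -(c ^ 2 * f * ζ / (u * q)), -(c ^ 2 * f * ζ / (v * q)), -(Complex.I * c ^ 2 * f / (u * v)),
       0, ζ / u]

/-- Rows that bring `symbol` to the form `leading`: row `0` is the left eigenvector of `μ₁`, rows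
`2`, `3`, `4` are left eigenvectors of `μ₃`, and row `1` is the one of `μ₂`, up to a multiple `g₂`
of row `2`. -/
def leftModes (k a e f g₁ g₂ : ℂ) : Matrix (Fin 5) (Fin 5) ℂ :=
  !![k / 2, g₁, Complex.I / 2 - Complex.I * g₁ * a, 0, 0;
     -(k / 2), g₂, Complex.I / 2 - Complex.I * g₂ * a, 0, 0;
     0, 1, -(Complex.I * a), 0, 0;
     -e, 0, 0, 1, 0;
     -f, 0, 0, 0, 1]

/-- The inverse of `leftModes`. -/
def rightModes (k a e f g₁ g₂ : ℂ) : Matrix (Fin 5) (Fin 5) ℂ :=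
  !![1 / k, -(1 / k), -((g₁ - g₂) / k), 0, 0;
     a, a, 1 - a * (g₁ + g₂), 0, 0;
     -Complex.I, -Complex.I, Complex.I * (g₁ + g₂), 0, 0;
     e / k, -(e / k), -(e * (g₁ - g₂) / k), 1, 0;
     f / k, -(f / k), -(f * (g₁ - g₂) / k), 0, 1]

lemma rightModes_mul_leftModes {k : ℂ} (hk : k ≠ 0) (a e f g₁ g₂ : ℂ) :
    rightModes k a e f g₁ g₂ * leftModes k a e f g₁ g₂ = 1 := by
  have hI := Complex.I_mul_I
  ext i j
  fin_cases i <;> fin_cases j <;>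
    simp [rightModes, leftModes, Matrix.mul_apply, Fin.sum_univ_succ] <;> field_simp <;>
    first
    | ring1
    | linear_combination (-2 : ℂ) * hI

/-- The acoustic eigenvalue `μ₁`. -/
def mode₁ (u c q ζ s : ℂ) : ℂ := -((u * ζ + c * s) / q)

/-- The acoustic eigenvalue `μ₂`. -/
def mode₂ (u c q ζ s : ℂ) : ℂ := -((u * ζ - c * s) / q)

/-- The coupling of row `2` into row `1` when `g₂ = 0`. -/
def acousticCoupling (u c q ζ s : ℂ) : ℂ := -((c * s - u * ζ) * c / (2 * q * s))

lemma leftModes_mul_symbol {u v c q e f ζ s k g₁ g₂ b : ℂ} (hu : u ≠ 0) (hv : v ≠ 0) (hc : c ≠ 0)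
    (hq : q ≠ 0) (hs : s ≠ 0) (hqe : q = c ^ 2 - u ^ 2) (hsq : s ^ 2 = ζ ^ 2 + q)
    (hk : k = u * v / (c * s))
    (hg₁ : g₁ * (ζ / u - mode₁ u c q ζ s) = (c * s + u * ζ) * c / (2 * q * s))
    (hb : b = acousticCoupling u c q ζ s + g₂ * (ζ / u - mode₂ u c q ζ s)) :
    leftModes k (ζ / u) e f g₁ g₂ * symbol u v c q e f ζ =
      leading (mode₁ u c q ζ s) (mode₂ u c q ζ s) (ζ / u) b * leftModes k (ζ / u) e f g₁ g₂ := by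
  have hI := Complex.I_mul_I
  have hku : k * c ^ 2 / (u * v) = c / s := by rw [hk]; field_simp
  have hkq : k * c ^ 2 / (v * q) = u * c / (s * q) := by rw [hk]; field_simp
  have hkc : k * (c * s) = u * v := by rw [hk]; field_simp
  have hss : s * s⁻¹ = 1 := mul_inv_cancel₀ hs
  have hcq : c ^ 2 / (u * q) = u / q + 1 / u := by field_simp; linear_combination -hqe
  have X0 : ∀ g : ℂ, (Complex.I / 2 - Complex.I * g * (ζ / u)) * (Complex.I * u * v / q) =
      -(u * v / (2 * q)) + g * ζ * v / q := fun g => by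
    rw [show (Complex.I / 2 - Complex.I * g * (ζ / u)) * (Complex.I * u * v / q) =
      (Complex.I * Complex.I) * (u * v / (2 * q) - g * ζ * v / q) by field_simp, hI]
    ring
  have X1 : ∀ g : ℂ, (Complex.I / 2 - Complex.I * g * (ζ / u)) * (Complex.I * c ^ 2 / q) =
      -(c ^ 2 / (2 * q)) + g * ζ * (c ^ 2 / (u * q)) := fun g => by
    linear_combination (c ^ 2 / (2 * q) - g * ζ * (c ^ 2 / (u * q))) * hI
  have hA : ζ / u - mode₁ u c q ζ s = c / s + ζ / u * ((c * s + u * ζ) * c / (q * s)) := by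
    rw [mode₁]
    field_simp
    linear_combination u * c * hsq + s * ζ * hqe
  have hB : ζ / u - mode₂ u c q ζ s = -(c / s) + ζ / u * ((c * s - u * ζ) * c / (q * s)) := by
    rw [mode₂]
    field_simp
    linear_combination -u * c * hsq + s * ζ * hqe
  ext i j
  fin_cases i <;> fin_cases j <;>
    simp [leading, symbol, leftModes, Matrix.mul_apply, Fin.sum_univ_succ]
  · rw [X0, mode₁]
    linear_combination (1 / (2 * q)) * hkc
  · rw [X1]
    linear_combination hg₁ + g₁ * ζ * hcq - ζ / 2 * hkq + c ^ 2 / (2 * q) * hss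
  · linear_combination -Complex.I * (ζ / u) * hg₁ + Complex.I / 2 * hA - Complex.I / 2 * hku
  · rw [X0, mode₂]
    linear_combination (1 / (2 * q)) * hkc
  · rw [X1, hb, acousticCoupling]
    linear_combination g₂ * ζ * hcq + ζ / 2 * hkq + c ^ 2 / (2 * q) * hss
  · rw [hb, acousticCoupling]
    linear_combination Complex.I / 2 * hB + Complex.I / 2 * hku
  · rw [show Complex.I * (ζ / u) * (Complex.I * u * v / q) = Complex.I * Complex.I * (ζ * v / q) by
      field_simp, hI]
    ring
  · linear_combination -(ζ * (c ^ 2 / (u * q))) * hI + ζ * hcq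
  · ring
  · linear_combination -e * ζ * hcq
  · ring
  · ring
  · linear_combination -f * ζ * hcq
  · ring
  · ring

/-! ### The coefficient matrices as functions of the state -/

namespace ThermoModel

variable (M : ThermoModel)

/-- The inverse of `A_x`. -/
def axInv (z : ℝ × ℝ × ℝ × ℝ) : Matrix (Fin 5) (Fin 5) ℝ :=
  let v := z.1
  let u := z.2.1
  let w := thermo z
  let δ := u ^ 2 + v ^ 2 * partialV M.p w
  !![u / δ, v / δ, 0, -(v ^ 2 * partialS M.p w / (u * δ)), -(v ^ 2 * partialLam M.p w / (u * δ));
     -(v * partialV M.p w / δ), u / δ, 0, -(v * partialS M.p w / δ), -(v * partialLam M.p w / δ);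
     0, 0, 1 / u, 0, 0;
     0, 0, 0, 1 / u, 0;
     0, 0, 0, 0, 1 / u]

/-- The matrix `B`, with `d/dx` expressed by differentiation along `field`. -/
def source (z : ℝ × ℝ × ℝ × ℝ) : Matrix (Fin 5) (Fin 5) ℝ :=
  let v := z.1
  let w := thermo z
  !![-M.along (fun y => y.2.1) z, M.along (fun y => y.1) z, 0, 0, 0;
     M.along (fun y => M.p (thermo y)) z -
       v * M.along (fun y => M.c0 (thermo y) ^ 2 / y.1 ^ 2) z, M.along (fun y => y.2.1) z, 0,
       v * M.along (fun y => partialS M.p (thermo y)) z,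
       v * M.along (fun y => partialLam M.p (thermo y)) z;
     0, 0, 0, 0, 0;
     -partialV M.entropySource w, M.along (fun y => y.2.2.1) z, 0, -partialS M.entropySource w,
       -partialLam M.entropySource w;
     -partialV M.r w, M.along (fun y => y.2.2.2) z, 0, -partialS M.r w, -partialLam M.r w]

variable {M}

lemma contDiffOn_denom : ContDiffOn ℝ ∞
    (fun z : ℝ × ℝ × ℝ × ℝ => z.2.1 ^ 2 + z.1 ^ 2 * partialV M.p (thermo z)) M.subsonic :=
  (contDiffOn_vel.pow 2).add
    ((contDiffOn_vol.pow 2).mul (contDiffOn_comp_thermo (contDiffOn_partialV M.contDiffOn_p)))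

lemma contDiffOn_axInv (i j : Fin 5) : ContDiffOn ℝ ∞ (fun z => M.axInv z i j) M.subsonic := by
  have hV := contDiffOn_comp_thermo (contDiffOn_partialV M.contDiffOn_p)
  have hS := contDiffOn_comp_thermo (contDiffOn_partialS M.contDiffOn_p)
  have hL := contDiffOn_comp_thermo (contDiffOn_partialLam M.contDiffOn_p)
  have hu0 : ∀ z ∈ M.subsonic, z.2.1 ≠ 0 := fun z hz => hz.2.1.ne'
  have hd0 := fun z (hz : z ∈ M.subsonic) => (denom_neg hz).ne
  have hd := contDiffOn_denom (M := M)
  have hud := contDiffOn_vel.mul hd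
  have hud0 := fun z (hz : z ∈ M.subsonic) => mul_ne_zero (hu0 z hz) (hd0 z hz)
  have h0 : ContDiffOn ℝ ∞ (fun _ : ℝ × ℝ × ℝ × ℝ => (0 : ℝ)) M.subsonic := contDiffOn_const
  have h1 : ContDiffOn ℝ ∞ (fun z : ℝ × ℝ × ℝ × ℝ => 1 / z.2.1) M.subsonic :=
    contDiffOn_const.div contDiffOn_vel hu0
  have h2 := contDiffOn_vel.div hd hd0
  fin_cases i <;> fin_cases j <;>
    first
    | exact h0
    | exact h1
    | exact h2
    | exact contDiffOn_vol.div hd hd0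
    | exact (((contDiffOn_vol.pow 2).mul hS).div hud hud0).neg
    | exact (((contDiffOn_vol.pow 2).mul hL).div hud hud0).neg
    | exact ((contDiffOn_vol.mul hV).div hd hd0).neg
    | exact ((contDiffOn_vol.mul hS).div hd hd0).neg
    | exact ((contDiffOn_vol.mul hL).div hd hd0).neg

lemma contDiffOn_stiffness :
    ContDiffOn ℝ ∞ (fun z => M.c0 (thermo z) ^ 2 / z.1 ^ 2) M.subsonic :=
  (contDiffOn_sound.pow 2).div (contDiffOn_vol.pow 2)
    fun _ hz => pow_ne_zero 2 (M.v_pos _ hz.1).ne'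

lemma contDiffOn_source (i j : Fin 5) : ContDiffOn ℝ ∞ (fun z => M.source z i j) M.subsonic := by
  have h0 : ContDiffOn ℝ ∞ (fun _ : ℝ × ℝ × ℝ × ℝ => (0 : ℝ)) M.subsonic := contDiffOn_const
  have hu := contDiffOn_along (contDiffOn_vel (M := M))
  have hv := contDiffOn_along (contDiffOn_vol (M := M))
  have hp := (contDiffOn_along (contDiffOn_comp_thermo M.contDiffOn_p)).sub
    (contDiffOn_vol.mul (contDiffOn_along contDiffOn_stiffness))
  have hpS := contDiffOn_vol.mul (contDiffOn_along
    (contDiffOn_comp_thermo (contDiffOn_partialS M.contDiffOn_p)))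
  have hpL := contDiffOn_vol.mul (contDiffOn_along
    (contDiffOn_comp_thermo (contDiffOn_partialLam M.contDiffOn_p)))
  have hS : ContDiffOn ℝ ∞ (M.along fun y => y.2.2.1) M.subsonic := contDiffOn_along (by fun_prop)
  have hl : ContDiffOn ℝ ∞ (M.along fun y => y.2.2.2) M.subsonic := contDiffOn_along (by fun_prop)
  have hV' : ∀ f : ℝ × ℝ × ℝ → ℝ, ContDiffOn ℝ ∞ f M.U →
      ContDiffOn ℝ ∞ (fun z => -partialV f (thermo z)) M.subsonic := fun f hf =>
    (contDiffOn_comp_thermo (contDiffOn_partialV hf)).neg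
  have hS' : ∀ f : ℝ × ℝ × ℝ → ℝ, ContDiffOn ℝ ∞ f M.U →
      ContDiffOn ℝ ∞ (fun z => -partialS f (thermo z)) M.subsonic := fun f hf =>
    (contDiffOn_comp_thermo (contDiffOn_partialS hf)).neg
  have hL' : ∀ f : ℝ × ℝ × ℝ → ℝ, ContDiffOn ℝ ∞ f M.U →
      ContDiffOn ℝ ∞ (fun z => -partialLam f (thermo z)) M.subsonic := fun f hf =>
    (contDiffOn_comp_thermo (contDiffOn_partialLam hf)).neg
  fin_cases i <;> fin_cases j <;>
    first
    | exact h0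
    | exact hu.neg
    | exact hv
    | exact hp
    | exact hu
    | exact hpS
    | exact hpL
    | exact hV' _ M.contDiffOn_entropySource
    | exact hS
    | exact hS' _ M.contDiffOn_entropySource
    | exact hL' _ M.contDiffOn_entropySource
    | exact hV' _ M.contDiffOn_r
    | exact hl
    | exact hS' _ M.contDiffOn_r
    | exact hL' _ M.contDiffOn_r

end ThermoModel

namespace Profile

variable {M : ThermoModel} (D : Profile M)

lemma Ax_inv {x : ℝ} (hx : 0 ≤ x) : (D.Ax x)⁻¹ = M.axInv (D.path x) := by
  have hmem := D.path_mem hx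
  have hd : D.u x ^ 2 + D.v x ^ 2 * partialV M.p (D.state x) ≠ 0 :=
    (ThermoModel.denom_neg hmem).ne
  have hu := (D.vel_pos hx).ne'
  have hw : thermo (D.path x) = D.state x := rfl
  refine Matrix.inv_eq_right_inv ?_
  simp only [Ax, ThermoModel.axInv, hw]
  simp only [path]
  generalize D.u x = u at *
  generalize D.v x = v at *
  generalize partialV M.p (D.state x) = a at *
  generalize partialS M.p (D.state x) = b at *
  generalize partialLam M.p (D.state x) = c at *
  ext i j
  fin_cases i <;> fin_cases j <;>
    simp [Matrix.mul_apply, Fin.sum_univ_succ, hu] <;> field_simp <;> ring1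

lemma B_eq {x : ℝ} (hx : 0 ≤ x) : D.B x = M.source (D.path x) := by
  have e1 := D.ddx_eq_along (g := D.u) ThermoModel.contDiffOn_vel (fun _ _ => rfl) hx
  have e2 := D.ddx_eq_along (g := D.v) ThermoModel.contDiffOn_vol (fun _ _ => rfl) hx
  have e3 := D.ddx_eq_along (g := fun y => M.p (D.state y))
    (ThermoModel.contDiffOn_comp_thermo M.contDiffOn_p) (fun _ _ => rfl) hx
  have e4 := D.ddx_eq_along (g := fun y => D.c0 y ^ 2 / D.v y ^ 2)
    ThermoModel.contDiffOn_stiffness (fun _ _ => rfl) hx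
  have e5 := D.ddx_eq_along (g := fun y => partialS M.p (D.state y))
    (ThermoModel.contDiffOn_comp_thermo (ThermoModel.contDiffOn_partialS M.contDiffOn_p))
    (fun _ _ => rfl) hx
  have e6 := D.ddx_eq_along (g := fun y => partialLam M.p (D.state y))
    (ThermoModel.contDiffOn_comp_thermo (ThermoModel.contDiffOn_partialLam M.contDiffOn_p))
    (fun _ _ => rfl) hx
  have e7 := D.ddx_eq_along (g := D.S) (f := fun y => y.2.2.1) (by fun_prop) (fun _ _ => rfl) hx
  have e8 := D.ddx_eq_along (g := D.lam) (f := fun y => y.2.2.2) (by fun_prop) (fun _ _ => rfl) hx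
  rw [B, e1, e2, e3, e4, e5, e6, e7, e8]
  rfl

/-- At the end state only the last column of `B` survives: all reactant is burnt there, and the
rate `r` vanishes to first order in `(v, S)`. -/
lemma source_pathInf (hrate : M.RateAssumption) (i : Fin 5) {j : Fin 5} (hj : j ≠ 4) :
    M.source D.pathInf i j = 0 := by
  have h0 := D.lamInf_eq_zero hrate
  have hm : (D.vInf, D.SInf, (0 : ℝ)) ∈ M.U := by have := D.inf_mem_U; rwa [h0] at this
  have hw : thermo D.pathInf = (D.vInf, D.SInf, 0) := by rw [thermo_pathInf, h0]
  have hrV := hrate.r_v_eq_zero _ _ hm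
  have hrS := hrate.r_S_eq_zero _ _ hm
  have hr := hrate.r_eq_zero _ _ hm
  -- `Φ = r · (-ΔF / T)` inherits the zero of `r`
  have hΦ : ∀ e : ℝ × ℝ × ℝ, fderiv ℝ M.r (D.vInf, D.SInf, 0) e = 0 →
      fderiv ℝ M.entropySource (D.vInf, D.SInf, 0) e = 0 := by
    intro e he
    have hn := M.isOpen_U.mem_nhds hm
    have d1 := ((M.contDiffOn_r.contDiffAt hn).differentiableAt (by simp)).hasFDerivAt
    have d2 : DifferentiableAt ℝ (fun z => -(M.deltaF z / M.temp z)) (D.vInf, D.SInf, 0) :=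
      (((M.contDiffOn_deltaF.contDiffAt hn).div (M.contDiffOn_temp.contDiffAt hn)
        (M.temp_pos _ hm).ne').neg).differentiableAt (by simp)
    have d3 := d1.mul d2.hasFDerivAt
    have hfun : M.entropySource = M.r * fun z => -(M.deltaF z / M.temp z) := by
      funext z
      simp only [ThermoModel.entropySource, Pi.mul_apply]
      ring
    rw [hfun, d3.fderiv]
    simp [hr, he]
  have e1 := D.along_pathInf (ThermoModel.contDiffOn_vel (M := M))
  have e2 := D.along_pathInf (ThermoModel.contDiffOn_vol (M := M))
  have e3 := D.along_pathInf (ThermoModel.contDiffOn_comp_thermo M.contDiffOn_p)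
  have e4 := D.along_pathInf (ThermoModel.contDiffOn_stiffness (M := M))
  have e5 := D.along_pathInf
    (ThermoModel.contDiffOn_comp_thermo (ThermoModel.contDiffOn_partialS M.contDiffOn_p))
  have e7 := D.along_pathInf (f := fun y => y.2.2.1) (by fun_prop)
  have e8 := D.along_pathInf (f := fun y => y.2.2.2) (by fun_prop)
  have hΦV : partialV M.entropySource (D.vInf, D.SInf, 0) = 0 := hΦ _ hrV
  have hΦS : partialS M.entropySource (D.vInf, D.SInf, 0) = 0 := hΦ _ hrS
  simp only [ThermoModel.source, hw, e1, e2, e3, e4, e5, e7, e8, hΦV, hΦS, hrV, hrS]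
  fin_cases i <;> fin_cases j <;> first | exact absurd rfl hj | simp

end Profile

end ZND

namespace ZND

/-! ### Families bounded away from zero -/

section Away

variable {ι : Type*} {K : Set ι} {β : ℝ} {k : ℕ} {f g : ι → ℝ → ℂ}

/-- The family `f p`, `p ∈ K`, is bounded away from zero on `[0, ∞)`, uniformly in `p`. -/
def UAway (K : Set ι) (f : ι → ℝ → ℂ) : Prop :=
  ∃ c : ℝ, 0 < c ∧ ∀ p ∈ K, ∀ x, 0 ≤ x → c ≤ ‖f p x‖

lemma UAway.ne_zero (hf : UAway K f) {p : ι} (hp : p ∈ K) {x : ℝ} (hx : 0 ≤ x) : f p x ≠ 0 := by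
  obtain ⟨c, hc, h⟩ := hf
  exact norm_pos_iff.1 (hc.trans_le (h p hp x hx))

lemma UAway.mul (hf : UAway K f) (hg : UAway K g) : UAway K (fun p x => f p x * g p x) := by
  obtain ⟨c, hc, h⟩ := hf
  obtain ⟨c', hc', h'⟩ := hg
  refine ⟨c * c', mul_pos hc hc', fun p hp x hx => ?_⟩
  rw [norm_mul]
  exact mul_le_mul (h p hp x hx) (h' p hp x hx) hc'.le (norm_nonneg _)

lemma UAway.cst {c : ℂ} (hc : c ≠ 0) : UAway K (fun _ _ => c) :=
  ⟨‖c‖, norm_pos_iff.2 hc, fun _ _ _ _ => le_rfl⟩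

/-- A factor of a product bounded away from zero is bounded away from zero if the other factor is
bounded. -/
lemma UAway.of_mul (h : UAway K (fun p x => f p x * g p x)) (hg : UBdd K g) : UAway K f := by
  obtain ⟨c, hc, h⟩ := h
  obtain ⟨b, hb⟩ := hg
  refine ⟨c / (|b| + 1), by positivity, fun p hp x hx => ?_⟩
  rw [div_le_iff₀ (by positivity)]
  have h1 := h p hp x hx
  rw [norm_mul] at h1
  refine h1.trans (mul_le_mul_of_nonneg_left ?_ (norm_nonneg _))
  linarith [hb p hp x hx, le_abs_self b]

lemma ULevel.div_away (hf : ULevel K β k f) (hg : ULevel K β k g) (h : UAway K g) :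
    ULevel K β k (fun p x => f p x / g p x) := by
  obtain ⟨c, hc, h⟩ := h
  exact hf.div hg hc h

/-- A function whose derivative is `O(e^{-βx})` approaches its limit at that rate. -/
lemma ULevel.decay_sub_limit (hβ : 0 < β) (hf : ULevel K β (k + 1) f) {l : ι → ℂ}
    (hl : ∀ p ∈ K, Tendsto (f p) atTop (𝓝 (l p))) : UDecay K β (fun p x => f p x - l p) := by
  obtain ⟨-, f', hd, ⟨C, hC⟩, -⟩ := hf
  refine ⟨C / β, fun p hp x hx => ?_⟩
  rw [norm_sub_rev]
  exact le_of_tendsto ((hl p hp).sub_const _).norm ((eventually_ge_atTop x).mono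
    fun y hxy => norm_sub_le_of_deriv_decay hβ (hd p hp) (hC p hp) hx hxy)

end Away

namespace Profile

variable {M : ThermoModel} (D : Profile M)

/-! ### The eigenvalues and eigenvectors along the profile -/

/-- The modulus `c₀ √η` of the branch points of `s(x, ·)`. -/
def turning (x : ℝ) : ℝ := D.c0 x * Real.sqrt (D.eta x)

/-- The frequencies of modulus at most `ρ` at distance at least `d` from all branch points. -/
def awayFromTurning (d ρ : ℝ) : Set ℂ :=
  {ζ | 0 ≤ ζ.re ∧ ‖ζ‖ ≤ ρ ∧ ∀ x, 0 ≤ x →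
    d ≤ ‖ζ - Complex.I * D.turning x‖ ∧ d ≤ ‖ζ + Complex.I * D.turning x‖}

/-- The parameters `(ζ, ε)` with `ζ` away from the branch points and `ε ≥ 1`. -/
def params (d ρ : ℝ) : Set (ℂ × ℝ) := {p | p.1 ∈ D.awayFromTurning d ρ ∧ 1 ≤ p.2}

/-- `q = c₀² - u²`. -/
def gapSq (x : ℝ) : ℝ := D.c0 x ^ 2 - D.u x ^ 2

lemma sound_pos {x : ℝ} (hx : 0 ≤ x) : 0 < D.c0 x :=
  (D.vel_pos hx).trans (ThermoModel.vel_lt_sound (D.path_mem hx))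

lemma vel_lt_sound {x : ℝ} (hx : 0 ≤ x) : D.u x < D.c0 x :=
  ThermoModel.vel_lt_sound (D.path_mem hx)

lemma gapSq_pos {x : ℝ} (hx : 0 ≤ x) : 0 < D.gapSq x := by
  have h1 := D.vel_pos hx
  have h2 := D.vel_lt_sound hx
  rw [gapSq]
  nlinarith

lemma vol_pos {x : ℝ} (hx : 0 ≤ x) : 0 < D.v x := M.v_pos _ (D.mem_U x hx)

lemma etaOf_mul_sq {u c : ℝ} (hc : c ≠ 0) : etaOf u c * c ^ 2 = c ^ 2 - u ^ 2 := by
  rw [etaOf, kappaOf]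
  field_simp

lemma etaOf_pos {u c : ℝ} (hu : 0 < u) (huc : u < c) : 0 < etaOf u c := by
  have hc : 0 < c := hu.trans huc
  have h := etaOf_mul_sq (u := u) hc.ne'
  by_contra hle
  nlinarith [sq_nonneg c]

lemma turning_sq {x : ℝ} (hx : 0 ≤ x) : D.turning x ^ 2 = D.gapSq x := by
  rw [turning, mul_pow, eta, Real.sq_sqrt (etaOf_pos (D.vel_pos hx) (D.vel_lt_sound hx)).le,
    mul_comm, etaOf_mul_sq (D.sound_pos hx).ne', gapSq]

lemma turning_pos {x : ℝ} (hx : 0 ≤ x) : 0 < D.turning x :=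
  mul_pos (D.sound_pos hx) (Real.sqrt_pos.2 (etaOf_pos (D.vel_pos hx) (D.vel_lt_sound hx)))

lemma s_sq {x : ℝ} (hx : 0 ≤ x) (ζ : ℂ) : D.s x ζ ^ 2 = ζ ^ 2 + D.gapSq x := by
  rw [s, sOf, sqrtBranch_sq]
  have h := D.turning_sq hx
  rw [turning, eta] at h
  rw [← Complex.ofReal_pow, h]

lemma mu1Of_eq {u c : ℝ} (hu : 0 < u) (huc : u < c) (ζ : ℂ) :
    mu1Of u c ζ = mode₁ u c ((c ^ 2 - u ^ 2 : ℝ) : ℂ) ζ (sOf u c ζ) := by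
  have hc : 0 < c := hu.trans huc
  have hq : (c ^ 2 - u ^ 2 : ℝ) ≠ 0 := by nlinarith
  have h := etaOf_mul_sq (u := u) hc.ne'
  have hη : etaOf u c = (c ^ 2 - u ^ 2) / c ^ 2 := by rw [← h]; field_simp
  have hc' : (c : ℂ) ≠ 0 := Complex.ofReal_ne_zero.2 hc.ne'
  have hu' : (u : ℂ) ≠ 0 := Complex.ofReal_ne_zero.2 hu.ne'
  have hq' : ((c ^ 2 - u ^ 2 : ℝ) : ℂ) ≠ 0 := Complex.ofReal_ne_zero.2 hq
  rw [mu1Of, mode₁, hη, kappaOf, Complex.ofReal_div, Complex.ofReal_div]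
  generalize ((c ^ 2 - u ^ 2 : ℝ) : ℂ) = q at *
  push_cast
  field_simp

lemma contDiffOn_gapSq :
    ContDiffOn ℝ ∞ (fun z => M.c0 (thermo z) ^ 2 - z.2.1 ^ 2) M.subsonic :=
  (ThermoModel.contDiffOn_sound.pow 2).sub (ThermoModel.contDiffOn_vel.pow 2)

lemma contDiffOn_turning : ContDiffOn ℝ ∞ (fun z =>
    M.c0 (thermo z) * Real.sqrt (etaOf z.2.1 (M.c0 (thermo z)))) M.subsonic := by
  refine ThermoModel.contDiffOn_sound.mul (ContDiffOn.sqrt ?_ fun z hz =>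
    (etaOf_pos hz.2.1 (ThermoModel.vel_lt_sound hz)).ne')
  exact contDiffOn_const.sub ((ThermoModel.contDiffOn_vel.div ThermoModel.contDiffOn_sound
    fun z hz => (hz.2.1.trans (ThermoModel.vel_lt_sound hz)).ne').pow 2)

variable {D} {β d ρ : ℝ} {K : Set (ℂ × ℝ)}

lemma away_ofReal {ι : Type*} {K : Set ι} {f : ℝ × ℝ × ℝ × ℝ → ℝ}
    (hf : ContDiffOn ℝ ∞ f M.subsonic) (hpos : ∀ z ∈ M.subsonic, 0 < f z) :
    UAway K (fun _ x => (f (D.path x) : ℂ)) := by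
  obtain ⟨c, hc, h⟩ := D.exists_pos_le hf hpos
  refine ⟨c, hc, fun _ _ x hx => ?_⟩
  rw [Complex.norm_real, Real.norm_eq_abs]
  exact (h x hx).trans (le_abs_self _)

lemma away_vel : UAway K (fun _ x => (D.u x : ℂ)) :=
  away_ofReal (f := fun z => z.2.1) ThermoModel.contDiffOn_vel fun _ hz => hz.2.1

lemma away_vol : UAway K (fun _ x => (D.v x : ℂ)) :=
  away_ofReal (f := fun z => z.1) ThermoModel.contDiffOn_vol fun _ hz => M.v_pos _ hz.1

lemma away_sound : UAway K (fun _ x => (D.c0 x : ℂ)) :=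
  away_ofReal (f := fun z => M.c0 (thermo z)) ThermoModel.contDiffOn_sound
    fun _ hz => hz.2.1.trans (ThermoModel.vel_lt_sound hz)

lemma away_gapSq : UAway K (fun _ x => (D.gapSq x : ℂ)) :=
  away_ofReal (f := fun z => M.c0 (thermo z) ^ 2 - z.2.1 ^ 2) contDiffOn_gapSq fun z hz => by
    have h1 := hz.2.1
    have h2 := ThermoModel.vel_lt_sound hz
    nlinarith

lemma HasRate.level_vel (hβ : D.HasRate β) (k : ℕ) : ULevel K β k (fun _ x => (D.u x : ℂ)) :=
  hβ.level ThermoModel.contDiffOn_vel k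

lemma HasRate.level_vol (hβ : D.HasRate β) (k : ℕ) : ULevel K β k (fun _ x => (D.v x : ℂ)) :=
  hβ.level ThermoModel.contDiffOn_vol k

lemma HasRate.level_sound (hβ : D.HasRate β) (k : ℕ) : ULevel K β k (fun _ x => (D.c0 x : ℂ)) :=
  hβ.level ThermoModel.contDiffOn_sound k

lemma HasRate.level_gapSq (hβ : D.HasRate β) (k : ℕ) :
    ULevel K β k (fun _ x => (D.gapSq x : ℂ)) :=
  hβ.level contDiffOn_gapSq k

lemma level_freq (hK : K ⊆ D.params d ρ) (k : ℕ) : ULevel K β k (fun p _ => p.1) :=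
  ULevel.const ⟨ρ, fun _ hp => (hK hp).1.2.1⟩

lemma HasRate.level_s (hβ : D.HasRate β) (hd : 0 < d) (hK : K ⊆ D.params d ρ) (k : ℕ) :
    ULevel K β k (fun p x => D.s x p.1) := by
  have ha : ULevel K β k (fun _ x => (D.turning x : ℂ)) := hβ.level contDiffOn_turning k
  have hia := (ULevel.cst (K := K) (β := β) (k := k) Complex.I).mul ha
  have hz := level_freq (β := β) hK k
  exact ((hz.sub hia).cpow_half hd (fun p hp x hx => ((hK hp).1.2.2 x hx).1)
    fun p hp x _ => by simpa using (hK hp).1.1).mul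
    ((hz.add hia).cpow_half hd (fun p hp x hx => ((hK hp).1.2.2 x hx).2)
    fun p hp x _ => by simpa using (hK hp).1.1)

lemma le_norm_s (hd : 0 < d) {ζ : ℂ} (hζ : ζ ∈ D.awayFromTurning d ρ) {x : ℝ} (hx : 0 ≤ x) :
    d ≤ ‖D.s x ζ‖ := by
  have h1 : D.s x ζ ^ 2 = (ζ - Complex.I * D.turning x) * (ζ + Complex.I * D.turning x) := by
    rw [D.s_sq hx, ← D.turning_sq hx]
    push_cast
    linear_combination (D.turning x : ℂ) ^ 2 * Complex.I_mul_I
  have h2 : d ^ 2 ≤ ‖D.s x ζ‖ ^ 2 := by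
    rw [← norm_pow, h1, norm_mul, sq]
    obtain ⟨h3, h4⟩ := hζ.2.2 x hx
    exact mul_le_mul h3 h4 hd.le (norm_nonneg _)
  exact le_of_sq_le_sq_of_nonneg h2 (norm_nonneg _)

lemma away_s (hd : 0 < d) (hK : K ⊆ D.params d ρ) : UAway K (fun p x => D.s x p.1) :=
  ⟨d, hd, fun _ hp _ hx => le_norm_s hd (hK hp).1 hx⟩

/-- `c ζ + u s` does not vanish: `μ₃` is never in resonance with `μ₁`. -/
lemma away_add (hd : 0 < d) (hK : K ⊆ D.params d ρ) :
    UAway K (fun p x => (D.c0 x : ℂ) * p.1 + D.u x * D.s x p.1) := by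
  obtain ⟨c, hc, h⟩ := away_vel (D := D) (K := K)
  refine ⟨c * d, mul_pos hc hd, fun p hp x hx => ?_⟩
  have hcx := D.sound_pos hx
  have hux := D.vel_pos hx
  have h1 := norm_sqrtBranch_le_norm_add (D.turning x) (hK hp).1.1
    (κ := D.u x / D.c0 x) (by positivity)
  change D.u x / D.c0 x * ‖D.s x p.1‖ ≤ ‖p.1 + ((D.u x / D.c0 x : ℝ) : ℂ) * D.s x p.1‖ at h1
  have hc' : (D.c0 x : ℂ) ≠ 0 := Complex.ofReal_ne_zero.2 hcx.ne'
  have h2 : (D.c0 x : ℂ) * p.1 + D.u x * D.s x p.1 =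
      D.c0 x * (p.1 + ((D.u x / D.c0 x : ℝ) : ℂ) * D.s x p.1) := by
    push_cast
    field_simp
  have h3 := h p hp x hx
  rw [Complex.norm_real, Real.norm_eq_abs, abs_of_pos hux] at h3
  have h4 := le_norm_s hd (hK hp).1 hx
  beta_reduce
  rw [h2, norm_mul, Complex.norm_real, Real.norm_eq_abs, abs_of_pos hcx]
  calc c * d ≤ D.u x * ‖D.s x p.1‖ := mul_le_mul h3 h4 hd.le hux.le
    _ = D.c0 x * (D.u x / D.c0 x * ‖D.s x p.1‖) := by field_simp
    _ ≤ _ := mul_le_mul_of_nonneg_left h1 hcx.le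

variable (D) in
/-- The eigenvalue `μ₁` of `symbol` along the profile. -/
def m₁ (x : ℝ) (ζ : ℂ) : ℂ := mode₁ (D.u x) (D.c0 x) (D.gapSq x) ζ (D.s x ζ)

variable (D) in
/-- The eigenvalue `μ₂` of `symbol` along the profile. -/
def m₂ (x : ℝ) (ζ : ℂ) : ℂ := mode₂ (D.u x) (D.c0 x) (D.gapSq x) ζ (D.s x ζ)

lemma HasRate.level_m₁ (hβ : D.HasRate β) (hd : 0 < d) (hK : K ⊆ D.params d ρ) (k : ℕ) :
    ULevel K β k (fun p x => D.m₁ x p.1) :=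
  ((((hβ.level_vel k).mul (level_freq hK k)).add
    ((hβ.level_sound k).mul (hβ.level_s hd hK k))).div_away (hβ.level_gapSq k) away_gapSq).neg

lemma HasRate.level_m₂ (hβ : D.HasRate β) (hd : 0 < d) (hK : K ⊆ D.params d ρ) (k : ℕ) :
    ULevel K β k (fun p x => D.m₂ x p.1) :=
  ((((hβ.level_vel k).mul (level_freq hK k)).sub
    ((hβ.level_sound k).mul (hβ.level_s hd hK k))).div_away (hβ.level_gapSq k) away_gapSq).neg

lemma re_le_re_s {ζ : ℂ} (hζ : 0 ≤ ζ.re) {x : ℝ} (hx : 0 ≤ x) : ζ.re ≤ (D.s x ζ).re :=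
  re_le_re_sqrtBranch (D.turning_pos hx) hζ

lemma re_m₁ {ζ : ℂ} (hζ : 0 ≤ ζ.re) {x : ℝ} (hx : 0 ≤ x) : (D.m₁ x ζ).re ≤ 0 := by
  have h1 := re_le_re_s (D := D) hζ hx
  have h2 := D.gapSq_pos hx
  have h3 := D.sound_pos hx
  have h4 := D.vel_pos hx
  rw [m₁, mode₁, Complex.neg_re, Complex.div_ofReal_re, Complex.add_re, Complex.re_ofReal_mul,
    Complex.re_ofReal_mul, neg_nonpos]
  have h5 : 0 ≤ (D.s x ζ).re := hζ.trans h1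
  positivity

/-- The mode `μ₂` grows at least at the rate `Re ζ / (c₀ + u)`. -/
lemma le_re_m₂ {ζ : ℂ} (hζ : 0 ≤ ζ.re) {x : ℝ} (hx : 0 ≤ x) :
    ζ.re * (1 / (D.c0 x + D.u x)) ≤ (D.m₂ x ζ).re := by
  have h1 := re_le_re_s (D := D) hζ hx
  have h2 := D.gapSq_pos hx
  have h3 := D.sound_pos hx
  have h4 := D.vel_pos hx
  rw [m₂, mode₂, Complex.neg_re, Complex.div_ofReal_re, Complex.sub_re, Complex.re_ofReal_mul,
    Complex.re_ofReal_mul, ← neg_div, le_div_iff₀ h2]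
  have h5 : ζ.re * (1 / (D.c0 x + D.u x)) * D.gapSq x = ζ.re * (D.c0 x - D.u x) := by
    rw [gapSq]
    field_simp
    ring
  rw [h5]
  nlinarith

lemma tendsto_cpow_half {f : ℝ → ℂ} {l : ℂ} (hd : 0 < d) (hf : Tendsto f atTop (𝓝 l))
    (hre : ∀ x, 0 ≤ x → 0 ≤ (f x).re) (h : ∀ x, 0 ≤ x → d ≤ ‖f x‖) :
    Tendsto (fun x => f x ^ (1 / 2 : ℂ)) atTop (𝓝 (l ^ (1 / 2 : ℂ))) := by
  have h1 : 0 ≤ l.re := ge_of_tendsto ((Complex.continuous_re.tendsto l).comp hf)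
    ((eventually_ge_atTop 0).mono hre)
  have h2 : d ≤ ‖l‖ := ge_of_tendsto hf.norm ((eventually_ge_atTop 0).mono h)
  refine (continuousAt_cpow_const ?_).tendsto.comp hf
  rw [Complex.mem_slitPlane_iff]
  rcases h1.eq_or_lt with h0 | h0
  · right
    intro him
    have : l = 0 := Complex.ext h0.symm him
    rw [this, norm_zero] at h2
    linarith
  · exact Or.inl h0

lemma tendsto_s (hd : 0 < d) {ζ : ℂ} (hζ : ζ ∈ D.awayFromTurning d ρ) :
    Tendsto (fun x => D.s x ζ) atTop (𝓝 (sOf D.uInf D.c0Inf ζ)) := by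
  have ha : Tendsto (fun x => Complex.I * (D.turning x : ℂ)) atTop
      (𝓝 (Complex.I * ((D.c0Inf * Real.sqrt (etaOf D.uInf D.c0Inf) : ℝ) : ℂ))) :=
    ((Complex.continuous_ofReal.tendsto _).comp
      (D.tendsto_comp_path contDiffOn_turning)).const_mul _
  rw [sOf, sqrtBranch]
  push_cast at ha ⊢
  exact (tendsto_cpow_half hd (ha.const_sub ζ) (fun x _ => by simpa using hζ.1)
    fun x hx => (hζ.2.2 x hx).1).mul (tendsto_cpow_half hd (ha.const_add ζ)
    (fun x _ => by simpa using hζ.1) fun x hx => (hζ.2.2 x hx).2)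

lemma tendsto_m₁ (hd : 0 < d) {ζ : ℂ} (hζ : ζ ∈ D.awayFromTurning d ρ) :
    Tendsto (fun x => D.m₁ x ζ) atTop (𝓝 (mu1Of D.uInf D.c0Inf ζ)) := by
  have hI := D.pathInf_mem
  have hlt : D.uInf < D.c0Inf := ThermoModel.vel_lt_sound hI
  have hu0 : 0 < D.uInf := hI.2.1
  rw [mu1Of_eq hu0 hlt]
  have hu : Tendsto (fun x => (D.u x : ℂ)) atTop (𝓝 (D.uInf : ℂ)) :=
    (Complex.continuous_ofReal.tendsto _).comp (D.tendsto_comp_path ThermoModel.contDiffOn_vel)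
  have hc : Tendsto (fun x => (D.c0 x : ℂ)) atTop (𝓝 (D.c0Inf : ℂ)) :=
    (Complex.continuous_ofReal.tendsto _).comp (D.tendsto_comp_path ThermoModel.contDiffOn_sound)
  have hq : Tendsto (fun x => (D.gapSq x : ℂ)) atTop (𝓝 ((D.c0Inf ^ 2 - D.uInf ^ 2 : ℝ) : ℂ)) :=
    (Complex.continuous_ofReal.tendsto _).comp (D.tendsto_comp_path contDiffOn_gapSq)
  refine (((hu.mul_const ζ).add (hc.mul (tendsto_s hd hζ))).div hq ?_).neg
  rw [Complex.ofReal_ne_zero]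
  nlinarith

end Profile

end ZND

namespace ZND

namespace Profile

variable {M : ThermoModel} (D : Profile M)

/-! ### Diagonalization along the profile -/

/-- `p_S / p_v`. -/
def slopeS (x : ℝ) : ℝ := partialS M.p (D.state x) / partialV M.p (D.state x)

/-- `p_λ / p_v`. -/
def slopeL (x : ℝ) : ℝ := partialLam M.p (D.state x) / partialV M.p (D.state x)

/-- The normalization `u v / (c₀ s)` of the acoustic eigenvectors, for which the first column of
`right` is `T e₁`. -/
def scale (x : ℝ) (ζ : ℂ) : ℂ := D.u x * D.v x / (D.c0 x * D.s x ζ)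

/-- The solution `g₁` of the equation that makes row `0` of `left` an eigenvector of `μ₁`. -/
def weight₁ (x : ℝ) (ζ : ℂ) : ℂ :=
  (D.c0 x * D.s x ζ + D.u x * ζ) * D.u x / (2 * D.s x ζ * (D.c0 x * ζ + D.u x * D.s x ζ))

/-- The matrix `leftModes` along the profile. -/
def left (x : ℝ) (ζ g : ℂ) : Matrix (Fin 5) (Fin 5) ℂ :=
  leftModes (D.scale x ζ) (ζ / D.u x) (D.slopeS x) (D.slopeL x) (D.weight₁ x ζ) g

/-- The matrix `rightModes` along the profile. -/
def right (x : ℝ) (ζ g : ℂ) : Matrix (Fin 5) (Fin 5) ℂ :=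
  rightModes (D.scale x ζ) (ζ / D.u x) (D.slopeS x) (D.slopeL x) (D.weight₁ x ζ) g

/-- The matrix `symbol` along the profile. -/
def principal (x : ℝ) (ζ : ℂ) : Matrix (Fin 5) (Fin 5) ℂ :=
  symbol (D.u x) (D.v x) (D.c0 x) (D.gapSq x) (D.slopeS x) (D.slopeL x) ζ

/-- The part of the coefficient matrix that does not depend on the frequencies. -/
def lower (x : ℝ) : Matrix (Fin 5) (Fin 5) ℂ :=
  ((M.axInv (D.path x) * M.source (D.path x)).map Complex.ofReal)ᵀ

lemma sound_sq {x : ℝ} (hx : 0 ≤ x) :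
    D.c0 x ^ 2 = -(D.v x ^ 2 * partialV M.p (D.state x)) :=
  ThermoModel.sound_sq (D.path_mem hx)

lemma partialV_neg {z : ℝ × ℝ × ℝ × ℝ} (hz : z ∈ M.subsonic) : partialV M.p (thermo z) < 0 := by
  have h := hz.2.2
  have h2 := sq_nonneg z.2.1
  by_contra hle
  nlinarith [mul_nonneg (sq_nonneg z.1) (not_lt.1 hle)]

lemma principal_eq {x : ℝ} (hx : 0 ≤ x) (ζ : ℂ) :
    ((M.axInv (D.path x)).map Complex.ofReal *
      (ζ • (1 : Matrix (Fin 5) (Fin 5) ℂ) + Complex.I • (D.Ay x).map Complex.ofReal))ᵀ =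
      D.principal x ζ := by
  have hpv : partialV M.p (D.state x) ≠ 0 := (partialV_neg (D.path_mem hx)).ne
  have hv := (D.vol_pos hx).ne'
  have hu := (D.vel_pos hx).ne'
  have hq := (D.gapSq_pos hx).ne'
  have hc := D.sound_sq hx
  have hδ : D.u x ^ 2 + D.v x ^ 2 * partialV M.p (D.state x) = -D.gapSq x := by
    rw [gapSq, hc]; ring
  have hw : thermo (D.path x) = D.state x := rfl
  have hS : partialS M.p (D.state x) = D.slopeS x * partialV M.p (D.state x) := by
    rw [slopeS, div_mul_cancel₀ _ hpv]
  have hL : partialLam M.p (D.state x) = D.slopeL x * partialV M.p (D.state x) := by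
    rw [slopeL, div_mul_cancel₀ _ hpv]
  have hV : partialV M.p (D.state x) = -(D.c0 x ^ 2) / D.v x ^ 2 := by rw [hc]; field_simp
  simp only [ThermoModel.axInv, Ay, principal, symbol, hw]
  simp only [path]
  rw [hδ, hS, hL, hV]
  have hv' : (D.v x : ℂ) ≠ 0 := Complex.ofReal_ne_zero.2 hv
  have hu' : (D.u x : ℂ) ≠ 0 := Complex.ofReal_ne_zero.2 hu
  have hq' : (D.gapSq x : ℂ) ≠ 0 := Complex.ofReal_ne_zero.2 hq
  clear hV hL hS hw hδ hc hq hu hv hpv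
  ext i j
  fin_cases i <;> fin_cases j <;>
    simp [Matrix.mul_apply, Fin.sum_univ_succ, Matrix.one_apply] <;> field_simp

lemma P_eq {x : ℝ} (hx : 0 ≤ x) (ζ : ℂ) (ε : ℝ) :
    -(D.P x (ε * ζ) ε)ᵀ = (ε : ℂ) • D.principal x ζ + D.lower x := by
  have h1 : (ε * ζ) • (1 : Matrix (Fin 5) (Fin 5) ℂ) +
      (Complex.I * ε) • (D.Ay x).map Complex.ofReal =
      (ε : ℂ) • (ζ • (1 : Matrix (Fin 5) (Fin 5) ℂ) + Complex.I • (D.Ay x).map Complex.ofReal) := by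
    rw [smul_add, smul_smul, smul_smul, mul_comm Complex.I]
  rw [P, D.Ax_inv hx, D.B_eq hx, h1, Matrix.transpose_neg, neg_neg, mul_add, Matrix.transpose_add,
    mul_smul_comm, Matrix.transpose_smul, D.principal_eq hx, lower]
  congr 2
  exact (Matrix.map_mul (f := Complex.ofRealHom)).symm

lemma gap₃_eq {x : ℝ} (hx : 0 ≤ x) (ζ : ℂ) : ζ / D.u x - D.m₁ x ζ =
    D.c0 x * (D.c0 x * ζ + D.u x * D.s x ζ) / (D.u x * D.gapSq x) := by
  have hu : (D.u x : ℂ) ≠ 0 := Complex.ofReal_ne_zero.2 (D.vel_pos hx).ne'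
  have hq : (D.gapSq x : ℂ) ≠ 0 := Complex.ofReal_ne_zero.2 (D.gapSq_pos hx).ne'
  have hqe : (D.gapSq x : ℂ) = (D.c0 x : ℂ) ^ 2 - (D.u x : ℂ) ^ 2 := by
    rw [gapSq]; push_cast; ring
  rw [m₁, mode₁]
  field_simp
  linear_combination ζ * hqe

lemma weight₁_eq {x : ℝ} (hx : 0 ≤ x) {ζ : ℂ} (hs : D.s x ζ ≠ 0)
    (hsum : (D.c0 x : ℂ) * ζ + D.u x * D.s x ζ ≠ 0) :
    D.weight₁ x ζ * (ζ / D.u x - D.m₁ x ζ) =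
      (D.c0 x * D.s x ζ + D.u x * ζ) * D.c0 x / (2 * D.gapSq x * D.s x ζ) := by
  have hu : (D.u x : ℂ) ≠ 0 := Complex.ofReal_ne_zero.2 (D.vel_pos hx).ne'
  have hq : (D.gapSq x : ℂ) ≠ 0 := Complex.ofReal_ne_zero.2 (D.gapSq_pos hx).ne'
  rw [D.gap₃_eq hx, weight₁]
  generalize hw : (D.c0 x : ℂ) * ζ + D.u x * D.s x ζ = w at *
  field_simp

lemma gap₃₂_eq {x : ℝ} (hx : 0 ≤ x) (ζ : ℂ) : ζ / D.u x - D.m₂ x ζ =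
    D.c0 x * (D.c0 x * ζ - D.u x * D.s x ζ) / (D.u x * D.gapSq x) := by
  have hu : (D.u x : ℂ) ≠ 0 := Complex.ofReal_ne_zero.2 (D.vel_pos hx).ne'
  have hq : (D.gapSq x : ℂ) ≠ 0 := Complex.ofReal_ne_zero.2 (D.gapSq_pos hx).ne'
  have hqe : (D.gapSq x : ℂ) = (D.c0 x : ℂ) ^ 2 - (D.u x : ℂ) ^ 2 := by
    rw [gapSq]; push_cast; ring
  rw [m₂, mode₂]
  field_simp
  linear_combination ζ * hqe

lemma gap₂_eq (x : ℝ) (ζ : ℂ) :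
    D.m₂ x ζ - D.m₁ x ζ = 2 * D.c0 x * D.s x ζ / D.gapSq x := by
  rw [m₂, mode₂, m₁, mode₁]
  ring

lemma scale_ne_zero {x : ℝ} (hx : 0 ≤ x) {ζ : ℂ} (hs : D.s x ζ ≠ 0) : D.scale x ζ ≠ 0 := by
  have hv : (D.v x : ℂ) ≠ 0 := Complex.ofReal_ne_zero.2 (D.vol_pos hx).ne'
  have hu : (D.u x : ℂ) ≠ 0 := Complex.ofReal_ne_zero.2 (D.vel_pos hx).ne'
  have hc : (D.c0 x : ℂ) ≠ 0 := Complex.ofReal_ne_zero.2 (D.sound_pos hx).ne'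
  exact div_ne_zero (mul_ne_zero hu hv) (mul_ne_zero hc hs)

lemma left_mul_principal {x : ℝ} (hx : 0 ≤ x) {ζ g b : ℂ} (hs : D.s x ζ ≠ 0)
    (hsum : (D.c0 x : ℂ) * ζ + D.u x * D.s x ζ ≠ 0)
    (hb : b = acousticCoupling (D.u x) (D.c0 x) (D.gapSq x) ζ (D.s x ζ) +
      g * (ζ / D.u x - D.m₂ x ζ)) :
    D.left x ζ g * D.principal x ζ =
      leading (D.m₁ x ζ) (D.m₂ x ζ) (ζ / D.u x) b * D.left x ζ g :=
  leftModes_mul_symbol (Complex.ofReal_ne_zero.2 (D.vel_pos hx).ne')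
    (Complex.ofReal_ne_zero.2 (D.vol_pos hx).ne') (Complex.ofReal_ne_zero.2 (D.sound_pos hx).ne')
    (Complex.ofReal_ne_zero.2 (D.gapSq_pos hx).ne') hs (by rw [gapSq]; push_cast; ring)
    (D.s_sq hx ζ) rfl (D.weight₁_eq hx hs hsum) hb

/-- The first column of `right` is the eigenvector `T e₁`. -/
lemma right_col_zero {x : ℝ} (hx : 0 ≤ x) {ζ : ℂ} (hs : D.s x ζ ≠ 0) (g : ℂ) (i : Fin 5) :
    D.right x ζ g i 0 = D.Te1 x ζ i := by
  have hv : (D.v x : ℂ) ≠ 0 := Complex.ofReal_ne_zero.2 (D.vol_pos hx).ne'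
  have hu : (D.u x : ℂ) ≠ 0 := Complex.ofReal_ne_zero.2 (D.vel_pos hx).ne'
  have hc : (D.c0 x : ℂ) ≠ 0 := Complex.ofReal_ne_zero.2 (D.sound_pos hx).ne'
  have hpv : (partialV M.p (D.state x) : ℂ) ≠ 0 :=
    Complex.ofReal_ne_zero.2 (partialV_neg (D.path_mem hx)).ne
  have hcc : (D.c0 x : ℂ) ^ 2 = -((D.v x : ℂ) ^ 2 * partialV M.p (D.state x)) := by
    exact_mod_cast D.sound_sq hx
  have hV : (partialV M.p (D.state x) : ℂ) = -((D.c0 x : ℂ) ^ 2) / (D.v x : ℂ) ^ 2 := by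
    rw [hcc]; field_simp
  simp only [Te1, Matrix.mulVec_single_one, Matrix.col_apply, right, rightModes, T, scale, slopeS,
    slopeL, m, kappa, kappaOf, Complex.ofReal_div, hV]
  fin_cases i <;> simp <;> field_simp

variable {D} {β d ρ : ℝ} {K : Set (ℂ × ℝ)}

lemma HasRate.level_lower (hβ : D.HasRate β) (i j : Fin 5) (k : ℕ) :
    ULevel K β k (fun _ x => D.lower x i j) := by
  refine hβ.level (f := fun z => (M.axInv z * M.source z) j i) ?_ k
  simp only [Matrix.mul_apply]
  exact ContDiffOn.sum fun l _ =>
    (ThermoModel.contDiffOn_axInv j l).mul (ThermoModel.contDiffOn_source l i)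

lemma HasRate.decay_lower (hβ : D.HasRate β) (hrate : M.RateAssumption) {i : Fin 5} (hi : i ≠ 4)
    (j : Fin 5) : UDecay K β (fun _ x => D.lower x i j) := by
  refine hβ.decay (f := fun z => (M.axInv z * M.source z) j i) ?_ ?_
  · simp only [Matrix.mul_apply]
    exact ContDiffOn.sum fun l _ =>
      (ThermoModel.contDiffOn_axInv j l).mul (ThermoModel.contDiffOn_source l i)
  · simp only [Matrix.mul_apply]
    exact Finset.sum_eq_zero fun l _ => by rw [D.source_pathInf hrate l hi, mul_zero]

variable (D) in
/-- The rate `-r_λ / u` at the end state, at which the last component of adjoint solutions grows. -/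
def burnRate : ℝ := -partialLam M.r (thermo D.pathInf) / D.uInf

lemma burnRate_pos (hrate : M.RateAssumption) : 0 < D.burnRate :=
  div_pos (neg_pos.2 (hrate.r_lam_neg _ D.pathInf_mem.1)) D.pathInf_mem.2.1

lemma HasRate.decay_lower_last (hβ : D.HasRate β) :
    UDecay K β (fun _ x => D.lower x 4 4 - D.burnRate) := by
  have h := hβ.decay_sub (K := K) (f := fun z => (M.axInv z * M.source z) 4 4) (by
    simp only [Matrix.mul_apply]
    exact ContDiffOn.sum fun l _ =>
      (ThermoModel.contDiffOn_axInv 4 l).mul (ThermoModel.contDiffOn_source l 4))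
  refine h.congr fun p _ x _ => ?_
  have h1 : (M.axInv D.pathInf * M.source D.pathInf) 4 4 = D.burnRate := by
    simp [Matrix.mul_apply, Fin.sum_univ_succ, ThermoModel.axInv, ThermoModel.source, burnRate,
      pathInf]
    ring
  rw [h1, Complex.ofReal_sub]
  rfl

lemma HasRate.level_slopeS (hβ : D.HasRate β) (k : ℕ) :
    ULevel K β k (fun _ x => (D.slopeS x : ℂ)) :=
  hβ.level (f := fun z => partialS M.p (thermo z) / partialV M.p (thermo z))
    ((ThermoModel.contDiffOn_comp_thermo (ThermoModel.contDiffOn_partialS M.contDiffOn_p)).div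
      (ThermoModel.contDiffOn_comp_thermo (ThermoModel.contDiffOn_partialV M.contDiffOn_p))
      fun _ hz => (partialV_neg hz).ne) k

lemma HasRate.level_slopeL (hβ : D.HasRate β) (k : ℕ) :
    ULevel K β k (fun _ x => (D.slopeL x : ℂ)) :=
  hβ.level (f := fun z => partialLam M.p (thermo z) / partialV M.p (thermo z))
    ((ThermoModel.contDiffOn_comp_thermo (ThermoModel.contDiffOn_partialLam M.contDiffOn_p)).div
      (ThermoModel.contDiffOn_comp_thermo (ThermoModel.contDiffOn_partialV M.contDiffOn_p))
      fun _ hz => (partialV_neg hz).ne) k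

lemma HasRate.level_scale (hβ : D.HasRate β) (hd : 0 < d) (hK : K ⊆ D.params d ρ) (k : ℕ) :
    ULevel K β k (fun p x => D.scale x p.1) :=
  ((hβ.level_vel k).mul (hβ.level_vol k)).div_away
    ((hβ.level_sound k).mul (hβ.level_s hd hK k)) (away_sound.mul (away_s hd hK))

lemma HasRate.away_scale (hβ : D.HasRate β) (hd : 0 < d) (hK : K ⊆ D.params d ρ) :
    UAway K (fun p x => D.scale x p.1) := by
  have hcs := (away_sound (D := D)).mul (away_s hd hK)
  refine UAway.of_mul (g := fun p x => (D.c0 x : ℂ) * D.s x p.1) ?_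
    (((hβ.level_sound 0).mul (hβ.level_s hd hK 0)).bdd)
  obtain ⟨c, hc, h⟩ := (away_vel (D := D) (K := K)).mul away_vol
  refine ⟨c, hc, fun p hp x hx => ?_⟩
  beta_reduce
  rw [scale, div_mul_cancel₀ _ (hcs.ne_zero hp hx)]
  exact h p hp x hx

lemma HasRate.level_weight₁ (hβ : D.HasRate β) (hd : 0 < d) (hK : K ⊆ D.params d ρ) (k : ℕ) :
    ULevel K β k (fun p x => D.weight₁ x p.1) := by
  have hu := hβ.level_vel (K := K) k
  have hc := hβ.level_sound (K := K) k
  have hs := hβ.level_s hd hK k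
  have hz := level_freq (β := β) hK k
  exact (((hc.mul hs).add (hu.mul hz)).mul hu).div_away
    (((ULevel.cst 2).mul hs).mul ((hc.mul hz).add (hu.mul hs)))
    (((UAway.cst two_ne_zero).mul (away_s hd hK)).mul (away_add hd hK))

lemma HasRate.level_left (hβ : D.HasRate β) (hd : 0 < d) (hK : K ⊆ D.params d ρ) {k : ℕ}
    {g : ℂ × ℝ → ℝ → ℂ} (hg : ULevel K β k g) (i j : Fin 5) :
    ULevel K β k (fun p x => D.left x p.1 (g p x) i j) := by
  have hk := (hβ.level_scale hd hK k).div_away (ULevel.cst 2) (UAway.cst two_ne_zero)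
  have ha := (level_freq (β := β) hK k).div_away (hβ.level_vel k) away_vel
  have hw := hβ.level_weight₁ hd hK k
  have hI := ULevel.cst (K := K) (β := β) (k := k) Complex.I
  have hI2 := ULevel.cst (K := K) (β := β) (k := k) (Complex.I / 2)
  have h0 := ULevel.cst (K := K) (β := β) (k := k) 0
  have h1 := ULevel.cst (K := K) (β := β) (k := k) 1
  fin_cases i <;> fin_cases j <;>
    first
    | exact h0
    | exact h1
    | exact hk
    | exact hk.neg
    | exact hw
    | exact hg
    | exact hI2.sub ((hI.mul hw).mul ha)
    | exact hI2.sub ((hI.mul hg).mul ha)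
    | exact (hI.mul ha).neg
    | exact (hβ.level_slopeS k).neg
    | exact (hβ.level_slopeL k).neg

lemma HasRate.level_right (hβ : D.HasRate β) (hd : 0 < d) (hK : K ⊆ D.params d ρ) {k : ℕ}
    {g : ℂ × ℝ → ℝ → ℂ} (hg : ULevel K β k g) (i j : Fin 5) :
    ULevel K β k (fun p x => D.right x p.1 (g p x) i j) := by
  have hk := hβ.level_scale hd hK k
  have hk0 := hβ.away_scale hd hK
  have ha := (level_freq (β := β) hK k).div_away (hβ.level_vel k) away_vel
  have hw := hβ.level_weight₁ hd hK k
  have hI := ULevel.cst (K := K) (β := β) (k := k) Complex.I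
  have h0 := ULevel.cst (K := K) (β := β) (k := k) 0
  have h1 := ULevel.cst (K := K) (β := β) (k := k) 1
  have hS := hβ.level_slopeS (K := K) k
  have hL := hβ.level_slopeL (K := K) k
  fin_cases i <;> fin_cases j <;>
    first
    | exact h0
    | exact h1
    | exact h1.div_away hk hk0
    | exact (h1.div_away hk hk0).neg
    | exact ((hw.sub hg).div_away hk hk0).neg
    | exact ha
    | exact h1.sub (ha.mul (hw.add hg))
    | exact hI.neg
    | exact hI.mul (hw.add hg)
    | exact hS.div_away hk hk0
    | exact (hS.div_away hk hk0).neg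
    | exact ((hS.mul (hw.sub hg)).div_away hk hk0).neg
    | exact hL.div_away hk hk0
    | exact (hL.div_away hk hk0).neg
    | exact ((hL.mul (hw.sub hg)).div_away hk hk0).neg

lemma left_last {i : Fin 5} (hi : i ≠ 4) (x : ℝ) (ζ g : ℂ) : D.left x ζ g i 4 = 0 := by
  fin_cases i <;> first | exact absurd rfl hi | rfl

lemma right_last {i : Fin 5} (hi : i ≠ 4) (x : ℝ) (ζ g : ℂ) : D.right x ζ g i 4 = 0 := by
  fin_cases i <;> first | exact absurd rfl hi | rfl

/-- Existence of decaying solutions with the expected initial value, and their uniqueness, for any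
admissible choice of the multiple `g` of row `2` in row `1` of `left` and of the remaining coupling
`b`. -/
theorem exists_decaying_of_coupling (hrate : M.RateAssumption) (hβ : D.HasRate β) (hd : 0 < d)
    (hK : K ⊆ D.params d ρ) {g b : ℂ × ℝ → ℝ → ℂ} (hg : ULevel K β 2 g) (hb : ULevel K β 1 b)
    (hbg : ∀ p ∈ K, ∀ x, 0 ≤ x → b p x =
      acousticCoupling (D.u x) (D.c0 x) (D.gapSq x) p.1 (D.s x p.1) +
        g p x * (p.1 / D.u x - D.m₂ x p.1))
    (hcoup : ∃ l, 0 < l ∧ ∀ p ∈ K, ∀ x, 0 ≤ x → ‖b p x‖ ≤ l * (D.m₂ x p.1).re) :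
    ∃ C ε₀ : ℝ, 1 ≤ ε₀ ∧ ∀ p ∈ K, ε₀ ≤ p.2 → ∃ θ : ℝ → Fin 5 → ℂ,
      D.IsExactDecayingSolution (p.2 * p.1) p.2 θ ∧
      ∀ i, ‖θ 0 i - D.Te1 0 p.1 i‖ ≤ C / p.2 := by
  set S : ℂ × ℝ → ℝ → Matrix (Fin 5) (Fin 5) ℂ := fun p x => D.left x p.1 (g p x) with hSdef
  set R : ℂ × ℝ → ℝ → Matrix (Fin 5) (Fin 5) ℂ := fun p x => D.right x p.1 (g p x) with hRdef
  have hS2 : ∀ i j, ULevel K β (1 + 1) (fun p x => S p x i j) := fun i j => hβ.level_left hd hK hg i j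
  have hS1 : ∀ i j, ULevel K β 1 (fun p x => S p x i j) := fun i j => (hS2 i j).pred
  have hR1 : ∀ i j, ULevel K β 1 (fun p x => R p x i j) := fun i j =>
    (show ULevel K β (1 + 1) _ from hβ.level_right hd hK hg i j).pred
  have hS2' := hS2
  choose _ S'f hSd hSdec hS'1 using hS2'
  set S' : ℂ × ℝ → ℝ → Matrix (Fin 5) (Fin 5) ℂ := fun p x => Matrix.of fun i j => S'f i j p x
    with hS'def
  set N : ℂ × ℝ → ℝ → Matrix (Fin 5) (Fin 5) ℂ := fun p x =>
    (S' p x + S p x * D.lower x) * R p x with hNdef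
  have hs0 : ∀ p ∈ K, ∀ x, 0 ≤ x → D.s x p.1 ≠ 0 := fun p hp x hx => (away_s hd hK).ne_zero hp hx
  have hRS : ∀ p ∈ K, ∀ x, 0 ≤ x → R p x * S p x = 1 := fun p hp x hx =>
    rightModes_mul_leftModes (D.scale_ne_zero hx (hs0 p hp x hx)) _ _ _ _ _
  have hconj : ∀ p ∈ K, ∀ x, 0 ≤ x →
      (S' p x + S p x * -(D.P x (p.2 * p.1) p.2)ᵀ) * R p x =
      (p.2 : ℂ) • leading (D.m₁ x p.1) (D.m₂ x p.1) (p.1 / D.u x) (b p x) + N p x := by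
    intro p hp x hx
    have h1 : S p x * D.principal x p.1 =
        leading (D.m₁ x p.1) (D.m₂ x p.1) (p.1 / D.u x) (b p x) * S p x :=
      D.left_mul_principal hx (hs0 p hp x hx) ((away_add hd hK).ne_zero hp hx) (hbg p hp x hx)
    have h2 : S p x * R p x = 1 := mul_eq_one_comm.1 (hRS p hp x hx)
    rw [D.P_eq hx, mul_add, mul_smul_comm, h1, add_left_comm, add_mul, smul_mul_assoc, mul_assoc,
      h2, mul_one]
  have hN_apply : ∀ i j p x, N p x i j =
      ∑ l, (S' p x i l + ∑ k, S p x i k * D.lower x k l) * R p x l j := fun i j p x => by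
    simp only [hNdef, Matrix.mul_apply, Matrix.add_apply]
  have hN1 : ∀ i j, ULevel K β 1 (fun p x => N p x i j) := by
    intro i j
    simp only [hN_apply]
    exact ULevel.sum _ fun l _ => ((hS'1 i l).add (ULevel.sum _ fun k _ =>
      (hS1 i k).mul (hβ.level_lower k l 1))).mul (hR1 l j)
  have hNdec : ∀ i j, i ≠ 4 → UDecay K β (fun p x => N p x i j) := by
    intro i j hi
    simp only [hN_apply]
    refine UDecay.sum _ fun l _ => ((hSdec i l).add (UDecay.sum _ fun k _ => ?_)).mul_bdd
      (hR1 l j).bdd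
    by_cases hk : k = 4
    · subst hk
      exact UDecay.zero.congr fun p _ x _ => by
        rw [show S p x i 4 = 0 from left_last hi x p.1 (g p x), zero_mul]
    · exact UDecay.bdd_mul (hS1 i k).bdd (hβ.decay_lower hrate hk l)
  have hNlast : UDecay K β (fun p x => N p x 4 4 - D.burnRate) := by
    have h1 : UDecay K β (fun p x => S'f 4 4 p x + ∑ k ∈ Finset.univ.erase 4,
        S p x 4 k * D.lower x k 4 + (D.lower x 4 4 - D.burnRate)) :=
      ((hSdec 4 4).add (UDecay.sum _ fun k hk => UDecay.bdd_mul (hS1 4 k).bdd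
        (hβ.decay_lower hrate (Finset.ne_of_mem_erase hk) 4))).add hβ.decay_lower_last
    refine h1.congr fun p _ x _ => ?_
    have h2 : ∀ l, l ≠ 4 → (S' p x 4 l + ∑ k, S p x 4 k * D.lower x k l) * R p x l 4 = 0 :=
      fun l hl => by rw [show R p x l 4 = 0 from right_last hl x p.1 (g p x), mul_zero]
    rw [hN_apply, Fintype.sum_eq_single 4 h2, show R p x 4 4 = 1 from rfl,
      ← Finset.add_sum_erase _ _ (Finset.mem_univ (4 : Fin 5)), show S p x 4 4 = 1 from rfl]
    simp only [hS'def, Matrix.of_apply]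
    ring
  have hz := level_freq (β := β) hK 1
  have hm3 := hz.div_away (hβ.level_vel 1) away_vel
  have hD : SpectralData K β (fun p => p.2) (fun p x => D.m₁ x p.1) (fun p x => D.m₂ x p.1)
      (fun p x => p.1 / D.u x) b N D.burnRate :=
    { eps_ge := fun p hp => (hK hp).2
      h_pos := burnRate_pos hrate
      level_gap₂ := (hβ.level_m₂ hd hK 1).sub (hβ.level_m₁ hd hK 1)
      level_gap₃ := hm3.sub (hβ.level_m₁ hd hK 1)
      level_b := hb
      level_N := hN1
      gap := by
        have hq := (hβ.level_gapSq (K := K) 0).bdd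
        have huq := ((hβ.level_vel (K := K) 0).mul (hβ.level_gapSq (K := K) 0)).bdd
        have h2 : UAway K (fun p x => D.m₂ x p.1 - D.m₁ x p.1) := by
          refine UAway.of_mul ?_ hq
          obtain ⟨c, hc, h⟩ := ((UAway.cst (K := K) two_ne_zero).mul
            (away_sound (D := D))).mul (away_s hd hK)
          refine ⟨c, hc, fun p hp x hx => (h p hp x hx).trans_eq ?_⟩
          beta_reduce
          rw [D.gap₂_eq, div_mul_cancel₀ _ (away_gapSq.ne_zero hp hx)]
        have h3 : UAway K (fun p x => p.1 / D.u x - D.m₁ x p.1) := by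
          refine UAway.of_mul ?_ huq
          obtain ⟨c, hc, h⟩ := (away_sound (D := D)).mul (away_add hd hK)
          refine ⟨c, hc, fun p hp x hx => (h p hp x hx).trans_eq ?_⟩
          beta_reduce
          rw [D.gap₃_eq hx, div_mul_cancel₀ _ ((away_vel.mul away_gapSq).ne_zero hp hx)]
        obtain ⟨c, hc, h⟩ := h2
        obtain ⟨c', hc', h'⟩ := h3
        exact ⟨min c c', lt_min hc hc', fun p hp x hx =>
          ⟨(min_le_left _ _).trans (h p hp x hx), (min_le_right _ _).trans (h' p hp x hx)⟩⟩
      re₁ := fun p hp x hx => re_m₁ (hK hp).1.1 hx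
      re₂ := fun p hp x hx => by
        have h1 := (hK hp).1.1
        have h2 := D.vel_pos hx
        have h3 := D.sound_pos hx
        exact le_trans (by positivity) (le_re_m₂ h1 hx)
      re₃ := fun p hp x hx => by
        rw [Complex.div_ofReal_re]
        exact div_nonneg (hK hp).1.1 (D.vel_pos hx).le
      coupling := hcoup
      decay_N := hNdec
      decay_N_last := hNlast }
  obtain ⟨C, ε₀, hε₀, hex⟩ := hD.exists_decaying hβ.1
    (A := fun p x => -(D.P x (p.2 * p.1) p.2)ᵀ) (S := S) (S' := S') (R := R)
    (fun p hp x hx i j => hSd i j p hp x hx) hS1 hR1 hRS hconj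
    (mInf := fun p => mu1Of D.uInf D.c0Inf p.1) (hβ.level_m₁ hd hK 0).cont
    ((hβ.level_m₁ hd hK 1).decay_sub_limit hβ.1 fun p hp => tendsto_m₁ hd (hK hp).1)
  refine ⟨C, ε₀, hε₀, fun p hp hpε => ?_⟩
  obtain ⟨θ, hθ, hbd, ⟨l, hl, hlim⟩, huniq, hunb, hval⟩ := hex p hp hpε
  have hε : (p.2 : ℂ) ≠ 0 := by
    have := (hK hp).2
    exact Complex.ofReal_ne_zero.2 (by linarith)
  have hsol : ∀ ψ, D.IsSolution (p.2 * p.1) p.2 ψ ↔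
      Solves (fun x => -(D.P x (p.2 * p.1) p.2)ᵀ) ψ := fun ψ => by
    simp only [IsSolution, Solves, Matrix.neg_mulVec]
  have hfast : D.fastMode (p.2 * p.1) p.2 = p.2 * mu1Of D.uInf D.c0Inf p.1 := by
    rw [fastMode, mul_div_cancel_left₀ _ hε]
  refine ⟨θ, ⟨⟨(hsol θ).2 hθ, hbd, l, hl, by rw [hfast]; exact hlim⟩, fun ψ hψ => ?_,
    fun hre ψ hψ hψb => ?_⟩, fun i => ?_⟩
  · obtain ⟨l', -, hl'⟩ := hψ.asymptotic
    rw [hfast] at hl'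
    exact huniq ψ ((hsol ψ).1 hψ.solves) ⟨l', hl'⟩
  · have hp2 : 0 < p.2 := by linarith [(hK hp).2]
    have hre' : 0 < p.1.re := by
      rw [Complex.re_ofReal_mul] at hre
      exact pos_of_mul_pos_right hre hp2.le
    obtain ⟨c₁, hc₁, h₁⟩ := D.exists_pos_le
      (f := fun z => 1 / (M.c0 (thermo z) + z.2.1)) (contDiffOn_const.div
        (ThermoModel.contDiffOn_sound.add ThermoModel.contDiffOn_vel) fun z hz =>
          (add_pos (hz.2.1.trans (ThermoModel.vel_lt_sound hz)) hz.2.1).ne')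
      fun z hz => one_div_pos.2 (add_pos (hz.2.1.trans (ThermoModel.vel_lt_sound hz)) hz.2.1)
    obtain ⟨c₂, hc₂, h₂⟩ := D.exists_pos_le (f := fun z => 1 / z.2.1)
      (contDiffOn_const.div ThermoModel.contDiffOn_vel fun z hz => hz.2.1.ne')
      fun z hz => one_div_pos.2 hz.2.1
    refine hunb (p.1.re * min c₁ c₂) (mul_pos hre' (lt_min hc₁ hc₂)) (fun x hx => ⟨?_, ?_⟩) ψ
      ((hsol ψ).1 hψ) hψb
    · exact (mul_le_mul_of_nonneg_left ((min_le_left _ _).trans (h₁ x hx)) hre'.le).trans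
        (le_re_m₂ hre'.le hx)
    · rw [Complex.div_ofReal_re, div_eq_mul_one_div]
      exact mul_le_mul_of_nonneg_left ((min_le_right _ _).trans (h₂ x hx)) hre'.le
  · rw [← D.right_col_zero le_rfl (hs0 p hp 0 le_rfl) (g p 0)]
    exact hval i

end Profile

end ZND

namespace ZND

namespace Profile

variable {M : ThermoModel} {D : Profile M} {β d ρ : ℝ} {K : Set (ℂ × ℝ)}

/-! ### Decaying solutions, uniformly away from the branch points -/

/-- If `Re ζ` is bounded below, the coupling of `μ₃` into `μ₂` is dominated by the growth of `μ₂`,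
and row `1` of `left` needs no correction. -/
lemma exists_decaying_of_le_re (hrate : M.RateAssumption) (hd : 0 < d) {δ : ℝ} (hδ : 0 < δ) :
    ∃ C ε₀ : ℝ, 1 ≤ ε₀ ∧ ∀ p ∈ D.params d ρ ∩ {p | δ ≤ p.1.re}, ε₀ ≤ p.2 →
      ∃ θ : ℝ → Fin 5 → ℂ, D.IsExactDecayingSolution (p.2 * p.1) p.2 θ ∧
      ∀ i, ‖θ 0 i - D.Te1 0 p.1 i‖ ≤ C / p.2 := by
  obtain ⟨β, hβ⟩ := D.exists_hasRate
  set K := D.params d ρ ∩ {p : ℂ × ℝ | δ ≤ p.1.re} with hKdef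
  have hK : K ⊆ D.params d ρ := inter_subset_left
  have hs := hβ.level_s hd hK 1
  have hc := hβ.level_sound (K := K) 1
  have hu := hβ.level_vel (K := K) 1
  have hb : ULevel K β 1 (fun p x =>
      acousticCoupling (D.u x) (D.c0 x) (D.gapSq x) p.1 (D.s x p.1)) :=
    (((((hc.mul hs).sub (hu.mul (level_freq hK 1))).mul hc).div_away
      (((ULevel.cst 2).mul (hβ.level_gapSq 1)).mul hs)
      (((UAway.cst two_ne_zero).mul away_gapSq).mul (away_s hd hK)))).neg
  refine exists_decaying_of_coupling hrate hβ hd hK (g := fun _ _ => 0) (ULevel.cst 0) hb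
    (fun p _ x _ => by ring) ?_
  obtain ⟨B, hB⟩ := hb.bdd
  obtain ⟨c, hc0, h⟩ := D.exists_pos_le (f := fun z => 1 / (M.c0 (thermo z) + z.2.1))
    (contDiffOn_const.div (ThermoModel.contDiffOn_sound.add ThermoModel.contDiffOn_vel)
      fun z hz => (add_pos (hz.2.1.trans (ThermoModel.vel_lt_sound hz)) hz.2.1).ne')
    fun z hz => one_div_pos.2 (add_pos (hz.2.1.trans (ThermoModel.vel_lt_sound hz)) hz.2.1)
  refine ⟨(|B| + 1) / (δ * c), by positivity, fun p hp x hx => (hB p hp x hx).trans ?_⟩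
  have h1 : δ * c ≤ (D.m₂ x p.1).re :=
    (mul_le_mul hp.2 (h x hx) hc0.le (hK hp).1.1).trans (le_re_m₂ (hK hp).1.1 hx)
  calc B ≤ |B| + 1 := by linarith [le_abs_self B]
    _ = (|B| + 1) / (δ * c) * (δ * c) := by field_simp
    _ ≤ _ := mul_le_mul_of_nonneg_left h1 (by positivity)

/-- If `Re ζ` is less than `u`, then `μ₂` and `μ₃` stay apart, since
`(c ζ - u s) (c ζ + u s) = q (ζ - u) (ζ + u)`, and the coupling can be removed. -/
lemma exists_decaying_of_re_le (hrate : M.RateAssumption) (hd : 0 < d) {δ : ℝ} (hδ : 0 < δ)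
    (hδu : ∀ x, 0 ≤ x → 2 * δ ≤ D.u x) :
    ∃ C ε₀ : ℝ, 1 ≤ ε₀ ∧ ∀ p ∈ D.params d ρ ∩ {p | p.1.re ≤ δ}, ε₀ ≤ p.2 →
      ∃ θ : ℝ → Fin 5 → ℂ, D.IsExactDecayingSolution (p.2 * p.1) p.2 θ ∧
      ∀ i, ‖θ 0 i - D.Te1 0 p.1 i‖ ≤ C / p.2 := by
  obtain ⟨β, hβ⟩ := D.exists_hasRate
  set K := D.params d ρ ∩ {p : ℂ × ℝ | p.1.re ≤ δ} with hKdef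
  have hK : K ⊆ D.params d ρ := inter_subset_left
  have hs := hβ.level_s hd hK 2
  have hc := hβ.level_sound (K := K) 2
  have hu := hβ.level_vel (K := K) 2
  have hz := level_freq (β := β) hK 2
  have haway : UAway K (fun p x => (D.c0 x : ℂ) * p.1 - D.u x * D.s x p.1) := by
    refine UAway.of_mul (g := fun p x => (D.c0 x : ℂ) * p.1 + D.u x * D.s x p.1) ?_
      ((hc.mul hz).add (hu.mul hs)).bdd
    have h1 : UAway K (fun p x => p.1 - (D.u x : ℂ)) := ⟨δ, hδ, fun p hp x hx => by
      have h1 := Complex.abs_re_le_norm (p.1 - (D.u x : ℂ))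
      have h2 : p.1.re ≤ δ := hp.2
      rw [Complex.sub_re, Complex.ofReal_re] at h1
      linarith [neg_abs_le (p.1.re - D.u x), hδu x hx]⟩
    have h2 : UAway K (fun p x => p.1 + (D.u x : ℂ)) := ⟨δ, hδ, fun p hp x hx => by
      have h1 := Complex.abs_re_le_norm (p.1 + (D.u x : ℂ))
      have h2 : 0 ≤ p.1.re := (hK hp).1.1
      rw [Complex.add_re, Complex.ofReal_re] at h1
      linarith [le_abs_self (p.1.re + D.u x), hδu x hx]⟩
    obtain ⟨c, hc0, h⟩ := ((away_gapSq (D := D)).mul h1).mul h2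
    refine ⟨c, hc0, fun p hp x hx => (h p hp x hx).trans_eq ?_⟩
    congr 1
    have h3 := D.s_sq hx p.1
    have h4 : (D.gapSq x : ℂ) = (D.c0 x : ℂ) ^ 2 - (D.u x : ℂ) ^ 2 := by
      rw [gapSq]; push_cast; ring
    linear_combination (D.u x : ℂ) ^ 2 * h3 + p.1 ^ 2 * h4
  have hg : ULevel K β 2 (fun p x => (D.c0 x * D.s x p.1 - D.u x * p.1) * D.u x /
      (2 * D.s x p.1 * (D.c0 x * p.1 - D.u x * D.s x p.1))) :=
    (((hc.mul hs).sub (hu.mul hz)).mul hu).div_away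
      (((ULevel.cst 2).mul hs).mul ((hc.mul hz).sub (hu.mul hs)))
      (((UAway.cst two_ne_zero).mul (away_s hd hK)).mul haway)
  refine exists_decaying_of_coupling hrate hβ hd hK hg (ULevel.cst 0) (fun p hp x hx => ?_)
    ⟨1, one_pos, fun p hp x hx => ?_⟩
  · have h1 := haway.ne_zero hp hx
    have h2 := (away_s hd hK).ne_zero hp hx
    have h3 : (D.u x : ℂ) ≠ 0 := Complex.ofReal_ne_zero.2 (D.vel_pos hx).ne'
    have h4 : (D.gapSq x : ℂ) ≠ 0 := Complex.ofReal_ne_zero.2 (D.gapSq_pos hx).ne'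
    beta_reduce at h1 ⊢
    rw [D.gap₃₂_eq hx, acousticCoupling]
    generalize (D.c0 x : ℂ) * p.1 - D.u x * D.s x p.1 = w at *
    field_simp
    ring
  · rw [norm_zero, one_mul]
    have h1 := (hK hp).1.1
    have h2 := D.vel_pos hx
    have h3 := D.sound_pos hx
    exact le_trans (by positivity) (le_re_m₂ h1 hx)

variable (D) in
/-- The exact decaying solution at frequencies away from the branch points: the regimes in which
`Re ζ` is bounded below and in which it is less than `u` cover all of them. -/
theorem exists_decaying (hrate : M.RateAssumption) (hd : 0 < d) (ρ : ℝ) :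
    ∃ C ε₀ : ℝ, 1 ≤ ε₀ ∧ ∀ ζ ∈ D.awayFromTurning d ρ, ∀ ε, ε₀ ≤ ε → ∃ θ : ℝ → Fin 5 → ℂ,
      D.IsExactDecayingSolution (ε * ζ) ε θ ∧ ∀ i, ‖θ 0 i - D.Te1 0 ζ i‖ ≤ C / ε := by
  obtain ⟨u₀, _, hu₀, hu⟩ := D.u_bounds
  obtain ⟨C₁, ε₁, hε₁, h₁⟩ := exists_decaying_of_le_re (D := D) (ρ := ρ) hrate hd (half_pos hu₀)
  obtain ⟨C₂, ε₂, hε₂, h₂⟩ := exists_decaying_of_re_le (D := D) (ρ := ρ) hrate hd (half_pos hu₀)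
    fun x hx => by linarith [(hu x hx).1]
  refine ⟨max C₁ C₂, max ε₁ ε₂, hε₁.trans (le_max_left _ _), fun ζ hζ ε hε => ?_⟩
  have hε1 : ε₁ ≤ ε := (le_max_left _ _).trans hε
  have hε2 : ε₂ ≤ ε := (le_max_right _ _).trans hε
  have hε0 : 0 ≤ ε := by linarith
  rcases le_total (u₀ / 2) ζ.re with h | h
  · obtain ⟨θ, hθ, hv⟩ := h₁ (ζ, ε) ⟨⟨hζ, hε₁.trans hε1⟩, h⟩ hε1
    exact ⟨θ, hθ, fun i => (hv i).trans (div_le_div_of_nonneg_right (le_max_left _ _) hε0)⟩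
  · obtain ⟨θ, hθ, hv⟩ := h₂ (ζ, ε) ⟨⟨hζ, hε₁.trans hε1⟩, h⟩ hε2
    exact ⟨θ, hθ, fun i => (hv i).trans (div_le_div_of_nonneg_right (le_max_right _ _) hε0)⟩

/-! ### Normalization -/

lemma IsExactDecayingSolution.smul {τ : ℂ} {ε : ℝ} {θ : ℝ → Fin 5 → ℂ}
    (h : D.IsExactDecayingSolution τ ε θ) {a : ℂ} (ha : a ≠ 0) :
    D.IsExactDecayingSolution τ ε (fun x => a • θ x) := by
  have hmult : ∀ {ψ : ℝ → Fin 5 → ℂ}, (∃ c : ℂ, ∀ x, 0 ≤ x → ψ x = c • θ x) →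
      ∃ c : ℂ, ∀ x, 0 ≤ x → ψ x = c • a • θ x := by
    rintro ψ ⟨c, hc⟩
    exact ⟨c / a, fun x hx => by rw [hc x hx, smul_smul, div_mul_cancel₀ _ ha]⟩
  refine ⟨⟨fun x hx => ?_, ?_, ?_⟩, fun ψ hψ => hmult (h.unique ψ hψ),
    fun hre ψ hψ hb => hmult (h.unique_of_bounded hre ψ hψ hb)⟩
  · refine ((h.decaying.solves x hx).const_smul a).congr_deriv ?_
    rw [Matrix.mulVec_smul, smul_neg]
  · obtain ⟨C, hC⟩ := h.decaying.bounded
    exact ⟨‖a‖ * C, fun x hx => by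
      rw [norm_smul]; exact mul_le_mul_of_nonneg_left (hC x hx) (norm_nonneg _)⟩
  · obtain ⟨c, hc, hl⟩ := h.decaying.asymptotic
    exact ⟨a • c, smul_ne_zero ha hc, (hl.const_smul a).congr fun x => smul_comm _ _ _⟩

variable (D) in
lemma Te1_affine : ∃ α γ δ : Fin 5 → ℂ, ∀ ζ i,
    D.Te1 0 ζ i = α i * D.s 0 ζ + γ i * ζ + δ i := by
  refine ⟨![D.m 0 / (D.kappa 0 * D.u 0), 0, 0,
    -(D.kappa 0 * partialS M.p (D.state 0) / (D.u 0 * D.m 0)),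
    -(D.kappa 0 * partialLam M.p (D.state 0) / (D.u 0 * D.m 0))], ![0, 1 / D.u 0, 0, 0, 0],
    ![0, 0, -Complex.I, 0, 0], fun ζ i => ?_⟩
  simp only [Te1, Matrix.mulVec_single_one, Matrix.col_apply, T]
  fin_cases i <;> simp <;> ring

variable (D) in
lemma Te1_two (ζ : ℂ) : D.Te1 0 ζ 2 = -Complex.I := by
  simp [Te1, T]

variable (D) in
lemma exists_Te1_bound (hd : 0 < d) (ρ : ℝ) : ∃ B, 0 ≤ B ∧
    (∀ ζ ∈ D.awayFromTurning d ρ, ∀ i, ‖D.Te1 0 ζ i‖ ≤ B) ∧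
    ∀ ζ ∈ D.awayFromTurning d ρ, ∀ ζ' ∈ D.awayFromTurning d ρ, ∀ i,
      ‖D.Te1 0 ζ i - D.Te1 0 ζ' i‖ ≤ B * ‖ζ - ζ'‖ := by
  obtain ⟨α, γ, δ, h⟩ := D.Te1_affine
  obtain ⟨β, hβ⟩ := D.exists_hasRate
  obtain ⟨σ, hσ⟩ := (hβ.level_s hd (Subset.refl (D.params d ρ)) 0).bdd
  set L := 2 * Real.sqrt (ρ + D.turning 0) / Real.sqrt d with hL
  have hL0 : 0 ≤ L := by positivity
  set A := ∑ i, (‖α i‖ + ‖γ i‖ + ‖δ i‖) with hA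
  have hA0 : 0 ≤ A := Finset.sum_nonneg fun _ _ => by positivity
  have hAi : ∀ i, ‖α i‖ + ‖γ i‖ + ‖δ i‖ ≤ A := fun i =>
    Finset.single_le_sum (f := fun i => ‖α i‖ + ‖γ i‖ + ‖δ i‖) (fun _ _ => by positivity)
      (Finset.mem_univ i)
  have hα : ∀ i, ‖α i‖ ≤ A := fun i => by
    linarith [hAi i, norm_nonneg (α i), norm_nonneg (γ i), norm_nonneg (δ i)]
  have hγ : ∀ i, ‖γ i‖ ≤ A := fun i => by
    linarith [hAi i, norm_nonneg (α i), norm_nonneg (γ i), norm_nonneg (δ i)]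
  have hδ : ∀ i, ‖δ i‖ ≤ A := fun i => by
    linarith [hAi i, norm_nonneg (α i), norm_nonneg (γ i), norm_nonneg (δ i)]
  refine ⟨A * (|σ| + |ρ| + 1 + L), by positivity, fun ζ hζ i => ?_, fun ζ hζ ζ' hζ' i => ?_⟩
  · have h1 : ‖D.s 0 ζ‖ ≤ |σ| := (hσ (ζ, 1) ⟨hζ, le_rfl⟩ 0 le_rfl).trans (le_abs_self _)
    have h2 : ‖ζ‖ ≤ |ρ| := hζ.2.1.trans (le_abs_self _)
    rw [h]
    calc _ ≤ ‖α i‖ * ‖D.s 0 ζ‖ + ‖γ i‖ * ‖ζ‖ + ‖δ i‖ := by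
          refine (norm_add_le _ _).trans (add_le_add ((norm_add_le _ _).trans ?_) le_rfl)
          rw [norm_mul, norm_mul]
      _ ≤ A * |σ| + A * |ρ| + A := add_le_add (add_le_add
          (mul_le_mul (hα i) h1 (norm_nonneg _) hA0) (mul_le_mul (hγ i) h2 (norm_nonneg _) hA0))
          (hδ i)
      _ ≤ _ := by nlinarith [mul_nonneg hA0 hL0]
  · have ht : ‖Complex.I * (D.turning 0 : ℂ)‖ = D.turning 0 := by
      rw [norm_mul, Complex.norm_I, one_mul, Complex.norm_real, Real.norm_eq_abs,
        abs_of_pos (D.turning_pos le_rfl)]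
    have h1 : ‖D.s 0 ζ - D.s 0 ζ'‖ ≤ L * ‖ζ - ζ'‖ :=
      norm_sqrtBranch_sub_le hd hζ.1 hζ'.1 (hζ.2.2 0 le_rfl).1 (hζ.2.2 0 le_rfl).2
        ((norm_sub_le _ _).trans (add_le_add hζ'.2.1 ht.le))
        ((norm_add_le _ _).trans (add_le_add hζ.2.1 ht.le))
    have h2 : D.Te1 0 ζ i - D.Te1 0 ζ' i = α i * (D.s 0 ζ - D.s 0 ζ') + γ i * (ζ - ζ') := by
      rw [h, h]; ring
    have hn := norm_nonneg (ζ - ζ')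
    rw [h2]
    calc _ ≤ ‖α i‖ * ‖D.s 0 ζ - D.s 0 ζ'‖ + ‖γ i‖ * ‖ζ - ζ'‖ := by
          refine (norm_add_le _ _).trans ?_
          rw [norm_mul, norm_mul]
      _ ≤ A * (L * ‖ζ - ζ'‖) + A * ‖ζ - ζ'‖ := add_le_add
          (mul_le_mul (hα i) h1 (norm_nonneg _) hA0) (mul_le_mul_of_nonneg_right (hγ i) hn)
      _ ≤ _ := by
          have h3 : 0 ≤ A * (|σ| + |ρ|) * ‖ζ - ζ'‖ := by positivity
          nlinarith

variable (D) in
open Classical in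
/-- The exact decaying solution whose component `2` at `x = 0` is that of `T e₁`, if there is
one. -/
def normalizedSolution (τ : ℂ) (ε : ℝ) : ℝ → Fin 5 → ℂ :=
  if h : ∃ ψ, D.IsExactDecayingSolution τ ε ψ ∧ ψ 0 2 = -Complex.I then h.choose else 0

/-- Normalization preserves the approximation of the initial value. -/
lemma normalizedSolution_spec {τ ζ : ℂ} {ε e B : ℝ} {θ : ℝ → Fin 5 → ℂ}
    (h : D.IsExactDecayingSolution τ ε θ) (he : e ≤ 1 / 2) (hB : ∀ i, ‖D.Te1 0 ζ i‖ ≤ B)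
    (hθ : ∀ i, ‖θ 0 i - D.Te1 0 ζ i‖ ≤ e) :
    D.IsExactDecayingSolution τ ε (D.normalizedSolution τ ε) ∧
      ∀ i, ‖D.normalizedSolution τ ε 0 i - D.Te1 0 ζ i‖ ≤ 2 * (1 + B) * e := by
  have he0 : 0 ≤ e := (norm_nonneg _).trans (hθ 0)
  have h2 := hθ 2
  rw [D.Te1_two] at h2
  have hlow : 1 / 2 ≤ ‖θ 0 2‖ := by
    have h3 := norm_sub_norm_le (-Complex.I) (θ 0 2)
    rw [norm_sub_rev, norm_neg, Complex.norm_I] at h3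
    linarith
  have h0 : θ 0 2 ≠ 0 := norm_pos_iff.1 (by linarith)
  have hex : ∃ ψ, D.IsExactDecayingSolution τ ε ψ ∧ ψ 0 2 = -Complex.I :=
    ⟨_, h.smul (div_ne_zero (neg_ne_zero.2 Complex.I_ne_zero) h0), by
      simp only [Pi.smul_apply, smul_eq_mul, div_mul_cancel₀ _ h0]⟩
  have hspec : D.normalizedSolution τ ε = hex.choose := dif_pos hex
  rw [hspec]
  obtain ⟨hψ, hψ2⟩ := hex.choose_spec
  generalize hex.choose = ψ at *
  refine ⟨hψ, fun i => ?_⟩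
  obtain ⟨a, ha⟩ := h.unique ψ hψ.decaying
  have ha2 : a * θ 0 2 = -Complex.I := by
    rw [← hψ2, ha 0 le_rfl, Pi.smul_apply, smul_eq_mul]
  have hna : ‖a‖ ≤ 2 := by
    have h3 : ‖a‖ * ‖θ 0 2‖ = 1 := by rw [← norm_mul, ha2, norm_neg, Complex.norm_I]
    nlinarith [norm_nonneg a]
  have hna1 : ‖a - 1‖ ≤ 2 * e := by
    have h3 : ‖a - 1‖ * ‖θ 0 2‖ ≤ e := by
      rw [← norm_mul, sub_mul, ha2, one_mul, norm_sub_rev]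
      exact h2
    nlinarith [norm_nonneg (a - 1)]
  have h3 : ψ 0 i - D.Te1 0 ζ i = a * (θ 0 i - D.Te1 0 ζ i) + (a - 1) * D.Te1 0 ζ i := by
    rw [ha 0 le_rfl, Pi.smul_apply, smul_eq_mul]; ring
  rw [h3]
  calc _ ≤ ‖a‖ * ‖θ 0 i - D.Te1 0 ζ i‖ + ‖a - 1‖ * ‖D.Te1 0 ζ i‖ := by
        refine (norm_add_le _ _).trans ?_
        rw [norm_mul, norm_mul]
    _ ≤ 2 * e + 2 * e * B := add_le_add (mul_le_mul hna (hθ i) (norm_nonneg _) zero_le_two)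
        (mul_le_mul hna1 (hB i) (norm_nonneg _) (by positivity))
    _ = _ := by ring

/-! ### Compact sets of frequencies outside Class III -/

variable (D)

lemma bddAbove_turningValues : BddAbove D.turningValues := by
  obtain ⟨β, hβ⟩ := D.exists_hasRate
  obtain ⟨C, hC⟩ := (hβ.level (K := (univ : Set Unit)) contDiffOn_turning 0).bdd
  refine ⟨C, ?_⟩
  rintro _ ⟨x, hx, rfl⟩
  have h := hC () trivial x hx
  rw [Complex.norm_real, Real.norm_eq_abs] at h
  exact (le_abs_self _).trans h

lemma bddBelow_turningValues : BddBelow D.turningValues := by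
  refine ⟨0, ?_⟩
  rintro _ ⟨x, hx, rfl⟩
  exact (D.turning_pos hx).le

lemma isClosed_classIII : IsClosed D.classIII := by
  refine (isClosed_eq Complex.continuous_re continuous_const).inter ?_
  exact (isClosed_le continuous_const continuous_norm).inter
    (isClosed_le continuous_norm continuous_const)

lemma mem_classIII {x : ℝ} (hx : 0 ≤ x) {z : ℂ} (hre : z.re = 0) (hz : ‖z‖ = D.turning x) :
    z ∈ D.classIII := by
  have hmem : D.turning x ∈ D.turningValues := ⟨x, hx, rfl⟩
  refine ⟨hre, ?_, ?_⟩
  · rw [hz]; exact csInf_le D.bddBelow_turningValues hmem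
  · rw [hz]; exact le_csSup D.bddAbove_turningValues hmem

lemma exists_awayFromTurning {K : Set ℂ} (hK : IsCompact K)
    (hsub : K ⊆ {ζ : ℂ | 0 ≤ ζ.re} \ D.classIII) :
    ∃ d ρ : ℝ, 0 < d ∧ ∀ ζ ∈ K, ∀ w : ℂ, 0 ≤ w.re → ‖w - ζ‖ ≤ d → w ∈ D.awayFromTurning d ρ := by
  have hdisj : Disjoint K D.classIII := disjoint_left.2 fun z hz => (hsub hz).2
  obtain ⟨r, hr, hr'⟩ := Metric.exists_pos_forall_lt_edist hK D.isClosed_classIII hdisj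
  obtain ⟨ρ, hρ⟩ := hK.isBounded.exists_norm_le
  have hr0 : (0 : ℝ) < r := hr
  refine ⟨r / 2, ρ + r / 2, by positivity, fun ζ hζ w hw hwζ => ⟨hw, ?_, fun x hx => ?_⟩⟩
  · calc ‖w‖ = ‖ζ + (w - ζ)‖ := by ring_nf
      _ ≤ ‖ζ‖ + ‖w - ζ‖ := norm_add_le _ _
      _ ≤ _ := add_le_add (hρ ζ hζ) hwζ
  · have ht : ‖Complex.I * (D.turning x : ℂ)‖ = D.turning x := by
      rw [norm_mul, Complex.norm_I, one_mul, Complex.norm_real, Real.norm_eq_abs,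
        abs_of_pos (D.turning_pos hx)]
    have key : ∀ z : ℂ, z.re = 0 → ‖z‖ = D.turning x → (r : ℝ) / 2 ≤ ‖w - z‖ := by
      intro z hz hz'
      have h1 := hr' ζ hζ z (D.mem_classIII hx hz hz')
      rw [edist_nndist, ENNReal.coe_lt_coe] at h1
      have h2 : (r : ℝ) < ‖ζ - z‖ := by
        rw [← dist_eq_norm, ← coe_nndist]; exact_mod_cast h1
      have h3 : ‖ζ - z‖ ≤ ‖w - ζ‖ + ‖w - z‖ := by
        rw [norm_sub_rev w ζ]
        calc ‖ζ - z‖ = ‖(ζ - w) + (w - z)‖ := by ring_nf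
          _ ≤ _ := norm_add_le _ _
      linarith
    refine ⟨key _ (by simp) ht, ?_⟩
    have h1 := key (-(Complex.I * D.turning x)) (by simp) (by rw [norm_neg, ht])
    rwa [sub_neg_eq_add] at h1

end Profile

lemma euclid_le {w : Fin 5 → ℂ} {b : ℝ} (h : ∀ i, ‖w i‖ ≤ b) : euclid w ≤ 5 * b := by
  have hb : 0 ≤ b := (norm_nonneg _).trans (h 0)
  rw [euclid, EuclideanSpace.norm_eq, Real.sqrt_le_left (by positivity)]
  calc ∑ i, ‖(WithLp.toLp 2 w : EuclideanSpace ℂ (Fin 5)) i‖ ^ 2 ≤ ∑ _i : Fin 5, b ^ 2 :=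
        Finset.sum_le_sum fun i _ => pow_le_pow_left₀ (norm_nonneg _) (h i) 2
    _ ≤ _ := by simp; nlinarith [sq_nonneg b]

end ZND

end

theorem corollary2p2 (M : ZND.ThermoModel) (hrate : M.RateAssumption) (D : ZND.Profile M) :
    ∃ θ : ℂ → ℝ → ℝ → Fin 5 → ℂ,
      (∀ ζ : ℂ, 0 ≤ ζ.re → ζ ∉ D.classIII → ∀ R : ℝ, ∃ C ε₀ : ℝ, 0 < ε₀ ∧
        ∀ ν : ℂ, 0 ≤ ν.re → ‖ν‖ ≤ R → ∀ ε : ℝ, ε₀ ≤ ε →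
          D.IsExactDecayingSolution (ε * ζ + ν) ε (θ (ε * ζ + ν) ε) ∧
          ZND.euclid (θ (ε * ζ + ν) ε 0 - D.Te1 0 ζ) ≤ C / ε) ∧
      (∀ K : Set ℂ, IsCompact K → K ⊆ {ζ : ℂ | 0 ≤ ζ.re} \ D.classIII →
        ∀ R : ℝ, ∃ C ε₀ : ℝ, 0 < ε₀ ∧
          ∀ ζ ∈ K, ∀ ν : ℂ, 0 ≤ ν.re → ‖ν‖ ≤ R → ∀ ε : ℝ, ε₀ ≤ ε →
            D.IsExactDecayingSolution (ε * ζ + ν) ε (θ (ε * ζ + ν) ε) ∧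
            ZND.euclid (θ (ε * ζ + ν) ε 0 - D.Te1 0 ζ) ≤ C / ε) := by
  refine ⟨D.normalizedSolution, ?_⟩
  rw [and_iff_right_of_imp]
  · intro K hK hsub R
    obtain ⟨d, ρ, hd, haway⟩ := D.exists_awayFromTurning hK hsub
    obtain ⟨C, ε₁, hε₁, hex⟩ := D.exists_decaying hrate hd ρ
    obtain ⟨B, hB0, hB, hLip⟩ := D.exists_Te1_bound hd ρ
    refine ⟨5 * (2 * (1 + B) * |C| + B * |R|), max ε₁ (max (|R| / d) (2 * |C|)),
      by linarith [le_max_left ε₁ (max (|R| / d) (2 * |C|))], fun ζ hζ ν hν hνR ε hε => ?_⟩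
    have h1 : ε₁ ≤ ε := (le_max_left _ _).trans hε
    have h2 : |R| / d ≤ ε := ((le_max_left _ _).trans (le_max_right _ _)).trans hε
    have h3 : 2 * |C| ≤ ε := ((le_max_right _ _).trans (le_max_right _ _)).trans hε
    have hε0 : 0 < ε := by linarith
    have hεC : (ε : ℂ) ≠ 0 := Complex.ofReal_ne_zero.2 hε0.ne'
    have hre : 0 ≤ ζ.re := (hsub hζ).1
    -- `ν` is absorbed into the frequency
    set w : ℂ := ζ + ν / ε with hw
    have hτ : (ε : ℂ) * ζ + ν = ε * w := by rw [hw]; field_simp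
    have hwζ : ‖w - ζ‖ ≤ |R| / ε := by
      rw [hw, add_sub_cancel_left, norm_div, Complex.norm_real, Real.norm_eq_abs, abs_of_pos hε0]
      exact div_le_div_of_nonneg_right (hνR.trans (le_abs_self R)) hε0.le
    have hRd : |R| / ε ≤ d := by
      rw [div_le_iff₀ hd] at h2
      rw [div_le_iff₀ hε0]
      linarith
    have hwre : 0 ≤ w.re := by
      rw [hw, Complex.add_re, Complex.div_ofReal_re]
      positivity
    have hwmem := haway ζ hζ w hwre (hwζ.trans hRd)
    have hζmem := haway ζ hζ ζ hre (by rw [sub_self, norm_zero]; exact hd.le)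
    obtain ⟨θ, hθ, hv⟩ := hex w hwmem ε h1
    have hCε : |C| / ε ≤ 1 / 2 := by rw [div_le_iff₀ hε0]; linarith
    obtain ⟨hn, hnv⟩ := ZND.Profile.normalizedSolution_spec hθ hCε (hB w hwmem)
      fun i => (hv i).trans (div_le_div_of_nonneg_right (le_abs_self C) hε0.le)
    rw [hτ]
    refine ⟨hn, ?_⟩
    rw [mul_div_assoc]
    refine ZND.euclid_le fun i => ?_
    have h4 := hLip w hwmem ζ hζmem i
    calc _ = ‖(D.normalizedSolution (ε * w) ε 0 i - D.Te1 0 w i) +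
          (D.Te1 0 w i - D.Te1 0 ζ i)‖ := by rw [Pi.sub_apply]; ring_nf
      _ ≤ 2 * (1 + B) * (|C| / ε) + B * (|R| / ε) :=
        (norm_add_le _ _).trans (add_le_add (hnv i)
          (h4.trans (mul_le_mul_of_nonneg_left hwζ hB0)))
      _ = _ := by ring
  · intro h ζ hζ hζ3 R
    obtain ⟨C, ε₀, hε₀, h'⟩ := h {ζ} isCompact_singleton (singleton_subset_iff.2 ⟨hζ, hζ3⟩) R
    exact ⟨C, ε₀, hε₀, h' ζ rfl⟩
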